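/- Let $\mathbb K\in\{\mathbb R,\mathbb C\}$ and let $(M,g)$ be a smooth pseudo-Riemannian spin manifold of signature $(s,t)$ with Levi-Civita connection $\nabla$. Clifford multiplication is normalised by $vw+wv=-2g(v,w)$, and the spin structure is given by spin-group valued transition functions, where the spin group consists of the even elements $a$ of the Lipschitz group with $a\bar a=1$. Let $S\to M$ be the $\mathbb K$-vector bundle associated to the spin structure and a finite-dimensional representation over $\mathbb K$ of the even Clifford algebra (for example a real or complex spinor representation), and let $C$ be the bilinear form on $S$ induced by a nondegenerate $\mathfrak{spin}$-invariant $\mathbb K$-bilinear form on the typical fibre. Write $\nabla$ also for the induced connection on $S$ and on $\Lambda S$. Let $\mathfrak A=\Gamma\Lambda S$ (exterior algebra over $\mathbb K$) be the superalgebra of functions of the special graded manifold $\hat M$, and let $\mathfrak X(\hat M)=\mathfrak X(\hat M)_0\oplus\mathfrak X(\hat M)_1$ be the superderivations of $\mathfrak A$. A vector field $X$ on $M$ and a section $\varphi$ of $S$ define $\jmath(X)=\nabla_X\in\mathfrak X(\hat M)_0$ and $\jmath(\varphi)=\varphi\rfloor\in\mathfrak X(\hat M)_1$, where $\varphi\rfloor$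 is the odd derivation with $\varphi\rfloor f=0$ for $f\in C^\infty(M,\mathbb K)$ and $\varphi\rfloor\psi=C(\varphi,\psi)$ for $\psi\in\Gamma S$. An endomorphism of $S$ acts on $\mathfrak A$ as the even derivation extending it. The metric of $\hat M$ is the unique even bilinear form $h:\mathfrak X(\hat M)\times\mathfrak X(\hat M)\to\mathfrak A$ (biadditive, with $h(fV,W)=f\,h(V,W)$, and $h(V,fW)=(-1)^{|V||f|}f\,h(V,W)$ for homogeneous $V,f$) such that $$h(\jmath X,\jmath Y)=g(X,Y),\quad h(\jmath\varphi,\jmath\psi)=C(\varphi,\psi),\quad h(\jmath X,\jmath\varphi)=h(\jmath\varphi,\jmath X)=0 .$$ An even field $W\in\mathfrak X(\hat M)_0$ is called an even Killing field if $\mathcal L_Wh=0$, i.e. $W(h(V,Z))-h([W,V],Z)-h(V,[W,Z])=0$ for all $V,Z\in\mathfrak X(\hat M)$. Fix $\alpha\in\mathbb K$. For a vector field $X$ on $M$ put $$\mathfrak e_\alpha(X)=\jmath(X)-(\nabla X)_{\mathfrak a}+\alpha\,\mathrm{tr}(\nabla X)\,\mathbf 1_S ,$$ where, in a local orthonormal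 frame $(e_k)$ with $\gamma^k=g(e_k,e_k)\,e_k$ in the Clifford algebra, $(\nabla X)_{\mathfrak a}=\frac14\sum_{k,l}\frac12\big(g(\nabla_{e_k}X,e_l)-g(\nabla_{e_l}X,e_k)\big)\gamma^k\gamma^l$ acts on $S$. Then $\jmath$, $h$ and $\mathfrak e_\alpha(X)\in\mathfrak X(\hat M)_0$ are well defined, and for every smooth vector field $X$ on $M$, $\mathfrak e_\alpha(X)$ is an even Killing field of $\hat M$ if and only if $X$ is a Killing vector field of $(M,g)$. Moreover, for Killing vector fields $X,Y$ on $M$, $$[\mathfrak e_\alpha(X),\mathfrak e_\alpha(Y)]=\mathfrak e_\alpha([X,Y]).$$ -/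

import Mathlib

open scoped Manifold ContDiff
open Bundle

noncomputable section

namespace SuperKilling

/-! ### The spin representation and the charge conjugation on the typical fibre -/

/-- The model space `ℝ^{s,t}`: `s` coordinates of positive and `t` of negative sign. -/
abbrev ModelVec (s t : ℕ) : Type := Fin s ⊕ Fin t → ℝ

/-- The entries `±1` of the diagonal model metric. -/
def eta {s t : ℕ} : Fin s ⊕ Fin t → ℝ := Sum.elim (fun _ => 1) (fun _ => -1)

/-- The quadratic form `-g`, so that the Clifford relation is `v w + w v = -2 g(v, w)`. -/
def cliffordForm (s t : ℕ) : QuadraticForm ℝ (ModelVec s t) :=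
  QuadraticMap.weightedSumSquares ℝ (fun k => -eta k)

/-- The Clifford algebra `Cl_{s,t}`. -/
abbrev Cl (s t : ℕ) : Type := CliffordAlgebra (cliffordForm s t)

/-- The typical fibre: a representation, over `𝕜 = ℝ` or `ℂ`, of the even Clifford algebra (which
contains the group `Spin` and its Lie algebra), with a nondegenerate bilinear form that is
invariant under `𝔰𝔭𝔦𝔫`, the span of the commutators `v w - w v` of vectors. -/
structure SpinModule (s t : ℕ) (𝕜 S : Type*) [RCLike 𝕜] [AddCommGroup S] [Module 𝕜 S] where
  rep : CliffordAlgebra.even (cliffordForm s t) →+* Module.End 𝕜 S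
  rep_algebraMap : ∀ r : ℝ, rep (algebraMap ℝ _ r) = (r : 𝕜) • (1 : Module.End 𝕜 S)
  charge : S →ₗ[𝕜] S →ₗ[𝕜] 𝕜
  charge_nondegenerate : charge.Nondegenerate
  charge_invariant : ∀ (v w : ModelVec s t) (φ ψ : S),
    charge (rep ((CliffordAlgebra.even.ι (cliffordForm s t)).bilin v w
        - (CliffordAlgebra.even.ι (cliffordForm s t)).bilin w v) φ) ψ
      + charge φ (rep ((CliffordAlgebra.even.ι (cliffordForm s t)).bilin v w
        - (CliffordAlgebra.even.ι (cliffordForm s t)).bilin w v) ψ) = 0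

/-- The image `¼ B_{kl} γ^k γ^l` of a matrix in the even Clifford algebra. -/
def spinImage {s t : ℕ} (B : Fin s ⊕ Fin t → Fin s ⊕ Fin t → ℝ) :
    CliffordAlgebra.even (cliffordForm s t) :=
  (1 / 4 : ℝ) • ∑ k, ∑ l, (eta k * eta l * B k l) •
    (CliffordAlgebra.even.ι (cliffordForm s t)).bilin (Pi.single k 1) (Pi.single l 1)

namespace SpinModule

variable {s t : ℕ} {𝕜 S : Type*} [RCLike 𝕜] [AddCommGroup S] [Module 𝕜 S]

/-- The action of the spin group on the fibre. -/
def act (σ : SpinModule s t 𝕜 S) (a : spinGroup (cliffordForm s t)) : S →ₗ[𝕜] S :=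
  σ.rep ⟨a, spinGroup.mem_even a.2⟩

end SpinModule

/-- The even derivation of the exterior algebra that extends an endomorphism `A` of `S`, written
as `∑ A b_k ∧ (b^k ⌋ ·)` in a basis. -/
def derivExt {𝕜 S : Type*} [RCLike 𝕜] [AddCommGroup S] [Module 𝕜 S] [FiniteDimensional 𝕜 S]
    (A : Module.End 𝕜 S) : Module.End 𝕜 (ExteriorAlgebra 𝕜 S) :=
  ∑ k, LinearMap.mulLeft 𝕜 (ExteriorAlgebra.ι 𝕜 (A (Module.finBasis 𝕜 S k))) ∘ₗ
    CliffordAlgebra.contractLeft ((Module.finBasis 𝕜 S).coord k)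

/-- The homogeneous parts of the exterior algebra for the `ℤ/2`-grading. -/
abbrev parity (𝕜 S : Type*) [RCLike 𝕜] [AddCommGroup S] [Module 𝕜 S] (p : ZMod 2) :
    Submodule 𝕜 (ExteriorAlgebra 𝕜 S) :=
  CliffordAlgebra.evenOdd (0 : QuadraticForm 𝕜 S) p

/-- The sign `(-1)^{pq}`. -/
def superSign (p q : ZMod 2) : ℤ := if p = 1 ∧ q = 1 then -1 else 1

/-! ### Pseudo-Riemannian geometry -/

section Geometry

variable {n : ℕ} {M : Type*} [TopologicalSpace M] [ChartedSpace (EuclideanSpace ℝ (Fin n)) M]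

/-- Smooth vector fields. -/
abbrev VF (n : ℕ) (M : Type*) [TopologicalSpace M] [ChartedSpace (EuclideanSpace ℝ (Fin n)) M]
    [IsManifold (𝓡 n) ∞ M] : Type _ :=
  ContMDiffSection (𝓡 n) (EuclideanSpace ℝ (Fin n)) ∞ (TangentSpace (𝓡 n) : M → Type _)

/-- The Lie bracket of smooth vector fields. -/
def lieBracket [IsManifold (𝓡 n) ∞ M] (X Y : VF n M) : VF n M where
  toFun := VectorField.mlieBracket (𝓡 n) X Y
  contMDiff_toFun := by
    intro x
    have h1 : IsManifold (𝓡 n) (((⊤ : ℕ∞) : ℕ∞ω) + 1) M := by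
      simpa using (inferInstance : IsManifold (𝓡 n) ∞ M)
    have h2 : IsManifold (𝓡 n) (minSmoothness ℝ 2) M := by
      simpa using IsManifold.of_le (I := 𝓡 n) (M := M) (n := ∞) (m := 2)
        (WithTop.coe_le_coe.2 (le_top : (2 : ℕ∞) ≤ ⊤))
    exact ContMDiffAt.mlieBracket_vectorField (n := ⊤) (m := ⊤)
      (X.contMDiff x) (Y.contMDiff x) (by simp)

/-- The derivative of a function along a tangent vector. -/
def dirDeriv {𝕜 : Type*} [RCLike 𝕜] (f : M → 𝕜) (x : M) (v : TangentSpace (𝓡 n) x) : 𝕜 :=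
  mfderiv (𝓡 n) 𝓘(ℝ, 𝕜) f x v

/-- A smooth pseudo-Riemannian metric. -/
structure PseudoMetric (n : ℕ) (M : Type*) [TopologicalSpace M]
    [ChartedSpace (EuclideanSpace ℝ (Fin n)) M] [IsManifold (𝓡 n) ∞ M] where
  val : ∀ x : M, TangentSpace (𝓡 n) x →L[ℝ] TangentSpace (𝓡 n) x →L[ℝ] ℝ
  symm : ∀ x v w, val x v w = val x w v
  nondegenerate : ∀ x v, (∀ w, val x v w = 0) → v = 0
  smooth : ContMDiff (𝓡 n)
    ((𝓡 n).prod 𝓘(ℝ, EuclideanSpace ℝ (Fin n) →L[ℝ] EuclideanSpace ℝ (Fin n) →L[ℝ] ℝ)) ∞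
    (fun x => TotalSpace.mk' (EuclideanSpace ℝ (Fin n) →L[ℝ] EuclideanSpace ℝ (Fin n) →L[ℝ] ℝ)
      x (val x))

variable [IsManifold (𝓡 n) ∞ M] (g : PseudoMetric n M)

/-- The Koszul expression for `2 g(∇_X Y, Z)`. It is local in the three fields. -/
def koszul (X Y Z : ∀ x : M, TangentSpace (𝓡 n) x) (x : M) : ℝ :=
  dirDeriv (fun y => g.val y (Y y) (Z y)) x (X x)
    + dirDeriv (fun y => g.val y (Z y) (X y)) x (Y x)
    - dirDeriv (fun y => g.val y (X y) (Y y)) x (Z x)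
    + g.val x (VectorField.mlieBracket (𝓡 n) X Y x) (Z x)
    - g.val x (VectorField.mlieBracket (𝓡 n) Y Z x) (X x)
    + g.val x (VectorField.mlieBracket (𝓡 n) Z X x) (Y x)

/-- The Levi-Civita covariant derivative `∇_X Y` at `x`, for fields that are smooth near `x`: the
tangent vector determined by the Koszul formula. -/
def leviCivita (X Y : ∀ x : M, TangentSpace (𝓡 n) x) (x : M) : TangentSpace (𝓡 n) x :=
  Classical.epsilon fun w => ∀ Z : (∀ y : M, TangentSpace (𝓡 n) y),
    ContMDiffAt (𝓡 n) (𝓡 n).tangent ∞ (fun y => (⟨y, Z y⟩ : TangentBundle (𝓡 n) M)) x →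
      2 * g.val x w (Z x) = koszul g X Y Z x

/-- Killing vector fields: the Lie derivative of the metric vanishes. -/
def IsKilling (X : VF n M) : Prop :=
  ∀ (Y Z : VF n M) (x : M),
    dirDeriv (fun y => g.val y (Y y) (Z y)) x (X x)
      - g.val x (lieBracket X Y x) (Z x) - g.val x (Y x) (lieBracket X Z x) = 0

end Geometry

/-! ### Spin structures and special graded manifolds -/

/-- A spin structure of signature `(s, t)` for the metric `g`, given by an open cover with smooth
orthonormal frames `frame i x : ℝ^{s,t} → T_x M` and a smooth cocycle in the spin group that lifts
the changes of frame: `frame j = frame i ∘ λ(trans i j)`, where `λ(a) v = a v a⁻¹`. -/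
structure SpinStructure (s t : ℕ) {M : Type*} [TopologicalSpace M]
    [ChartedSpace (EuclideanSpace ℝ (Fin (s + t))) M] [IsManifold (𝓡 (s + t)) ∞ M]
    (g : PseudoMetric (s + t) M) (ι : Type*) where
  U : ι → Set M
  isOpen_U : ∀ i, IsOpen (U i)
  cover : ∀ x, ∃ i, x ∈ U i
  frame : ι → ∀ x : M, ModelVec s t →ₗ[ℝ] TangentSpace (𝓡 (s + t)) x
  frame_smooth : ∀ i v, ContMDiffOn (𝓡 (s + t)) (𝓡 (s + t)).tangent ∞
    (fun x => (⟨x, frame i x v⟩ : TangentBundle (𝓡 (s + t)) M)) (U i)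
  frame_orthonormal : ∀ i, ∀ x ∈ U i, ∀ v w,
    g.val x (frame i x v) (frame i x w) = ∑ k, eta k * v k * w k
  trans : ι → ι → M → spinGroup (cliffordForm s t)
  trans_smooth : ∀ i j (ℓ : Module.Dual ℝ (Cl s t)), ContMDiffOn (𝓡 (s + t)) 𝓘(ℝ, ℝ) ∞
    (fun x => ℓ (trans i j x : Cl s t)) (U i ∩ U j)
  trans_cocycle : ∀ i j k, ∀ x ∈ U i ∩ U j ∩ U k, trans i j x * trans j k x = trans i k x
  trans_frame : ∀ i j, ∀ x ∈ U i ∩ U j, ∀ v w, frame j x v = frame i x w →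
    (trans i j x : Cl s t) * CliffordAlgebra.ι (cliffordForm s t) v
      = CliffordAlgebra.ι (cliffordForm s t) w * (trans i j x : Cl s t)

/-- A special graded manifold: a pseudo-Riemannian spin manifold with the typical fibre of its
spinor bundle and the charge conjugation. -/
structure SpecialGradedManifold (s t : ℕ) (𝕜 S M ι : Type*) [RCLike 𝕜] [AddCommGroup S]
    [Module 𝕜 S] [TopologicalSpace M] [ChartedSpace (EuclideanSpace ℝ (Fin (s + t))) M]
    [IsManifold (𝓡 (s + t)) ∞ M] where
  metric : PseudoMetric (s + t) M
  spin : SpinStructure s t metric ι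
  fibre : SpinModule s t 𝕜 S

namespace SpecialGradedManifold

variable {s t : ℕ} {𝕜 S M ι : Type*} [RCLike 𝕜] [AddCommGroup S] [Module 𝕜 S]
  [TopologicalSpace M] [ChartedSpace (EuclideanSpace ℝ (Fin (s + t))) M]
  [IsManifold (𝓡 (s + t)) ∞ M] (G : SpecialGradedManifold s t 𝕜 S M ι)

/-- A choice of a frame domain around each point. Elements of the fibres of the associated bundles
at `x` are written in the frame with this index. -/
def idx (x : M) : ι := (G.spin.cover x).choose

/-- The representative of a section of the spinor bundle in the frame `i`. -/
def spinorLocal (i : ι) (φ : M → S) (x : M) : S :=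
  G.fibre.act (G.spin.trans i (G.idx x) x) (φ x)

/-- The representative of a section of the exterior bundle in the frame `i`. -/
def superLocal (i : ι) (f : M → ExteriorAlgebra 𝕜 S) (x : M) : ExteriorAlgebra 𝕜 S :=
  ExteriorAlgebra.map (G.fibre.act (G.spin.trans i (G.idx x) x)) (f x)

/-- Smooth sections of the spinor bundle. -/
def SpinorField : Type _ :=
  {φ : M → S // ∀ (i : ι) (ℓ : Module.Dual 𝕜 S),
    ContMDiffOn (𝓡 (s + t)) 𝓘(ℝ, 𝕜) ∞ (fun x => ℓ (G.spinorLocal i φ x)) (G.spin.U i)}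

variable [FiniteDimensional 𝕜 S]

/-- Functions on the graded manifold: smooth sections of the exterior bundle of `S`. -/
def superFunctions : Subalgebra 𝕜 (M → ExteriorAlgebra 𝕜 S) where
  carrier := {f | ∀ (i : ι) (ℓ : Module.Dual 𝕜 (ExteriorAlgebra 𝕜 S)),
    ContMDiffOn (𝓡 (s + t)) 𝓘(ℝ, 𝕜) ∞ (fun x => ℓ (G.superLocal i f x)) (G.spin.U i)}
  mul_mem' := by
    intro f g hf hg i ℓ
    let b := (Module.finBasis 𝕜 S).ExteriorAlgebra
    have key : (fun x => ℓ (G.superLocal i (f * g) x)) = fun x => ∑ k, ∑ l,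
        b.coord k (G.superLocal i f x) * b.coord l (G.superLocal i g x) * ℓ (b k * b l) := by
      funext x
      have h1 : G.superLocal i (f * g) x = G.superLocal i f x * G.superLocal i g x := by
        simp [superLocal]
      rw [h1]
      conv_lhs => rw [← b.sum_repr (G.superLocal i f x), ← b.sum_repr (G.superLocal i g x)]
      rw [Finset.sum_mul_sum]
      simp only [map_sum, map_smul, smul_mul_smul_comm, smul_eq_mul, Module.Basis.coord_apply]
    rw [key]
    refine contMDiffOn_finsetSum fun k _ => contMDiffOn_finsetSum fun l _ => ?_
    have hmul : ContDiff ℝ ∞ fun p : 𝕜 × 𝕜 => p.1 * p.2 * ℓ (b k * b l) := by fun_prop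
    exact hmul.contMDiff.comp_contMDiffOn ((hf i (b.coord k)).prodMk_space (hg i (b.coord l)))
  add_mem' := by
    intro f g hf hg i ℓ
    have key : (fun x => ℓ (G.superLocal i (f + g) x)) =
        fun x => ℓ (G.superLocal i f x) + ℓ (G.superLocal i g x) := by
      funext x
      simp [superLocal]
    rw [key]
    exact (hf i ℓ).add (hg i ℓ)
  algebraMap_mem' := by
    intro r i ℓ
    have key : (fun x => ℓ (G.superLocal i (algebraMap 𝕜 (M → ExteriorAlgebra 𝕜 S) r) x)) =
        fun _ => ℓ (algebraMap 𝕜 (ExteriorAlgebra 𝕜 S) r) := by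
      funext x
      simp [superLocal]
    rw [key]
    exact contMDiffOn_const

/-! ### Vector fields on the graded manifold -/

/-- The homogeneous superderivations of parity `p` of the algebra of functions. -/
def derivations (p : ZMod 2) : Submodule 𝕜 (Module.End 𝕜 G.superFunctions) where
  carrier := {W | ∀ (q : ZMod 2) (f : G.superFunctions), (∀ x, f.1 x ∈ parity 𝕜 S q) →
    (∀ x, (W f).1 x ∈ parity 𝕜 S (p + q)) ∧
      ∀ f' : G.superFunctions, W (f * f') = W f * f' + superSign p q • (f * W f')}
  add_mem' := by
    intro V W hV hW q f hf
    refine ⟨fun x => add_mem ((hV q f hf).1 x) ((hW q f hf).1 x), fun f' => ?_⟩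
    simp only [LinearMap.add_apply, (hV q f hf).2 f', (hW q f hf).2 f', add_mul, mul_add,
      smul_add]
    abel
  zero_mem' := by
    intro q f _
    exact ⟨fun x => by simp, fun f' => by simp⟩
  smul_mem' := by
    intro c W hW q f hf
    refine ⟨fun x => Submodule.smul_mem _ c ((hW q f hf).1 x), fun f' => ?_⟩
    simp only [LinearMap.smul_apply, (hW q f hf).2 f', smul_add, smul_mul_assoc, mul_smul_comm]
    rw [smul_comm c]

/-- All (not necessarily homogeneous) vector fields on the graded manifold. -/
abbrev Field : Type _ := ↥(G.derivations 0 ⊔ G.derivations 1)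

/-- Even vector fields on the graded manifold. -/
abbrev EvenField : Type _ := ↥(G.derivations 0)

theorem lie_mem_derivations {W : Module.End 𝕜 G.superFunctions} (hW : W ∈ G.derivations 0)
    {p : ZMod 2} {Y : Module.End 𝕜 G.superFunctions} (hY : Y ∈ G.derivations p) :
    ⁅W, Y⁆ ∈ G.derivations p := by
  intro q f hf
  have h0 : ∀ r : ZMod 2, superSign 0 r = 1 := fun r => by simp [superSign]
  have hWf := hW q f hf
  have hYf := hY q f hf
  have hWf' : ∀ x, (W f).1 x ∈ parity 𝕜 S q := by simpa using hWf.1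
  have hYW := hY q (W f) hWf'
  have hWY := hW (p + q) (Y f) hYf.1
  simp only [h0, one_smul] at hWf hWY
  refine ⟨fun x => ?_, fun f' => ?_⟩
  · have h1 : ∀ x, (W (Y f)).1 x ∈ parity 𝕜 S (p + q) := by simpa using hWY.1
    exact sub_mem (h1 x) (hYW.1 x)
  · simp only [Ring.lie_def, LinearMap.sub_apply, Module.End.mul_apply, hWf.2, hYf.2, map_add,
      map_zsmul, hWY.2, hYW.2, mul_sub, sub_mul, smul_sub, smul_add]
    abel

/-- The bracket of an even vector field with a vector field; as one of the two is even, it is the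
ordinary commutator of operators. -/
def bracket (W : G.EvenField) (Y : G.Field) : G.Field :=
  ⟨⁅(W : Module.End 𝕜 G.superFunctions), (Y : Module.End 𝕜 G.superFunctions)⁆, by
    obtain ⟨Y, hY⟩ := Y
    obtain ⟨Y₀, h₀, Y₁, h₁, rfl⟩ := Submodule.mem_sup.1 hY
    have key : ⁅(W : Module.End 𝕜 G.superFunctions), Y₀ + Y₁⁆
        = ⁅(W : Module.End 𝕜 G.superFunctions), Y₀⁆ + ⁅(W : Module.End 𝕜 G.superFunctions), Y₁⁆ := by
      simp only [Ring.lie_def, mul_add, add_mul]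
      abel
    change ⁅(W : Module.End 𝕜 G.superFunctions), Y₀ + Y₁⁆ ∈ _
    rw [key]
    exact Submodule.add_mem_sup (G.lie_mem_derivations W.2 h₀) (G.lie_mem_derivations W.2 h₁)⟩

/-! ### The lift of vector fields and the even fields built from them -/

/-- The frame vector field `e_k` of the frame `i`. -/
def frameField (i : ι) (k : Fin s ⊕ Fin t) (x : M) : TangentSpace (𝓡 (s + t)) x :=
  G.spin.frame i x (Pi.single k 1)

/-- The connection form `g(∇_X e_k, e_l)` at `x`. -/
def connForm (X : VF (s + t) M) (x : M) (k l : Fin s ⊕ Fin t) : ℝ :=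
  G.metric.val x (leviCivita G.metric X (G.frameField (G.idx x) k) x) (G.frameField (G.idx x) l x)

/-- The matrix `g(∇_{e_k} X, e_l)` at `x` of the endomorphism `∇X`. -/
def covMatrix (X : VF (s + t) M) (x : M) (k l : Fin s ⊕ Fin t) : ℝ :=
  G.metric.val x (leviCivita G.metric (G.frameField (G.idx x) k) X x) (G.frameField (G.idx x) l x)

/-- The trace of the endomorphism `∇X`. -/
def traceCov (X : VF (s + t) M) (x : M) : ℝ := ∑ k, eta k * G.covMatrix X x k k

/-- The derivative, at `x` along `v`, of the representative of `f` in the frame at `x`. -/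
def superDeriv (f : M → ExteriorAlgebra 𝕜 S) (x : M) (v : TangentSpace (𝓡 (s + t)) x) :
    ExteriorAlgebra 𝕜 S :=
  ∑ J, dirDeriv (fun y => (Module.finBasis 𝕜 S).ExteriorAlgebra.coord J
    (G.superLocal (G.idx x) f y)) x v • (Module.finBasis 𝕜 S).ExteriorAlgebra J

/-- The covariant derivative `∇_X f` on the exterior bundle of `S` that is induced by the
Levi-Civita connection. -/
def nabla (X : VF (s + t) M) (f : M → ExteriorAlgebra 𝕜 S) (x : M) : ExteriorAlgebra 𝕜 S :=
  G.superDeriv f x (X x) + derivExt (G.fibre.rep (spinImage (G.connForm X x))) (f x)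

/-- Interior multiplication with a spinor field, by means of the charge conjugation. -/
def interior (φ : M → S) (f : M → ExteriorAlgebra 𝕜 S) (x : M) : ExteriorAlgebra 𝕜 S :=
  CliffordAlgebra.contractLeft (G.fibre.charge (φ x)) (f x)

/-- The operator `X - (∇X)_𝔞 + α tr(∇X)`, where `X` acts as `∇_X`, the skew part `(∇X)_𝔞` acts
through the spin representation, and endomorphisms of `S` act as derivations. -/
def evenOp (α : 𝕜) (X : VF (s + t) M) (f : M → ExteriorAlgebra 𝕜 S) (x : M) :
    ExteriorAlgebra 𝕜 S :=
  G.nabla X f x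
    - derivExt (G.fibre.rep (spinImage fun k l =>
        (1 / 2) * (G.covMatrix X x k l - G.covMatrix X x l k))) (f x)
    + derivExt ((α * (G.traceCov X x : 𝕜)) • (1 : Module.End 𝕜 S)) (f x)

/-! ### Bilinear forms, the metric, Killing fields -/

/-- Even bilinear forms on the graded manifold: additive, linear over functions in the first
argument, and linear up to the sign `(-1)^{|W||f|}` in the second. -/
structure IsEvenBilinearForm (b : G.Field → G.Field → G.superFunctions) : Prop where
  add_left : ∀ V V' W, b (V + V') W = b V W + b V' W
  add_right : ∀ V W W', b V (W + W') = b V W + b V W'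
  mul_left : ∀ (f : G.superFunctions) (V V' W : G.Field),
    (∀ a, V'.1 a = f * V.1 a) → b V' W = f * b V W
  mul_right : ∀ (p q : ZMod 2) (f : G.superFunctions) (V W W' : G.Field),
    V.1 ∈ G.derivations p → (∀ x, f.1 x ∈ parity 𝕜 S q) →
    (∀ a, W'.1 a = f * W.1 a) → b V W' = superSign p q • (f * b V W)

/-- `h` is the metric `g ⊕ C`: the even bilinear form with `h(jX, jY) = g(X, Y)`,
`h(jφ, jψ) = C(φ, ψ)` and `h(jX, jφ) = h(jφ, jX) = 0`. -/
structure IsMetric (jv : VF (s + t) M → G.Field) (js : G.SpinorField → G.Field)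
    (h : G.Field → G.Field → G.superFunctions) : Prop where
  bilinear : G.IsEvenBilinearForm h
  vec_vec : ∀ X Y x, (h (jv X) (jv Y)).1 x =
    algebraMap 𝕜 (ExteriorAlgebra 𝕜 S) (G.metric.val x (X x) (Y x) : ℝ)
  spin_spin : ∀ φ ψ x, (h (js φ) (js ψ)).1 x =
    algebraMap 𝕜 (ExteriorAlgebra 𝕜 S) (G.fibre.charge (φ.1 x) (ψ.1 x))
  vec_spin : ∀ X φ, h (jv X) (js φ) = 0
  spin_vec : ∀ φ X, h (js φ) (jv X) = 0

/-- The Lie derivative of an even bilinear form along an even field; all signs are `+`. -/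
def lieDeriv (W : G.EvenField) (b : G.Field → G.Field → G.superFunctions) (Y Z : G.Field) :
    G.superFunctions :=
  W.1 (b Y Z) - b (G.bracket W Y) Z - b Y (G.bracket W Z)

/-- Even Killing fields of the special graded manifold with metric `h`. -/
def IsEvenKilling (h : G.Field → G.Field → G.superFunctions) (W : G.EvenField) : Prop :=
  ∀ Y Z, G.lieDeriv W h Y Z = 0

end SpecialGradedManifold

end SuperKilling

end

/-! In a spin frame `𝔢_α(X)` is a first-order operator `X + B + c N`: a skew matrix `B` acts through
the spin representation, `N` counts the exterior degree, and `c = α tr(∇X)`. If `X` is Killing, the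
trace vanishes, so `α` disappears, and torsion-freeness gives `B k l = g([X, e_k], e_l)`
(`conn_sub_skewCov`). The operator is then the Lie derivative of spinors along `X`, which preserves
everything built from `g` and `C`.

Even Killing implies Killing: endomorphism parts annihilate scalar functions, so for every `X` the
bracket of `𝔢_α(X)` with `∇_Y` acts on scalars as `[X, Y]`, and the product of a field with `∇_Z`
depends only on how the field acts on scalars. Hence the Lie derivative of `h`, evaluated on `∇_Y`
and `∇_Z`, is the Lie derivative of `g` on `Y` and `Z` (`lieDeriv_evenLift_vec_vec`).

Killing implies even Killing: the Lie derivative of `h` is again a graded form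
(`isGradedForm_lieDeriv`), and such a form is determined by its values on lifts
(`IsGradedForm.eq_zero`). Invariance of the Levi-Civita connection gives `[𝔢_α(X), ∇_Y] = ∇_[X,Y]`
(`lie_evenGauge_nablaOp`), and invariance of `C` gives `[𝔢_α(X), φ⌋] = (𝔢_α(X) φ)⌋`
(`GaugeOperator.lie_interiorEnd`). The mixed values then vanish, the vector values vanish by the
Killing equation, and the spinor values vanish because `C(φ, ψ)` is `φ⌋ψ`.

The bracket relation is reduced by `GaugeOperator.lie_toEnd` to a matrix identity in a frame, which
follows from the Killing equation and the Jacobi identity (`lie_evenGauge`).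

Two points of well-definedness take most of the work. The local operators must agree on overlaps:
the transformation law of the matrices under a change of frame has to be lifted to the spin group,
and `add_spinElt_mul_eq` does this because an even skew Clifford element commuting with all vectors
is zero. The metric must exist and be unique: by Hadamard's lemma every superderivation is locally a
combination of `∇` along coordinate fields and of contractions with spinors
(`SuperCoordinates.remainder_eq_zero`). The resulting formula for `h` does not depend on the
combination chosen (`SuperCoordinates.metricLocal_eq`). -/

noncomputable section

universe u v

namespace SuperKilling

/-! ### Directional derivatives and Lie brackets -/

section Calculus

variable {n : ℕ} {M : Type*} [TopologicalSpace M] [ChartedSpace (EuclideanSpace ℝ (Fin n)) M]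

/-- Smoothness of a scalar function at a point. -/
abbrev SmoothAt {𝕜 : Type*} [RCLike 𝕜] (n : ℕ) {M : Type*} [TopologicalSpace M]
    [ChartedSpace (EuclideanSpace ℝ (Fin n)) M] (f : M → 𝕜) (x : M) : Prop :=
  ContMDiffAt (𝓡 n) 𝓘(ℝ, 𝕜) ∞ f x

variable {𝕜 : Type*} [RCLike 𝕜] {f f' : M → 𝕜} {x : M}

theorem SmoothAt.mdiff (hf : SmoothAt n f x) : MDifferentiableAt (𝓡 n) 𝓘(ℝ, 𝕜) f x :=
  hf.mdifferentiableAt (by simp)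

theorem SmoothAt.mul' (hf : SmoothAt n f x) (hf' : SmoothAt n f' x) :
    SmoothAt n (fun y => f y * f' y) x := by
  have hmul : ContDiff ℝ ∞ fun p : 𝕜 × 𝕜 => p.1 * p.2 := by fun_prop
  exact hmul.contMDiff.contMDiffAt.comp x (hf.prodMk_space hf')

theorem SmoothAt.ofReal {f : M → ℝ} (hf : SmoothAt n f x) :
    SmoothAt n (fun y => (f y : 𝕜)) x :=
  (RCLike.ofRealCLM (K := 𝕜)).contDiff.contMDiff.contMDiffAt.comp x hf

section DirDeriv

variable (v : TangentSpace (𝓡 n) x)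

theorem dirDeriv_congr (h : f =ᶠ[nhds x] f') : dirDeriv f x v = dirDeriv f' x v := by
  unfold dirDeriv
  rw [h.mfderiv_eq]
  rfl

theorem dirDeriv_const (c : 𝕜) : dirDeriv (fun _ : M => c) x v = 0 := by
  unfold dirDeriv
  rw [mfderiv_const]
  rfl

theorem dirDeriv_add (hf : SmoothAt n f x) (hf' : SmoothAt n f' x) :
    dirDeriv (fun y => f y + f' y) x v = dirDeriv f x v + dirDeriv f' x v :=
  congrArg (fun L => L v) (mfderiv_add hf.mdiff hf'.mdiff)

theorem dirDeriv_clm {𝕜' : Type*} [RCLike 𝕜'] (L : 𝕜 →L[ℝ] 𝕜') (hf : SmoothAt n f x) :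
    dirDeriv (fun y => L (f y)) x v = L (dirDeriv f x v) := by
  have h := (L.hasMFDerivAt.comp x hf.mdiff.hasMFDerivAt).mfderiv
  exact congrArg (fun A => A v) h

theorem dirDeriv_mul (hf : SmoothAt n f x) (hf' : SmoothAt n f' x) :
    dirDeriv (fun y => f y * f' y) x v = dirDeriv f x v * f' x + f x * dirDeriv f' x v := by
  have h := (hf.mdiff.hasMFDerivAt.mul' hf'.mdiff.hasMFDerivAt).mfderiv
  have h2 := congrArg (fun A => A v) h
  refine h2.trans ?_
  change f x * dirDeriv f' x v + dirDeriv f x v * f' x = _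
  ring

end DirDeriv

theorem dirDeriv_add_vec (v w : TangentSpace (𝓡 n) x) :
    dirDeriv f x (v + w) = dirDeriv f x v + dirDeriv f x w :=
  map_add (mfderiv (𝓡 n) 𝓘(ℝ, 𝕜) f x) v w

theorem dirDeriv_smul_vec (c : ℝ) (v : TangentSpace (𝓡 n) x) :
    dirDeriv f x (c • v) = (c : 𝕜) * dirDeriv f x v := by
  have h := map_smul (mfderiv (𝓡 n) 𝓘(ℝ, 𝕜) f x) c v
  refine h.trans ?_
  rw [← RCLike.real_smul_eq_coe_mul]
  rfl

theorem dirDeriv_sum_vec {J : Type*} (s : Finset J) (v : J → TangentSpace (𝓡 n) x) :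
    dirDeriv f x (∑ j ∈ s, v j) = ∑ j ∈ s, dirDeriv f x (v j) :=
  map_sum (mfderiv (𝓡 n) 𝓘(ℝ, 𝕜) f x) v s


variable {X Y Z : ∀ x : M, TangentSpace (𝓡 n) x}

/-- The Lie bracket of vector fields, as sections of the tangent bundle. -/
local notation "⟦" X ", " Y "⟧" => VectorField.mlieBracket (𝓡 n) X Y

theorem bracket_swap : ⟦X, Y⟧ x = -⟦Y, X⟧ x := VectorField.mlieBracket_swap_apply

theorem bracket_congr {X' Y' : ∀ x : M, TangentSpace (𝓡 n) x}
    (hX : X =ᶠ[nhds x] X') (hY : Y =ᶠ[nhds x] Y') :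
   ⟦X, Y⟧ x = ⟦X', Y'⟧ x := Filter.EventuallyEq.mlieBracket_vectorField_eq hX hY

variable [IsManifold (𝓡 n) ∞ M]

/-- Smoothness of a vector field at a point. -/
abbrev SmoothFieldAt (n : ℕ) {M : Type*} [TopologicalSpace M]
    [ChartedSpace (EuclideanSpace ℝ (Fin n)) M] [IsManifold (𝓡 n) ∞ M]
    (X : ∀ x : M, TangentSpace (𝓡 n) x) (x : M) : Prop :=
  ContMDiffAt (𝓡 n) (𝓡 n).tangent ∞ (fun y => (⟨y, X y⟩ : TangentBundle (𝓡 n) M)) x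


theorem SmoothFieldAt.mdiff (hX : SmoothFieldAt n X x) :
  MDifferentiableAt (𝓡 n) (𝓡 n).tangent (fun y => (⟨y, X y⟩ : TangentBundle (𝓡 n) M)) x :=
  ContMDiffAt.mdifferentiableAt hX (by simp)

theorem SmoothAt.dirDeriv (hf : SmoothAt n f x) (hX : SmoothFieldAt n X x) :
    SmoothAt n (fun y => dirDeriv f y (X y)) x := by
  have h := ContMDiffAt.mfderiv_const (m := ∞) hf (by simp)
  have h2 : ContMDiffAt (𝓡 n) (𝓘(ℝ, 𝕜)).tangent ∞
      (fun y => (⟨f y, mfderiv (𝓡 n) 𝓘(ℝ, 𝕜) f y (X y)⟩ : TangentBundle 𝓘(ℝ, 𝕜) 𝕜)) x :=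
    ContMDiffAt.clm_apply_of_inCoordinates h hX hf
  exact (contMDiff_snd_tangentBundle_modelSpace 𝕜 𝓘(ℝ, 𝕜)).contMDiffAt.comp x h2

theorem SmoothFieldAt.eventually_mdiff (hX : SmoothFieldAt n X x) :
    ∀ᶠ y in nhds x, MDifferentiableAt (𝓡 n) (𝓡 n).tangent
      (fun y => (⟨y, X y⟩ : TangentBundle (𝓡 n) M)) y := by
  have h1 : ContMDiffAt (𝓡 n) (𝓡 n).tangent 1 (fun y => (⟨y, X y⟩ : TangentBundle (𝓡 n) M)) x :=
    hX.of_le (by simp)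
  filter_upwards [(contMDiffAt_iff_contMDiffAt_nhds (by simp)).1 h1] with y hy
  exact hy.mdifferentiableAt (by simp)

theorem SmoothAt.eventually_mdiff (hf : SmoothAt n f x) :
    ∀ᶠ y in nhds x, MDifferentiableAt (𝓡 n) 𝓘(ℝ, 𝕜) f y := by
  have h1 : ContMDiffAt (𝓡 n) 𝓘(ℝ, 𝕜) 1 f x :=
    hf.of_le (by simp)
  filter_upwards [(contMDiffAt_iff_contMDiffAt_nhds (by simp)).1 h1] with y hy
  exact hy.mdifferentiableAt (by simp)

theorem SmoothFieldAt.bracket (hX : SmoothFieldAt n X x) (hY : SmoothFieldAt n Y x) :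
    SmoothFieldAt n ⟦X, Y⟧ x := by
  have h1 : IsManifold (𝓡 n) (((⊤ : ℕ∞) : ℕ∞ω) + 1) M := by
    simpa using (inferInstance : IsManifold (𝓡 n) ∞ M)
  have h2 : IsManifold (𝓡 n) (minSmoothness ℝ 2) M := by
    simpa using IsManifold.of_le (I := 𝓡 n) (M := M) (n := ∞) (m := 2)
      (WithTop.coe_le_coe.2 (le_top : (2 : ℕ∞) ≤ ⊤))
  exact ContMDiffAt.mlieBracket_vectorField (n := ⊤) (m := ⊤) hX hY (by simp)

theorem SmoothFieldAt.smul (hf : SmoothAt n (𝕜 := ℝ) a x) (hX : SmoothFieldAt n X x) :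
    SmoothFieldAt n (fun y => a y • X y) x :=
  ContMDiffAt.smul_section hf hX

theorem SmoothFieldAt.sum {J : Type*} {s : Finset J} {Y : J → ∀ x : M, TangentSpace (𝓡 n) x}
    (hY : ∀ j ∈ s, SmoothFieldAt n (Y j) x) :
    SmoothFieldAt n (fun y => ∑ j ∈ s, Y j y) x :=
  ContMDiffAt.sum_section hY

theorem bracket_smul_right {a : M → ℝ} (ha : MDifferentiableAt (𝓡 n) 𝓘(ℝ, ℝ) a x)
    (hY : MDifferentiableAt (𝓡 n) (𝓡 n).tangent (fun y => (⟨y, Y y⟩ : TangentBundle (𝓡 n) M)) x) :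
    ⟦X, fun y => a y • Y y⟧ x = SuperKilling.dirDeriv a x (X x) • Y x + a x • ⟦X, Y⟧ x := by
  have h1 : IsManifold (𝓡 n) (minSmoothness ℝ 2) M := by
    simpa using IsManifold.of_le (I := 𝓡 n) (M := M) (n := ∞) (m := 2)
      (WithTop.coe_le_coe.2 (le_top : (2 : ℕ∞) ≤ ⊤))
  exact VectorField.mlieBracket_smul_right ha hY

theorem bracket_add_right
    (hY : MDifferentiableAt (𝓡 n) (𝓡 n).tangent (fun y => (⟨y, Y y⟩ : TangentBundle (𝓡 n) M)) x)
    (hZ : MDifferentiableAt (𝓡 n) (𝓡 n).tangent (fun y => (⟨y, Z y⟩ : TangentBundle (𝓡 n) M)) x) :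
   ⟦X, fun y => Y y + Z y⟧ x = ⟦X, Y⟧ x + ⟦X, Z⟧ x := by
  have h1 : IsManifold (𝓡 n) (minSmoothness ℝ 2) M := by
    simpa using IsManifold.of_le (I := 𝓡 n) (M := M) (n := ∞) (m := 2)
      (WithTop.coe_le_coe.2 (le_top : (2 : ℕ∞) ≤ ⊤))
  exact VectorField.mlieBracket_add_right hY hZ

theorem bracket_jacobi (hX : SmoothFieldAt n X x) (hY : SmoothFieldAt n Y x)
    (hZ : SmoothFieldAt n Z x) : ⟦X, ⟦Y, Z⟧⟧ x = ⟦⟦X, Y⟧, Z⟧ x + ⟦Y, ⟦X, Z⟧⟧ x := by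
  have h1 : IsManifold (𝓡 n) (minSmoothness ℝ 3) M := by
    simpa using IsManifold.of_le (I := 𝓡 n) (M := M) (n := ∞) (m := 3)
      (WithTop.coe_le_coe.2 (le_top : (3 : ℕ∞) ≤ ⊤))
  have h2 : minSmoothness ℝ 2 ≤ (∞ : ℕ∞ω) := by
    simpa using (WithTop.coe_le_coe.2 (le_top : (2 : ℕ∞) ≤ ⊤))
  exact VectorField.leibniz_identity_mlieBracket_apply (hX.of_le h2) (hY.of_le h2) (hZ.of_le h2)

theorem exists_smoothFieldAt (v : TangentSpace (𝓡 n) x) :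
    ∃ Z : ∀ x : M, TangentSpace (𝓡 n) x, SmoothFieldAt n Z x ∧ Z x = v :=
  ⟨FiberBundle.extend (EuclideanSpace ℝ (Fin n)) v,
    FiberBundle.contMDiffAt_extend (𝓡 n) (EuclideanSpace ℝ (Fin n)) v, by simp⟩

/-- The commutator formula is extracted from the Jacobi identity: apply it to `X`, `Y` and `a Z`
with `Z x ≠ 0`, expand by the Leibniz rule, and compare the coefficients of `Z x`. -/
theorem dirDeriv_bracket_real {a : M → ℝ} (ha : SmoothAt n a x) (hX : SmoothFieldAt n X x)
    (hY : SmoothFieldAt n Y x) :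
    dirDeriv a x (⟦X, Y⟧ x) = dirDeriv (fun y => dirDeriv a y (Y y)) x (X x)
      - dirDeriv (fun y => dirDeriv a y (X y)) x (Y x) := by
  -- A nonzero tangent vector is needed in order to cancel it at the end; in dimension zero all
  -- terms vanish.
  by_cases hz : ∃ v : TangentSpace (𝓡 n) x, v ≠ 0
  swap
  · push Not at hz
    rw [hz (⟦X, Y⟧ x), hz (X x), hz (Y x)]
    have h0 : ∀ b : M → ℝ, dirDeriv b x (0 : TangentSpace (𝓡 n) x) = 0 := fun b =>
      map_zero (mfderiv (𝓡 n) 𝓘(ℝ, ℝ) b x)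
    simp [h0]
  obtain ⟨v, hv⟩ := hz
  obtain ⟨Z, hZ, rfl⟩ := exists_smoothFieldAt v
  have key : ∀ {A B : ∀ x : M, TangentSpace (𝓡 n) x}, SmoothFieldAt n A x → SmoothFieldAt n B x →
      ⟦A, ⟦B, fun y => a y • Z y⟧⟧ x = dirDeriv (fun y => dirDeriv a y (B y)) x (A x) • Z x
        + dirDeriv a x (B x) • ⟦A, Z⟧ x + (dirDeriv a x (A x) • ⟦B, Z⟧ x
        + a x • ⟦A, ⟦B, Z⟧⟧ x) := by
    intro A B hA hB
    have h1 : ⟦B, fun y => a y • Z y⟧ =ᶠ[nhds x]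
        fun y => dirDeriv a y (B y) • Z y + a y • ⟦B, Z⟧ y := by
      filter_upwards [ha.eventually_mdiff, hZ.eventually_mdiff] with y h1 h2
      exact bracket_smul_right h1 h2
    have hBa := ha.dirDeriv hB
    rw [bracket_congr (X := A) (X' := A) Filter.EventuallyEq.rfl h1,
      bracket_add_right (hZ.smul hBa).mdiff ((hB.bracket hZ).smul ha).mdiff,
      bracket_smul_right hBa.mdiff hZ.mdiff, bracket_smul_right ha.mdiff (hB.bracket hZ).mdiff]
  -- The terms with first derivatives of `a` times `[X, Z]` or `[Y, Z]` are symmetric in `X` and `Y`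
  -- and cancel. The undifferentiated terms cancel by the Jacobi identity for `X`, `Y`, `Z`.
  have hj := bracket_jacobi hX hY (hZ.smul ha)
  rw [key hX hY, key hY hX, bracket_smul_right ha.mdiff hZ.mdiff, bracket_jacobi hX hY hZ] at hj
  have : (dirDeriv a x (⟦X, Y⟧ x) - (dirDeriv (fun y => dirDeriv a y (Y y)) x (X x)
      - dirDeriv (fun y => dirDeriv a y (X y)) x (Y x))) • Z x = 0 := by
    simp only [smul_add, sub_smul] at hj ⊢
    rw [← sub_eq_zero] at hj
    rw [← neg_eq_zero, ← hj]
    abel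
  rcases smul_eq_zero.1 this with h | h
  · linarith
  · exact absurd h hv

/-- Real-linear functionals commute with differentiation, so the real and imaginary parts reduce
this to the real case. -/
theorem dirDeriv_bracket (hf : SmoothAt n f x) (hX : SmoothFieldAt n X x)
    (hY : SmoothFieldAt n Y x) :
    dirDeriv f x (⟦X, Y⟧ x) = dirDeriv (fun y => dirDeriv f y (Y y)) x (X x)
      - dirDeriv (fun y => dirDeriv f y (X y)) x (Y x) := by
  have key : ∀ L : 𝕜 →L[ℝ] ℝ, L (dirDeriv f x (⟦X, Y⟧ x)) =
      L (dirDeriv (fun y => dirDeriv f y (Y y)) x (X x)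
      - dirDeriv (fun y => dirDeriv f y (X y)) x (Y x)) := by
    intro L
    have hLf : SmoothAt n (fun y => L (f y)) x := L.contDiff.contMDiff.contMDiffAt.comp x hf
    have hev : ∀ {A : ∀ x : M, TangentSpace (𝓡 n) x}, (fun y => L (dirDeriv f y (A y)))
        =ᶠ[nhds x] fun y => dirDeriv (fun z => L (f z)) y (A y) := by
      intro A
      filter_upwards [hf.eventually_mdiff] with y hy
      exact (congrArg (fun B => B (A y)) (L.hasMFDerivAt.comp y hy.hasMFDerivAt).mfderiv).symm
    rw [map_sub, ← dirDeriv_clm _ L (hf.dirDeriv hY), ← dirDeriv_clm _ L (hf.dirDeriv hX),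
      ← dirDeriv_clm _ L hf, dirDeriv_congr _ hev, dirDeriv_congr _ hev,
      dirDeriv_bracket_real hLf hX hY]
  exact RCLike.ext (key RCLike.reCLM) (key RCLike.imCLM)

end Calculus

/-! ### Cut-off functions and global extension of local fields -/

section Bump

variable {n : ℕ} {M : Type*} [TopologicalSpace M] [ChartedSpace (EuclideanSpace ℝ (Fin n)) M]
  {𝕜 : Type*} [RCLike 𝕜] {x : M} {U : Set M}

/-- Smoothness of `f` is available on the closed support of `χ`; off it the product is zero in a
whole neighbourhood, whatever `f` is there. -/
theorem smoothAt_bump_mul {χ : M → ℝ} (hχ : ContMDiff (𝓡 n) 𝓘(ℝ, ℝ) ∞ χ) (hs : tsupport χ ⊆ U)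
    {f : M → 𝕜} (hf : ∀ y ∈ U, SmoothAt n f y) (y : M) :
    SmoothAt n (fun y => (χ y : 𝕜) * f y) y := by
  by_cases hy : y ∈ tsupport χ
  · exact (SmoothAt.ofReal hχ.contMDiffAt).mul' (hf y (hs hy))
  · have h0 : (fun y => (χ y : 𝕜) * f y) =ᶠ[nhds y] fun _ => 0 := by
      filter_upwards [(isClosed_tsupport χ).isOpen_compl.mem_nhds hy] with z hz
      rw [image_eq_zero_of_notMem_tsupport hz]
      simp
    exact contMDiffAt_const.congr_of_eventuallyEq h0

variable [IsManifold (𝓡 n) ∞ M] [T2Space M]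

theorem exists_bump (hU : IsOpen U) (hx : x ∈ U) : ∃ χ : M → ℝ, ContMDiff (𝓡 n) 𝓘(ℝ, ℝ) ∞ χ ∧
    χ =ᶠ[nhds x] (fun _ => 1) ∧ tsupport χ ⊆ U := by
  obtain ⟨b, -, hb⟩ := (SmoothBumpFunction.nhds_basis_tsupport (I := 𝓡 n) x).mem_iff.1
    (hU.mem_nhds hx)
  exact ⟨b, b.contMDiff, b.eventuallyEq_one, hb⟩

/-- A local vector field multiplied with a bump function. -/
def bumpField {χ : M → ℝ} (hχ : ContMDiff (𝓡 n) 𝓘(ℝ, ℝ) ∞ χ) (hU : IsOpen U)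
    (hs : tsupport χ ⊆ U) (X : ∀ x : M, TangentSpace (𝓡 n) x)
    (hX : ∀ y ∈ U, SmoothFieldAt n X y) : VF n M where
  toFun := fun y => χ y • X y
  contMDiff_toFun := ContMDiffOn.smul_section_of_tsupport hχ.contMDiffOn hU hs
    fun y hy => (hX y hy).contMDiffWithinAt

theorem exists_field_eq (hU : IsOpen U) (hx : x ∈ U) {X : ∀ x : M, TangentSpace (𝓡 n) x}
    (hX : ∀ y ∈ U, SmoothFieldAt n X y) : ∃ X' : VF n M, ∀ᶠ y in nhds x, X' y = X y := by
  obtain ⟨χ, hχ, h1, hs⟩ := exists_bump (n := n) hU hx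
  refine ⟨bumpField hχ hU hs X hX, ?_⟩
  filter_upwards [h1] with y hy
  change χ y • X y = X y
  rw [hy, one_smul]

end Bump

/-! ### Hadamard's lemma, in vector spaces and in charts -/

section Hadamard

open MeasureTheory in
theorem hasFDerivAt_parametric_integral {E F : Type*} [NormedAddCommGroup E] [NormedSpace ℝ E]
    [FiniteDimensional ℝ E] [NormedAddCommGroup F] [NormedSpace ℝ F]
    {G : E × ℝ → F} (hG : ContDiff ℝ 1 G) (z₀ : E) :
    HasFDerivAt (fun z => ∫ t in (0 : ℝ)..1, G (z, t))
      (∫ t in (0 : ℝ)..1, (fderiv ℝ G (z₀, t)).comp (ContinuousLinearMap.inl ℝ E ℝ)) z₀ := by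
  have hc : Continuous fun p : E × ℝ => (fderiv ℝ G p).comp (ContinuousLinearMap.inl ℝ E ℝ) :=
    (hG.continuous_fderiv (by simp)).clm_comp continuous_const
  -- The dominating constant is a bound for the partial derivative on the compact set `closedBall z₀
  -- 1 × [0, 1]`; finite dimension of `E` makes the ball compact.
  obtain ⟨C, hC⟩ := ((isCompact_closedBall z₀ 1).prod (isCompact_Icc (a := (0 : ℝ)) (b := 1))
    ).exists_bound_of_continuousOn hc.continuousOn
  refine intervalIntegral.hasFDerivAt_integral_of_dominated_of_fderiv_le
    (F := fun z t => G (z, t)) (bound := fun _ => C)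
    (F' := fun z t => (fderiv ℝ G (z, t)).comp (ContinuousLinearMap.inl ℝ E ℝ))
    (Metric.closedBall_mem_nhds z₀ one_pos) ?_ ?_ ?_ ?_ ?_ ?_
  · exact Filter.Eventually.of_forall fun z =>
      (hG.continuous.comp (Continuous.prodMk_right z)).aestronglyMeasurable
  · exact (hG.continuous.comp (Continuous.prodMk_right z₀)).intervalIntegrable 0 1
  · exact (hc.comp (Continuous.prodMk_right z₀)).aestronglyMeasurable
  · refine Filter.Eventually.of_forall fun t ht z hz => hC (z, t) ⟨hz, ?_⟩
    rw [Set.uIoc_of_le zero_le_one] at ht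
    exact Set.Ioc_subset_Icc_self ht
  · exact intervalIntegrable_const
  · refine Filter.Eventually.of_forall fun t _ z _ => ?_
    have h1 := (hG.differentiable (by simp) (z, t)).hasFDerivAt
    exact h1.comp z (hasFDerivAt_prodMk_left z t)

/-- Differentiation produces an integral of the same kind with values in `E →L[ℝ] F`. The induction
therefore runs over all `F`, in the universe `max u v`, which is closed under passing from `F` to `E
→L[ℝ] F`. -/
theorem contDiff_parametric_integral {E : Type u} [NormedAddCommGroup E] [NormedSpace ℝ E]
    [FiniteDimensional ℝ E] (m : ℕ) : ∀ {F : Type (max u v)} [NormedAddCommGroup F]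
    [NormedSpace ℝ F] {G : E × ℝ → F}, ContDiff ℝ ∞ G →
    ContDiff ℝ m fun z => ∫ t in (0 : ℝ)..1, G (z, t) := by
  induction m with
  | zero =>
    intro F _ _ G hG
    refine contDiff_zero.2 (continuous_iff_continuousAt.2 fun z =>
      (hasFDerivAt_parametric_integral (hG.of_le (by simp)) z).continuousAt)
  | succ m ih =>
    intro F _ _ G hG
    have h1 : ContDiff ℝ 1 G := hG.of_le (by simp)
    rw [Nat.cast_add, Nat.cast_one, contDiff_succ_iff_hasFDerivAt]
    refine ⟨_, ih (G := fun p => (fderiv ℝ G p).comp (ContinuousLinearMap.inl ℝ E ℝ)) ?_,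
      fun z => hasFDerivAt_parametric_integral h1 z⟩
    exact (hG.fderiv_right (by simp)).clm_comp contDiff_const

/-- Hadamard's lemma. -/
theorem exists_contDiff_eq_add_apply_sub {E : Type u} [NormedAddCommGroup E] [NormedSpace ℝ E]
    [FiniteDimensional ℝ E] {F : Type v} [NormedAddCommGroup F] [NormedSpace ℝ F]
    [CompleteSpace F] {u : E → F} (hu : ContDiff ℝ ∞ u) (p : E) :
    ∃ g : E → E →L[ℝ] F, ContDiff ℝ ∞ g ∧ ∀ z, u z = u p + g z (z - p) := by
  have hf : ContDiff ℝ ∞ fun q : E × ℝ => fderiv ℝ u (p + q.2 • (q.1 - p)) :=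
    (hu.fderiv_right (m := ∞) (by simp)).comp (by fun_prop)
  -- The coefficient is the mean of the derivative along the segment from `p` to `z`; the identity
  -- is the fundamental theorem of calculus on that segment.
  refine ⟨fun z => ∫ t in (0 : ℝ)..1, fderiv ℝ u (p + t • (z - p)),
    contDiff_infty.2 fun m => contDiff_parametric_integral.{u, v} m hf, fun z => ?_⟩
  have hd : ∀ t : ℝ, HasDerivAt (fun t : ℝ => u (p + t • (z - p)))
      (fderiv ℝ u (p + t • (z - p)) (z - p)) t := by
    intro t
    have h1 := (hu.differentiable (by simp) (p + t • (z - p))).hasFDerivAt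
    have h2 : HasDerivAt (fun t : ℝ => p + t • (z - p)) (z - p) t := by
      simpa using ((hasDerivAt_id t).smul_const (z - p)).const_add p
    exact h1.comp_hasDerivAt t h2
  have hcf : Continuous fun t : ℝ => fderiv ℝ u (p + t • (z - p)) :=
    hf.continuous.comp (Continuous.prodMk_right z)
  have := intervalIntegral.integral_eq_sub_of_hasDerivAt (a := 0) (b := 1) (fun t _ => hd t)
    ((hcf.clm_apply continuous_const).intervalIntegrable 0 1)
  change u z = u p + (∫ t in (0 : ℝ)..1, fderiv ℝ u (p + t • (z - p))) (z - p)
  rw [ContinuousLinearMap.intervalIntegral_apply (hcf.intervalIntegrable 0 1), this]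
  simp

/-- Two cut-offs make the coefficients global. The bump `ρ` extends the chart expression of `f` to
the whole model space, where Hadamard's lemma applies, and `χ` extends the pulled-back coefficients
from the chart domain to `M`. Both are one near the point, so the identity survives there. -/
theorem exists_smooth_eq_add_sum {n : ℕ} {M : Type*} [TopologicalSpace M]
    [ChartedSpace (EuclideanSpace ℝ (Fin n)) M] [IsManifold (𝓡 n) ∞ M] [T2Space M]
    {𝕜 : Type*} [RCLike 𝕜] {x₀ x : M} (hx : x ∈ (extChartAt (𝓡 n) x₀).source) {f : M → 𝕜}
    (hf : ContMDiff (𝓡 n) 𝓘(ℝ, 𝕜) ∞ f) :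
    ∃ G : Fin n → M → 𝕜, (∀ m y, SmoothAt n (G m) y) ∧ ∀ᶠ y in nhds x,
      f y = f x + ∑ m, ((extChartAt (𝓡 n) x₀ y m - extChartAt (𝓡 n) x₀ x m : ℝ) : 𝕜) * G m y := by
  set φ := extChartAt (𝓡 n) x₀ with hφ
  have hT : φ.target ∈ nhds (φ x) := (isOpen_extChartAt_target x₀).mem_nhds (φ.map_source hx)
  obtain ⟨r, hr, hrT⟩ := Metric.nhds_basis_closedBall.mem_iff.1 hT
  let ρ : ContDiffBump (φ x) := ⟨r / 2, r, by positivity, by linarith⟩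
  have hρ : tsupport ρ ⊆ φ.target := by
    rw [ρ.tsupport_eq]
    exact hrT
  have hfs : ∀ z ∈ φ.target, ContDiffAt ℝ ∞ (fun z => f (φ.symm z)) z := by
    intro z hz
    have h1 := (contMDiffOn_extChartAt_symm (I := 𝓡 n) (n := ∞) x₀).contMDiffAt
      ((isOpen_extChartAt_target x₀).mem_nhds hz)
    exact (hf.contMDiffAt.comp z h1).contDiffAt
  have hu : ContDiff ℝ ∞ fun z => ρ z • f (φ.symm z) := by
    refine contMDiff_iff_contDiff.1 (contMDiff_of_tsupport fun z hz => ?_)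
    exact (ρ.contDiff.contDiffAt.smul (hfs z (hρ (tsupport_smul_subset_left _ _ hz)))).contMDiffAt
  obtain ⟨g, hg, hgu⟩ := exists_contDiff_eq_add_apply_sub hu (φ x)
  obtain ⟨χ, hχ, hχ1, hχs⟩ := exists_bump (n := n) (isOpen_extChartAt_source (I := 𝓡 n) x₀) hx
  refine ⟨fun m y => (χ y : 𝕜) * g (φ y) (EuclideanSpace.single m 1), fun m => ?_, ?_⟩
  · refine smoothAt_bump_mul hχ hχs fun y hy => ?_
    rw [extChartAt_source] at hy
    have h1 : ContMDiffAt (𝓡 n) 𝓘(ℝ, EuclideanSpace ℝ (Fin n)) ∞ φ y := contMDiffAt_extChartAt' hy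
    have h2 : ContDiff ℝ ∞ fun z => g z (EuclideanSpace.single m 1) :=
      hg.clm_apply contDiff_const
    exact h2.contMDiff.contMDiffAt.comp y h1
  · have hc : ContinuousAt φ x := continuousAt_extChartAt' hx
    filter_upwards [hχ1, (isOpen_extChartAt_source (I := 𝓡 n) x₀).mem_nhds hx,
      hc.eventually ρ.eventuallyEq_one] with y h1 h2 h3
    have h4 := hgu (φ y)
    have h6 : ρ (φ x) = 1 := ρ.eventuallyEq_one.self_of_nhds
    rw [h3, φ.left_inv h2, φ.left_inv hx, h6, Pi.one_apply, one_smul, one_smul] at h4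
    rw [h4, h1]
    congr 1
    have h5 : φ y - φ x = ∑ m, (φ y m - φ x m) • EuclideanSpace.single m (1 : ℝ) := by
      ext k
      simp [Finset.sum_apply, Pi.single_apply]
    conv_lhs => rw [h5]
    simp [map_sum, RCLike.real_smul_eq_coe_mul]

end Hadamard

end SuperKilling

end

noncomputable section

namespace SuperKilling

/-! ### Derivations, contractions and parity in the exterior algebra -/

section Exterior

variable {𝕜 S : Type*} [RCLike 𝕜] [AddCommGroup S] [Module 𝕜 S]

open CliffordAlgebra (contractLeft involute)

/-- Contraction is an odd antiderivation: each generator that it passes costs a sign, and `involute`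
collects these signs. -/
theorem contractLeft_mul {R V : Type*} [CommRing R] [AddCommGroup V] [Module R V]
    {Q : QuadraticForm R V} (d : Module.Dual R V) (a b : CliffordAlgebra Q) :
    contractLeft d (a * b) = contractLeft d a * b + involute a * contractLeft d b := by
  induction a using CliffordAlgebra.left_induction with
  | algebraMap r => simp [CliffordAlgebra.contractLeft_algebraMap_mul]
  | add x y hx hy => simp only [add_mul, map_add, hx, hy]; abel
  | ι_mul x m hx =>
    rw [mul_assoc, CliffordAlgebra.contractLeft_ι_mul, hx, CliffordAlgebra.contractLeft_ι_mul,
      map_mul, CliffordAlgebra.involute_ι]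
    simp only [mul_add, sub_mul, neg_mul, smul_mul_assoc, mul_assoc]
    abel

theorem involute_contractLeft {R V : Type*} [CommRing R] [AddCommGroup V] [Module R V]
    {Q : QuadraticForm R V} (d : Module.Dual R V) (a : CliffordAlgebra Q) :
    involute (contractLeft d a) = -contractLeft d (involute a) := by
  induction a using CliffordAlgebra.left_induction with
  | algebraMap r => simp
  | add x y hx hy => simp only [map_add, hx, hy]; abel
  | ι_mul x m hx =>
    simp only [CliffordAlgebra.contractLeft_ι_mul, map_mul, map_sub, map_smul, hx,
      CliffordAlgebra.involute_ι, neg_mul, map_neg]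
    simp only [mul_neg]
    abel

theorem ι_mul_involute (v : S) (x : ExteriorAlgebra 𝕜 S) :
    ExteriorAlgebra.ι 𝕜 v * involute x = x * ExteriorAlgebra.ι 𝕜 v := by
  induction x using CliffordAlgebra.left_induction with
  | algebraMap r => simp [Algebra.commutes]
  | add x y hx hy => simp only [map_add, mul_add, add_mul, hx, hy]
  | ι_mul x m hx =>
    have h := ExteriorAlgebra.ι_add_mul_swap (R := 𝕜) v m
    have h' : ExteriorAlgebra.ι 𝕜 v * CliffordAlgebra.ι (0 : QuadraticForm 𝕜 S) m
      = - (CliffordAlgebra.ι (0 : QuadraticForm 𝕜 S) m * ExteriorAlgebra.ι 𝕜 v) :=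
      eq_neg_of_add_eq_zero_left h
    rw [map_mul, CliffordAlgebra.involute_ι, neg_mul, mul_neg, ← mul_assoc, h', neg_mul, neg_neg,
      mul_assoc, hx, mul_assoc]

variable [FiniteDimensional 𝕜 S] (A B : Module.End 𝕜 S)

theorem derivExt_apply (x : ExteriorAlgebra 𝕜 S) : derivExt A x =
    ∑ k, ExteriorAlgebra.ι 𝕜 (A (Module.finBasis 𝕜 S k)) *
      contractLeft ((Module.finBasis 𝕜 S).coord k) x := by
  simp [derivExt]

/-- The sign of the antiderivation rule is undone when the vector `A b_k` moves past the first
factor (`ι_mul_involute`); contraction followed by multiplication is thus an even derivation. -/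
theorem derivExt_mul (x y : ExteriorAlgebra 𝕜 S) :
    derivExt A (x * y) = derivExt A x * y + x * derivExt A y := by
  simp only [derivExt_apply, contractLeft_mul, mul_add, Finset.sum_add_distrib, Finset.sum_mul,
    Finset.mul_sum, ← mul_assoc, ι_mul_involute]

theorem derivExt_algebraMap (c : 𝕜) : derivExt A (algebraMap 𝕜 _ c) = 0 := by
  rw [derivExt_apply]
  exact Finset.sum_eq_zero fun k _ => by
    rw [CliffordAlgebra.contractLeft_algebraMap, mul_zero]

theorem derivExt_ι (v : S) :
    derivExt A (ExteriorAlgebra.ι 𝕜 v) = ExteriorAlgebra.ι 𝕜 (A v) := by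
  rw [derivExt_apply]
  conv_rhs => rw [← (Module.finBasis 𝕜 S).sum_repr v, map_sum, map_sum]
  refine Finset.sum_congr rfl fun k _ => ?_
  erw [CliffordAlgebra.contractLeft_ι]
  rw [← Algebra.commutes, ← Algebra.smul_def, map_smul, map_smul]
  rfl

theorem derivExt_ι' (v : S) :
    derivExt A (CliffordAlgebra.ι (0 : QuadraticForm 𝕜 S) v) = CliffordAlgebra.ι _ (A v) :=
  derivExt_ι A v

/-- `derivExt` as a linear map. -/
def derivExtHom (𝕜 S : Type*) [RCLike 𝕜] [AddCommGroup S] [Module 𝕜 S] [FiniteDimensional 𝕜 S] :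
    Module.End 𝕜 S →ₗ[𝕜] Module.End 𝕜 (ExteriorAlgebra 𝕜 S) where
  toFun := derivExt
  map_add' A B := by
    refine LinearMap.ext fun x => ?_
    simp only [derivExt_apply, LinearMap.add_apply, map_add, add_mul, Finset.sum_add_distrib]
  map_smul' c A := by
    refine LinearMap.ext fun x => ?_
    simp only [derivExt_apply, LinearMap.smul_apply, map_smul, smul_mul_assoc, Finset.smul_sum,
      RingHom.id_apply]

theorem derivExt_add : derivExt (A + B) = derivExt A + derivExt B := map_add (derivExtHom 𝕜 S) A B

theorem derivExt_sub : derivExt (A - B) = derivExt A - derivExt B := map_sub (derivExtHom 𝕜 S) A B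

theorem derivExt_smul (c : 𝕜) : derivExt (c • A) = c • derivExt A := map_smul (derivExtHom 𝕜 S) c A

/-- Both sides are derivations that kill scalars, so only generators matter, and there both are the
commutator on `S`. -/
theorem derivExt_lie (x : ExteriorAlgebra 𝕜 S) :
    derivExt A (derivExt B x) - derivExt B (derivExt A x) = derivExt (A * B - B * A) x := by
  induction x using CliffordAlgebra.left_induction with
  | algebraMap r => simp only [derivExt_algebraMap, map_zero, sub_zero]
  | add x y hx hy =>
    rw [map_add, map_add, map_add, map_add, map_add, ← hx, ← hy]
    abel
  | ι_mul x m hx =>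
    simp only [derivExt_mul, derivExt_ι', map_add, ← hx, LinearMap.sub_apply, map_sub,
      Module.End.mul_apply]
    simp only [sub_mul, mul_sub]
    abel

/-- With `g` a transition function, this is the change of frame for the endomorphism part of an
operator. -/
theorem map_derivExt {g A' : Module.End 𝕜 S} (h : g * A = A' * g) (x : ExteriorAlgebra 𝕜 S) :
    ExteriorAlgebra.map g (derivExt A x) = derivExt A' (ExteriorAlgebra.map g x) := by
  induction x using CliffordAlgebra.left_induction with
  | algebraMap r =>
    rw [derivExt_algebraMap, map_zero, AlgHom.commutes, derivExt_algebraMap]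
  | add x y hx hy => simp only [map_add, hx, hy]
  | ι_mul x m hx =>
    have h1 : ∀ v, ExteriorAlgebra.map g (CliffordAlgebra.ι (0 : QuadraticForm 𝕜 S) v)
      = CliffordAlgebra.ι (0 : QuadraticForm 𝕜 S) (g v) := ExteriorAlgebra.map_apply_ι g
    have h2 : g (A m) = A' (g m) := congrArg (fun L => L m) h
    simp only [derivExt_mul, derivExt_ι', map_add, map_mul, hx, h1, h2]

/-- The last term is the dual action on `d`. If `d` is pairing with `φ` under a form for which `A`
is skew, it becomes contraction with `A φ`. -/
theorem derivExt_contractLeft (d : Module.Dual 𝕜 S) (x : ExteriorAlgebra 𝕜 S) :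
    derivExt A (contractLeft d x) = contractLeft d (derivExt A x) - contractLeft (d ∘ₗ A) x := by
  induction x using CliffordAlgebra.left_induction with
  | algebraMap r =>
    rw [CliffordAlgebra.contractLeft_algebraMap, derivExt_algebraMap,
      CliffordAlgebra.contractLeft_algebraMap]
    simp
  | add x y hx hy => simp only [map_add, hx, hy]; abel
  | ι_mul x m hx =>
    simp only [derivExt_mul, derivExt_ι', map_add, map_sub, map_smul, hx,
      CliffordAlgebra.contractLeft_ι_mul, LinearMap.comp_apply, mul_sub]
    abel

omit [FiniteDimensional 𝕜 S] in
theorem map_contractLeft (g : Module.End 𝕜 S) (d : Module.Dual 𝕜 S) (x : ExteriorAlgebra 𝕜 S) :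
    ExteriorAlgebra.map g (contractLeft (d ∘ₗ g) x) = contractLeft d (ExteriorAlgebra.map g x) := by
  have h1 : ∀ v, ExteriorAlgebra.map g (CliffordAlgebra.ι (0 : QuadraticForm 𝕜 S) v)
    = CliffordAlgebra.ι (0 : QuadraticForm 𝕜 S) (g v) := ExteriorAlgebra.map_apply_ι g
  induction x using CliffordAlgebra.left_induction with
  | algebraMap r =>
    rw [CliffordAlgebra.contractLeft_algebraMap, AlgHom.commutes,
      CliffordAlgebra.contractLeft_algebraMap, map_zero]
  | add x y hx hy => simp only [map_add, hx, hy]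
  | ι_mul x m hx =>
    simp only [map_mul, map_sub, map_smul, hx, h1,
      CliffordAlgebra.contractLeft_ι_mul, LinearMap.comp_apply]

omit [FiniteDimensional 𝕜 S] in
theorem involute_map (g : Module.End 𝕜 S) (x : ExteriorAlgebra 𝕜 S) :
    involute (ExteriorAlgebra.map g x) = ExteriorAlgebra.map g (involute x) := by
  have h1 : ∀ v, ExteriorAlgebra.map g (CliffordAlgebra.ι (0 : QuadraticForm 𝕜 S) v)
    = CliffordAlgebra.ι (0 : QuadraticForm 𝕜 S) (g v) := ExteriorAlgebra.map_apply_ι g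
  induction x using CliffordAlgebra.left_induction with
  | algebraMap r => simp only [AlgHom.commutes]
  | add x y hx hy => simp only [map_add, hx, hy]
  | ι_mul x m hx =>
    simp only [map_mul, hx, h1, CliffordAlgebra.involute_ι, map_neg]

theorem involute_derivExt (x : ExteriorAlgebra 𝕜 S) :
    involute (derivExt A x) = derivExt A (involute x) := by
  induction x using CliffordAlgebra.left_induction with
  | algebraMap r => simp only [AlgHom.commutes, derivExt_algebraMap, map_zero]
  | add x y hx hy => simp only [map_add, hx, hy]
  | ι_mul x m hx =>
    simp only [map_mul, map_add, derivExt_mul, hx, derivExt_ι', CliffordAlgebra.involute_ι, map_neg]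

omit [FiniteDimensional 𝕜 S] in
-- As 2 is invertible, the homogeneous parts are the eigenspaces of the grading involution. A linear
-- equation of this form is inherited by derivatives.
theorem mem_parity_iff {p : ZMod 2} {x : ExteriorAlgebra 𝕜 S} :
    x ∈ parity 𝕜 S p ↔ involute x = superSign p 1 • x := by
  obtain ⟨x₀, h₀, x₁, h₁, rfl⟩ := Submodule.mem_sup.1
    ((CliffordAlgebra.evenOdd_isCompl (Q := (0 : QuadraticForm 𝕜 S))).codisjoint.eq_top.symm ▸
      Submodule.mem_top : x ∈ _)
  have e0 := CliffordAlgebra.involute_eq_of_mem_even h₀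
  have e1 := CliffordAlgebra.involute_eq_of_mem_odd h₁
  have h2 : ∀ y : ExteriorAlgebra 𝕜 S, y + y = 0 → y = 0 := fun y hy => by
    rw [← two_smul 𝕜] at hy
    exact (smul_eq_zero.1 hy).resolve_left two_ne_zero
  have hp : p = 0 ∨ p = 1 := by revert p; decide
  rcases hp with rfl | rfl
  · rw [show superSign 0 1 = 1 from rfl, one_smul]
    constructor
    · exact CliffordAlgebra.involute_eq_of_mem_even
    · intro h
      rw [map_add, e0, e1] at h
      have : x₁ = 0 := h2 _ (by simpa [neg_eq_iff_add_eq_zero] using h)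
      rw [this, add_zero]
      exact h₀
  · rw [show superSign 1 1 = -1 from rfl, neg_one_smul]
    constructor
    · exact CliffordAlgebra.involute_eq_of_mem_odd
    · intro h
      rw [map_add, e0, e1] at h
      have : x₀ = 0 := h2 _ (by
        rw [neg_add] at h
        exact eq_neg_iff_add_eq_zero.1 (add_right_cancel h))
      rw [this, zero_add]
      exact h₁

end Exterior

/-! ### The spin Lie algebra inside the Clifford algebra -/

section Clifford

open CliffordAlgebra (contractLeft involute)

theorem derivExt_one_prod {𝕜 S : Type*} [RCLike 𝕜] [AddCommGroup S] [Module 𝕜 S]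
    [FiniteDimensional 𝕜 S] (l : List S) :
    derivExt (1 : Module.End 𝕜 S) (l.map (ExteriorAlgebra.ι 𝕜)).prod
      = (l.length : 𝕜) • (l.map (ExteriorAlgebra.ι 𝕜)).prod := by
  induction l with
  | nil =>
    have := derivExt_algebraMap (1 : Module.End 𝕜 S) 1
    simpa using this
  | cons v l ih =>
    rw [List.map_cons, List.prod_cons, derivExt_mul, derivExt_ι, ih, List.length_cons]
    simp only [Module.End.one_apply, mul_smul_comm, Nat.cast_add, Nat.cast_one, add_smul, one_smul]
    abel

/-- The identity extends to the degree operator, which is diagonal in the basis of exterior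
monomials; in characteristic zero its kernel is spanned by the empty monomial. -/
theorem exists_algebraMap_of_derivExt_one {𝕜 S : Type*} [RCLike 𝕜] [AddCommGroup S] [Module 𝕜 S]
    [FiniteDimensional 𝕜 S] {x : ExteriorAlgebra 𝕜 S} (hx : derivExt (1 : Module.End 𝕜 S) x = 0) :
    ∃ c, x = algebraMap 𝕜 _ c := by
  set b := (Module.finBasis 𝕜 S).ExteriorAlgebra with hb
  have hJ : ∀ J, derivExt (1 : Module.End 𝕜 S) (b J) = (J.card : 𝕜) • b J := by
    intro J
    obtain ⟨v, hv⟩ : ∃ v : Fin J.card → S, b J = ExteriorAlgebra.ιMulti 𝕜 J.card v :=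
      ⟨_, ExteriorAlgebra.basis_apply _ _⟩
    have h1 : (List.ofFn fun i => ExteriorAlgebra.ι 𝕜 (v i))
        = (List.ofFn v).map (ExteriorAlgebra.ι 𝕜) := by
      rw [List.map_ofFn]
      rfl
    rw [hv, ExteriorAlgebra.ιMulti_apply, h1, derivExt_one_prod, List.length_ofFn]
  rw [← b.sum_repr x, map_sum] at hx
  simp only [map_smul, hJ, smul_smul] at hx
  have h0 := Fintype.linearIndependent_iff.1 b.linearIndependent _ hx
  refine ⟨b.repr x ∅, ?_⟩
  conv_lhs => rw [← b.sum_repr x]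
  rw [Finset.sum_eq_single ∅]
  · obtain ⟨v, hv⟩ : ∃ v : Fin 0 → S, b ∅ = ExteriorAlgebra.ιMulti 𝕜 0 v :=
      ⟨_, ExteriorAlgebra.basis_apply _ _⟩
    rw [Algebra.algebraMap_eq_smul_one, hv, ExteriorAlgebra.ιMulti_zero_apply]
  · intro J _ hJ'
    have h1 := (mul_eq_zero.1 (h0 J)).resolve_right (by simpa using hJ')
    rw [h1, zero_smul]
  · simp

/-- The linear identification with the exterior algebra respects contractions, and there the degree
operator is a sum of contractions followed by multiplications. An element killed by all contractions
has degree zero. -/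
theorem exists_algebraMap_of_contractLeft {V : Type*} [AddCommGroup V] [Module ℝ V]
    [FiniteDimensional ℝ V] {Q : QuadraticForm ℝ V} {x : CliffordAlgebra Q}
    (hx : ∀ d : Module.Dual ℝ V, contractLeft d x = 0) : ∃ c, x = algebraMap ℝ _ c := by
  obtain ⟨c, hc⟩ := exists_algebraMap_of_derivExt_one (𝕜 := ℝ)
    (x := CliffordAlgebra.equivExterior Q x) (by
      rw [derivExt_apply]
      refine Finset.sum_eq_zero fun k _ => ?_
      have := CliffordAlgebra.changeForm_contractLeft (Q := Q) (Q' := 0)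
        (CliffordAlgebra.changeForm.associated_neg_proof) ((Module.finBasis ℝ V).coord k) x
      rw [hx, map_zero] at this
      have h2 : contractLeft ((Module.finBasis ℝ V).coord k) (CliffordAlgebra.equivExterior Q x) = 0 :=
        this.symm
      rw [h2, mul_zero])
  refine ⟨c, (CliffordAlgebra.equivExterior Q).injective ?_⟩
  rw [hc]
  exact (CliffordAlgebra.changeForm_algebraMap
    (CliffordAlgebra.changeForm.associated_neg_proof (Q := Q)) c).symm

/-- Both the supercommutator with a vector and the contraction are antiderivations, and on a
generator both give the polar form. This turns commutation conditions into vanishing contractions.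
-/
theorem ι_mul_sub_involute_mul_ι {R V : Type*} [CommRing R] [AddCommGroup V] [Module R V]
    {Q : QuadraticForm R V} (v : V) (x : CliffordAlgebra Q) :
    CliffordAlgebra.ι Q v * x - involute x * CliffordAlgebra.ι Q v
      = contractLeft (QuadraticMap.polarBilin Q v) x := by
  induction x using CliffordAlgebra.left_induction with
  | algebraMap r =>
    rw [AlgHom.commutes, Algebra.commutes, sub_self, CliffordAlgebra.contractLeft_algebraMap]
  | add x y hx hy => rw [map_add, map_add, ← hx, ← hy, mul_add, add_mul]; abel
  | ι_mul x m hx =>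
    have h1 : CliffordAlgebra.ι Q v * CliffordAlgebra.ι Q m =
        algebraMap R _ (QuadraticMap.polar Q v m) - CliffordAlgebra.ι Q m * CliffordAlgebra.ι Q v :=
      eq_sub_of_add_eq (CliffordAlgebra.ι_mul_ι_add_swap v m)
    rw [CliffordAlgebra.contractLeft_ι_mul, ← hx, map_mul, CliffordAlgebra.involute_ι, ← mul_assoc,
      h1, sub_mul, ← Algebra.smul_def, QuadraticMap.polarBilin_apply_apply]
    simp only [neg_mul, mul_sub, mul_assoc]
    abel

variable {s t : ℕ}

/-- The generators of the Clifford algebra. -/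
def gam (k : Fin s ⊕ Fin t) : Cl s t := CliffordAlgebra.ι (cliffordForm s t) (Pi.single k 1)

theorem eta_mul_self (k : Fin s ⊕ Fin t) : eta k * eta k = 1 := by
  rcases k with k | k <;> simp [eta]

theorem polar_cliffordForm (v w : ModelVec s t) :
    QuadraticMap.polar (cliffordForm s t) v w = ∑ k, -2 * eta k * v k * w k := by
  simp only [QuadraticMap.polar, cliffordForm, QuadraticMap.weightedSumSquares_apply, Pi.add_apply,
    ← Finset.sum_sub_distrib, smul_eq_mul]
  exact Finset.sum_congr rfl fun k _ => by ring

theorem gam_mul_gam (k l : Fin s ⊕ Fin t) :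
    gam k * gam l = (if k = l then algebraMap ℝ (Cl s t) (-2 * eta k) else 0) - gam l * gam k := by
  rw [gam, gam, eq_sub_iff_add_eq, CliffordAlgebra.ι_mul_ι_add_swap, polar_cliffordForm]
  rw [Finset.sum_eq_single k]
  · by_cases h : k = l
    · subst h; simp
    · rw [Pi.single_eq_of_ne h]
      simp [h]
  · intro j _ hj
    simp [Pi.single_eq_of_ne hj]
  · simp

theorem ι_eq_sum_gam (v : ModelVec s t) :
    CliffordAlgebra.ι (cliffordForm s t) v = ∑ k, v k • gam k := by
  simp only [gam, ← map_smul, ← map_sum]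
  congr 1
  ext j
  simp [Finset.sum_apply, Pi.single_apply]

/-- Even skew elements that commute with all vectors vanish. -/
theorem eq_zero_of_commute_gam {z : Cl s t} (h0 : involute z = z) (h1 : star z = -z)
    (h2 : ∀ k, z * gam k = gam k * z) : z = 0 := by
  have hc : ∀ v, CliffordAlgebra.ι (cliffordForm s t) v * z
      = z * CliffordAlgebra.ι (cliffordForm s t) v := by
    intro v
    simp only [ι_eq_sum_gam, Finset.sum_mul, Finset.mul_sum, smul_mul_assoc, mul_smul_comm, h2]
  -- For even `z`, commuting with a vector means that the contraction with its polar form vanishes.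
  -- The polar form has matrix `-2 η`, so `d` is represented by the vector with components `-½ η_k
  -- d(e_k)`.
  obtain ⟨c, rfl⟩ := exists_algebraMap_of_contractLeft (x := z) fun d => by
    have h3 := ι_mul_sub_involute_mul_ι (Q := cliffordForm s t)
      (fun k => -(1 / 2) * eta k * d (Pi.single k 1)) z
    rw [h0, hc, sub_self] at h3
    rw [h3]
    congr 1
    refine congrArg _ ?_
    refine LinearMap.pi_ext' fun k => LinearMap.ext_ring ?_
    simp only [LinearMap.comp_apply, LinearMap.single_apply, QuadraticMap.polarBilin_apply_apply,
      polar_cliffordForm]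
    rw [Finset.sum_eq_single k]
    · have := eta_mul_self k
      simp only [Pi.single_eq_same]
      linear_combination (-1 * d (Pi.single k 1)) * this
    · intro j _ hj
      simp [Pi.single_eq_of_ne hj]
    · simp
  -- Conjugation fixes scalars, so a skew scalar is zero.
  rw [CliffordAlgebra.star_algebraMap, eq_neg_iff_add_eq_zero, ← map_add] at h1
  have h4 : c + c = 0 := by
    apply (algebraMap ℝ (Cl s t)).injective
    rw [h1, map_zero]
  rw [show c = 0 by linarith, map_zero]

/-- The element `¼ B_{kl} γ^k γ^l` of the Clifford algebra. -/
def spinElt (B : Fin s ⊕ Fin t → Fin s ⊕ Fin t → ℝ) : Cl s t :=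
  (spinImage B : CliffordAlgebra.even (cliffordForm s t))

theorem spinElt_eq (B : Fin s ⊕ Fin t → Fin s ⊕ Fin t → ℝ) :
    spinElt B = (1 / 4 : ℝ) • ∑ k, ∑ l, (eta k * eta l * B k l) • (gam k * gam l) := by
  simp only [spinElt, spinImage, SetLike.val_smul, AddSubmonoidClass.coe_finsetSum]
  rfl

theorem involute_spinElt (B : Fin s ⊕ Fin t → Fin s ⊕ Fin t → ℝ) :
    involute (spinElt B) = spinElt B :=
  CliffordAlgebra.involute_eq_of_mem_even (spinImage B).2

theorem star_gam (k : Fin s ⊕ Fin t) : star (gam k) = -gam k := CliffordAlgebra.star_ι _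

theorem star_spinElt {B : Fin s ⊕ Fin t → Fin s ⊕ Fin t → ℝ} (hB : ∀ k l, B k l = -B l k) :
    star (spinElt B) = -spinElt B := by
  simp only [spinElt_eq, CliffordAlgebra.star_smul, star_sum, star_mul, star_gam, neg_mul_neg]
  rw [Finset.sum_comm, ← smul_neg, ← Finset.sum_neg_distrib]
  refine congrArg _ (Finset.sum_congr rfl fun k _ => ?_)
  rw [← Finset.sum_neg_distrib]
  refine Finset.sum_congr rfl fun l _ => ?_
  rw [hB l k, ← neg_smul]
  congr 1
  ring

/-- This is the vector representation of `𝔰𝔭𝔦𝔫`. Moving `γ_m` through `γ_k γ_l` leaves two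
remainders with factor 2, one for each index; by skewness they add up and cancel the normalisation
`¼`. -/
theorem spinElt_mul_gam {B : Fin s ⊕ Fin t → Fin s ⊕ Fin t → ℝ} (hB : ∀ k l, B k l = -B l k)
    (m : Fin s ⊕ Fin t) :
    spinElt B * gam m = gam m * spinElt B + ∑ l, (eta l * B m l) • gam l := by
  have key : ∀ k l, gam k * gam l * gam m = gam m * (gam k * gam l)
      + (if l = m then (-2 * eta m) • gam k else 0) - if k = m then (-2 * eta m) • gam l else 0 := by
    intro k l
    rw [mul_assoc, gam_mul_gam l m, mul_sub, ← mul_assoc (gam k), gam_mul_gam k m, sub_mul,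
      mul_assoc (gam m)]
    have e1 : gam k * (if l = m then algebraMap ℝ (Cl s t) (-2 * eta l) else 0)
        = if l = m then (-2 * eta m) • gam k else 0 := by
      split_ifs with h
      · rw [h, ← Algebra.commutes, ← Algebra.smul_def]
      · simp
    have e2 : (if k = m then algebraMap ℝ (Cl s t) (-2 * eta k) else 0) * gam l
        = if k = m then (-2 * eta m) • gam l else 0 := by
      split_ifs with h
      · rw [h, ← Algebra.smul_def]
      · simp
    rw [e1, e2]
    abel
  rw [spinElt_eq]
  simp only [smul_mul_assoc, mul_smul_comm, Finset.sum_mul, Finset.mul_sum, key, smul_sub, smul_add,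
    Finset.sum_add_distrib, Finset.sum_sub_distrib, smul_ite, smul_zero, Finset.sum_ite_eq',
    Finset.mem_univ, if_true, smul_smul]
  rw [add_sub_assoc]
  congr 1
  have e3 : (∑ x, ∑ x_1, if x = m then (eta x * eta x_1 * B x x_1 * (-2 * eta m)) • gam x_1 else 0)
      = ∑ l, (eta m * eta l * B m l * (-2 * eta m)) • gam l := by
    rw [Finset.sum_comm]
    simp
  rw [e3, ← smul_sub, ← Finset.sum_sub_distrib, Finset.smul_sum]
  refine Finset.sum_congr rfl fun l _ => ?_
  rw [← sub_smul, smul_smul, hB l m]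
  congr 1
  linear_combination (eta l * B m l) * eta_mul_self m

/-- The infinitesimal form of a change of frames determines the logarithmic derivative of its lift
to the spin group. -/
theorem add_spinElt_mul_eq {a a' : Cl s t} (ha : involute a = a) (ha' : involute a' = a')
    (h1 : star a * a = 1) (h1' : a * star a = 1) (h2 : star a' * a + star a * a' = 0)
    {Λ Λ' B C : Fin s ⊕ Fin t → Fin s ⊕ Fin t → ℝ} (hB : ∀ k l, B k l = -B l k)
    (hC : ∀ k l, C k l = -C l k) (hΛ : ∀ k, a * gam k = ∑ l, Λ k l • (gam l * a))
    (hΛ' : ∀ k, a' * gam k = ∑ l, Λ' k l • (gam l * a) + ∑ l, Λ k l • (gam l * a'))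
    (h : ∀ k m, Λ' k m + ∑ l, Λ k l * (eta m * B l m) = ∑ l, eta l * C k l * Λ l m) :
    a' + spinElt B * a = a * spinElt C := by
  -- The hypothesis `h` is exactly what makes the defect pass through vectors by the same matrix `Λ`
  -- as `a` does.
  have hy : ∀ k, (a' + spinElt B * a - a * spinElt C) * gam k
      = ∑ l, Λ k l • (gam l * (a' + spinElt B * a - a * spinElt C)) := by
    intro k
    have e1 : spinElt B * a * gam k = ∑ l, Λ k l • (gam l * (spinElt B * a))
        + ∑ m, (∑ l, Λ k l * (eta m * B l m)) • (gam m * a) := by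
      rw [mul_assoc, hΛ, Finset.mul_sum]
      simp only [mul_smul_comm, ← mul_assoc, spinElt_mul_gam hB, add_mul, smul_add,
        Finset.sum_add_distrib, Finset.sum_mul, Finset.smul_sum, smul_mul_assoc, smul_smul,
        Finset.sum_smul]
      exact congrArg _ Finset.sum_comm
    have e2 : a * spinElt C * gam k = ∑ l, Λ k l • (gam l * (a * spinElt C))
        + ∑ m, (∑ l, eta l * C k l * Λ l m) • (gam m * a) := by
      rw [mul_assoc, spinElt_mul_gam hC, mul_add, ← mul_assoc, hΛ, Finset.sum_mul, Finset.mul_sum]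
      simp only [mul_smul_comm, hΛ, smul_mul_assoc, mul_assoc, Finset.smul_sum, smul_smul,
        Finset.sum_smul]
      exact congrArg _ Finset.sum_comm
    rw [sub_mul, add_mul, hΛ', e1, e2]
    simp only [← h, add_smul, mul_sub, mul_add, smul_add, smul_sub, Finset.sum_add_distrib,
      Finset.sum_sub_distrib]
    abel
  have hsa : involute (star a) = star a := by
    rw [CliffordAlgebra.star_def, ← CliffordAlgebra.reverse_involute, ha, ha]
  -- Multiplying by `a⁻¹ = star a` gives an element that commutes with all vectors. It is even and
  -- skew, the latter because `star a * a'` is skew by `h2`, so it vanishes.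
  have hz : star a * (a' + spinElt B * a - a * spinElt C) = 0 := by
    refine eq_zero_of_commute_gam ?_ ?_ fun k => ?_
    · simp only [map_mul, map_sub, map_add, ha, ha', hsa, involute_spinElt]
    · simp only [star_mul, star_sub, star_add, star_spinElt hB, star_spinElt hC, star_star,
        mul_sub, mul_add, neg_mul, mul_neg, mul_assoc, h1]
      rw [← mul_assoc (star a) a, h1, one_mul, mul_one, eq_neg_of_add_eq_zero_left h2]
      abel
    · have h3 : ∀ k, gam k * star a = star a * ∑ l, Λ k l • gam l := by
        intro k
        have : gam k = star a * ∑ l, Λ k l • (gam l * a) := by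
          rw [← hΛ, ← mul_assoc, h1, one_mul]
        calc gam k * star a = star a * (∑ l, Λ k l • (gam l * a)) * star a := by rw [← this]
          _ = _ := by
            simp only [Finset.mul_sum, Finset.sum_mul, mul_assoc, smul_mul_assoc, mul_smul_comm,
              h1', mul_one]
      rw [mul_assoc, hy, ← mul_assoc, h3, mul_assoc, Finset.sum_mul]
      simp only [smul_mul_assoc]
  have h4 : a' + spinElt B * a - a * spinElt C = 0 := by
    rw [← one_mul (a' + spinElt B * a - a * spinElt C), ← h1', mul_assoc, hz, mul_zero]
  exact sub_eq_zero.1 h4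

/-- Even skew elements are determined by their commutators with vectors, so only these are compared.
The matrix products occur in reversed order because the row index is the one attached to the vector
being acted on. -/
theorem spinElt_lie {B C D E : Fin s ⊕ Fin t → Fin s ⊕ Fin t → ℝ} (hB : ∀ k l, B k l = -B l k)
    (hC : ∀ k l, C k l = -C l k) (hD : ∀ k l, D k l = -D l k) (hE : ∀ k l, E k l = -E l k)
    (h : ∀ m p, E m p = D m p + ∑ l, eta l * (C m l * B l p - B m l * C l p)) :
    spinElt D + (spinElt B * spinElt C - spinElt C * spinElt B) = spinElt E := by
  refine sub_eq_zero.1 (eq_zero_of_commute_gam ?_ ?_ fun m => ?_)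
  · simp only [map_mul, map_sub, map_add, involute_spinElt]
  · simp only [star_mul, star_sub, star_add, star_spinElt hB, star_spinElt hC, star_spinElt hD,
      star_spinElt hE, neg_mul_neg]
    abel
  · have e1 : ∀ {B C : Fin s ⊕ Fin t → Fin s ⊕ Fin t → ℝ}, (∀ k l, B k l = -B l k) →
        (∀ k l, C k l = -C l k) → spinElt B * spinElt C * gam m = gam m * (spinElt B * spinElt C)
        + ∑ l, (eta l * B m l) • (gam l * spinElt C) + ∑ l, (eta l * C m l) • (gam l * spinElt B)
        + ∑ p, (∑ l, eta l * C m l * (eta p * B l p)) • gam p := by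
      intro B C hB hC
      rw [mul_assoc, spinElt_mul_gam hC, mul_add, ← mul_assoc, spinElt_mul_gam hB, add_mul,
        Finset.mul_sum, Finset.sum_mul]
      simp only [mul_smul_comm, spinElt_mul_gam hB, smul_add, Finset.sum_add_distrib,
        Finset.smul_sum, smul_smul, smul_mul_assoc, mul_assoc, Finset.sum_smul]
      rw [Finset.sum_comm (f := fun l p => (eta l * (C m l * (eta p * B l p))) • gam p)]
      abel
    have e2 : ∑ l, (eta l * E m l) • gam l = ∑ l, (eta l * D m l) • gam l
        + (∑ p, (∑ l, eta l * C m l * (eta p * B l p)) • (gam p : Cl s t)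
        - ∑ p, (∑ l, eta l * B m l * (eta p * C l p)) • (gam p : Cl s t)) := by
      rw [← Finset.sum_sub_distrib, ← Finset.sum_add_distrib]
      refine Finset.sum_congr rfl fun p _ => ?_
      rw [← sub_smul, ← add_smul, h, mul_add, ← Finset.sum_sub_distrib, Finset.mul_sum]
      congr 2
      refine Finset.sum_congr rfl fun l _ => ?_
      ring
    rw [sub_mul, add_mul, sub_mul, e1 hB hC, e1 hC hB, spinElt_mul_gam hD, spinElt_mul_gam hE, e2]
    simp only [mul_sub, mul_add]
    abel

end Clifford

/-! ### The representation on the fibre and invariance of the charge conjugation -/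

section Representation

open CliffordAlgebra (involute)

variable {s t : ℕ} {𝕜 S : Type*} [RCLike 𝕜] [AddCommGroup S] [Module 𝕜 S]

/-- Projecting to the even part first makes the representation a real-linear map on the whole
Clifford algebra, so transition functions can be differentiated there. -/
theorem half_add_involute_mem (x : Cl s t) :
    (1 / 2 : ℝ) • (x + involute x) ∈ CliffordAlgebra.even (cliffordForm s t) := by
  obtain ⟨x₀, h₀, x₁, h₁, rfl⟩ := Submodule.mem_sup.1
    ((CliffordAlgebra.evenOdd_isCompl (Q := cliffordForm s t)).codisjoint.eq_top.symm ▸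
      Submodule.mem_top : x ∈ _)
  rw [map_add, CliffordAlgebra.involute_eq_of_mem_even h₀, CliffordAlgebra.involute_eq_of_mem_odd h₁,
    show x₀ + x₁ + (x₀ + -x₁) = x₀ + x₀ by abel]
  exact Submodule.smul_mem _ _ (add_mem h₀ h₀)

namespace SpinModule

variable (σ : SpinModule s t 𝕜 S)

/-- The representation, extended by zero to the odd part of the Clifford algebra. -/
def repCl (x : Cl s t) : Module.End 𝕜 S := σ.rep ⟨_, half_add_involute_mem x⟩

theorem repCl_coe (x : CliffordAlgebra.even (cliffordForm s t)) : σ.repCl x = σ.rep x := by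
  refine congrArg σ.rep (Subtype.ext ?_)
  change (1 / 2 : ℝ) • ((x : Cl s t) + involute (x : Cl s t)) = x
  rw [CliffordAlgebra.involute_eq_of_mem_even x.2, ← two_smul ℝ, smul_smul]
  norm_num

theorem mem_even_of_involute {x : Cl s t} (hx : involute x = x) :
    x ∈ CliffordAlgebra.even (cliffordForm s t) := by
  have h := half_add_involute_mem x
  rw [hx, ← two_smul ℝ, smul_smul] at h
  norm_num at h
  exact h

theorem repCl_add (x y : Cl s t) : σ.repCl (x + y) = σ.repCl x + σ.repCl y := by
  rw [repCl, repCl, repCl, ← map_add]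
  refine congrArg σ.rep (Subtype.ext ?_)
  change (1 / 2 : ℝ) • (x + y + involute (x + y)) =
    (1 / 2 : ℝ) • (x + involute x) + (1 / 2 : ℝ) • (y + involute y)
  rw [map_add, ← smul_add]
  congr 1
  abel

theorem repCl_smul (r : ℝ) (x : Cl s t) : σ.repCl (r • x) = (r : 𝕜) • σ.repCl x := by
  have h : σ.repCl (r • x) = σ.rep (algebraMap ℝ _ r * ⟨_, half_add_involute_mem x⟩) := by
    refine congrArg σ.rep (Subtype.ext ?_)
    change (1 / 2 : ℝ) • (r • x + involute (r • x)) =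
      algebraMap ℝ (Cl s t) r * (1 / 2 : ℝ) • (x + involute x)
    rw [map_smul, ← smul_add, ← Algebra.smul_def, smul_comm]
  rw [h, map_mul, σ.rep_algebraMap, smul_mul_assoc, one_mul]
  rfl

theorem repCl_mul {x y : Cl s t} (hx : involute x = x) (hy : involute y = y) :
    σ.repCl (x * y) = σ.repCl x * σ.repCl y := by
  have h := σ.repCl_coe (⟨x, mem_even_of_involute hx⟩ * ⟨y, mem_even_of_involute hy⟩)
  rw [map_mul, ← repCl_coe, ← repCl_coe] at h
  exact h

theorem repCl_one : σ.repCl 1 = 1 := by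
  rw [← map_one σ.rep, ← repCl_coe]
  rfl

theorem act_eq_repCl (a : spinGroup (cliffordForm s t)) : σ.act a = σ.repCl (a : Cl s t) :=
  (σ.repCl_coe ⟨a, spinGroup.mem_even a.2⟩).symm

theorem rep_spinImage (B : Fin s ⊕ Fin t → Fin s ⊕ Fin t → ℝ) :
    σ.rep (spinImage B) = σ.repCl (spinElt B) := (σ.repCl_coe _).symm

theorem act_mul (a b : spinGroup (cliffordForm s t)) : σ.act (a * b) = σ.act a * σ.act b := by
  simp only [act_eq_repCl]
  exact σ.repCl_mul (spinGroup.involute_eq a.2) (spinGroup.involute_eq b.2)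

theorem act_one : σ.act 1 = 1 := by
  rw [act_eq_repCl]
  exact σ.repCl_one

/-- Write `v w` as half its commutator plus half its anticommutator. The commutator is skew for the
form by invariance, the anticommutator is a real scalar, and together they give the adjoint `w v`.
-/
theorem charge_repCl_ι_mul_ι (v w : ModelVec s t) (φ ψ : S) :
    σ.charge (σ.repCl (CliffordAlgebra.ι (cliffordForm s t) v * CliffordAlgebra.ι _ w) φ) ψ
      = σ.charge φ (σ.repCl (CliffordAlgebra.ι _ w * CliffordAlgebra.ι _ v) ψ) := by
  have h := σ.charge_invariant v w φ ψ
  rw [← repCl_coe] at h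
  have e : (((CliffordAlgebra.even.ι (cliffordForm s t)).bilin v w
      - (CliffordAlgebra.even.ι (cliffordForm s t)).bilin w v :
      CliffordAlgebra.even (cliffordForm s t)) : Cl s t)
      = CliffordAlgebra.ι (cliffordForm s t) v * CliffordAlgebra.ι _ w
        + (-1 : ℝ) • (CliffordAlgebra.ι _ w * CliffordAlgebra.ι _ v) := by
    rw [neg_one_smul, ← sub_eq_add_neg]
    rfl
  have h2 : ∀ χ, σ.repCl (CliffordAlgebra.ι (cliffordForm s t) v * CliffordAlgebra.ι _ w) χ
      + σ.repCl (CliffordAlgebra.ι (cliffordForm s t) w * CliffordAlgebra.ι _ v) χ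
      = ((QuadraticMap.polar (cliffordForm s t) v w : ℝ) : 𝕜) • χ := by
    intro χ
    rw [← LinearMap.add_apply, ← repCl_add, CliffordAlgebra.ι_mul_ι_add_swap,
      Algebra.algebraMap_eq_smul_one, repCl_smul, repCl_one]
    rfl
  have h3 := congrArg (fun χ => σ.charge χ ψ) (h2 φ)
  have h4 := congrArg (fun χ => σ.charge φ χ) (h2 ψ)
  rw [e, repCl_add, repCl_smul] at h
  simp only [map_add, map_smul, LinearMap.add_apply, LinearMap.smul_apply, smul_eq_mul,
    RCLike.ofReal_neg, RCLike.ofReal_one] at h h3 h4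
  linear_combination (1 / 2 : 𝕜) * h + (1 / 2 : 𝕜) * h3 - (1 / 2 : 𝕜) * h4

/-- Products of two vectors generate the even algebra, and adjoints reverse products just as `star`
does. -/
theorem charge_repCl {x : Cl s t} (hx : involute x = x) (φ ψ : S) :
    σ.charge (σ.repCl x φ) ψ = σ.charge φ (σ.repCl (star x) ψ) := by
  have hx' := mem_even_of_involute hx
  clear hx
  replace hx' : x ∈ CliffordAlgebra.evenOdd (cliffordForm s t) 0 := hx'
  induction x, hx' using CliffordAlgebra.even_induction generalizing φ ψ with
  | algebraMap r =>
    rw [CliffordAlgebra.star_algebraMap, Algebra.algebraMap_eq_smul_one, repCl_smul, repCl_one]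
    simp [RCLike.real_smul_eq_coe_mul]
  | add x y hx hy ihx ihy => simp only [repCl_add, star_add, LinearMap.add_apply, map_add, ihx, ihy]
  | ι_mul_ι_mul v w x hx ih =>
    have e1 : ∀ v w, involute (CliffordAlgebra.ι (cliffordForm s t) v * CliffordAlgebra.ι _ w)
        = CliffordAlgebra.ι (cliffordForm s t) v * CliffordAlgebra.ι _ w := by
      intro v w
      rw [map_mul, CliffordAlgebra.involute_ι, CliffordAlgebra.involute_ι, neg_mul_neg]
    have e2 := CliffordAlgebra.involute_eq_of_mem_even hx
    have e3 : involute (star x) = star x := by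
      rw [CliffordAlgebra.star_def, ← CliffordAlgebra.reverse_involute, e2, e2]
    rw [σ.repCl_mul (e1 v w) e2, star_mul, star_mul, CliffordAlgebra.star_ι, CliffordAlgebra.star_ι,
      neg_mul_neg, σ.repCl_mul e3 (e1 w v), Module.End.mul_apply, charge_repCl_ι_mul_ι, ih]
    rfl

/-- Invariance under the group follows from `star a * a = 1` and the adjoint formula; no
connectedness of the spin group is involved. -/
theorem charge_act (a : spinGroup (cliffordForm s t)) (φ ψ : S) :
    σ.charge (σ.act a φ) (σ.act a ψ) = σ.charge φ ψ := by
  have ha : involute (a : Cl s t) = a := spinGroup.involute_eq a.2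
  have ha' : involute (star (a : Cl s t)) = star (a : Cl s t) := by
    rw [CliffordAlgebra.star_def, ← CliffordAlgebra.reverse_involute, ha, ha]
  rw [act_eq_repCl, σ.charge_repCl ha, ← Module.End.mul_apply, ← σ.repCl_mul ha' ha,
    spinGroup.coe_star_mul_self, repCl_one]
  rfl

theorem charge_spinElt {B : Fin s ⊕ Fin t → Fin s ⊕ Fin t → ℝ} (hB : ∀ k l, B k l = -B l k)
    (φ ψ : S) :
    σ.charge (σ.repCl (spinElt B) φ) ψ = -σ.charge φ (σ.repCl (spinElt B) ψ) := by
  rw [σ.charge_repCl (involute_spinElt B), star_spinElt hB, ← neg_one_smul ℝ, repCl_smul]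
  simp

end SpinModule

end Representation

end SuperKilling

end

noncomputable section

namespace SuperKilling

/-! ### Sums of smooth scalar functions -/

section Scalar

variable {n : ℕ} {M : Type*} [TopologicalSpace M] [ChartedSpace (EuclideanSpace ℝ (Fin n)) M]
  {𝕜 : Type*} [RCLike 𝕜] {f f' : M → 𝕜} {x : M}

theorem SmoothAt.add' (hf : SmoothAt n f x) (hf' : SmoothAt n f' x) :
    SmoothAt n (fun y => f y + f' y) x := ContMDiffAt.add hf hf'

theorem SmoothAt.sub' (hf : SmoothAt n f x) (hf' : SmoothAt n f' x) :
    SmoothAt n (fun y => f y - f' y) x := ContMDiffAt.sub hf hf'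

theorem SmoothAt.neg' (hf : SmoothAt n f x) : SmoothAt n (fun y => -f y) x := ContMDiffAt.neg hf

theorem SmoothAt.sum' {J : Type*} {s : Finset J} {f : J → M → 𝕜} (hf : ∀ j, SmoothAt n (f j) x) :
    SmoothAt n (fun y => ∑ j ∈ s, f j y) x := contMDiffAt_finsetSum fun j _ => hf j

theorem SmoothAt.const (c : 𝕜) : SmoothAt n (fun _ : M => c) x := contMDiffAt_const

theorem dirDeriv_sum {J : Type*} (s : Finset J) {f : J → M → 𝕜}
    (hf : ∀ j, SmoothAt n (f j) x) (v : TangentSpace (𝓡 n) x) :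
    dirDeriv (fun y => ∑ j ∈ s, f j y) x v = ∑ j ∈ s, dirDeriv (f j) x v := by
  classical
  induction s using Finset.induction_on with
  | empty => simpa using dirDeriv_const v (0 : 𝕜)
  | insert j s hj ih =>
    simp only [Finset.sum_insert hj]
    rw [dirDeriv_add _ (hf j) (contMDiffAt_finsetSum fun j _ => hf j), ih]

theorem dirDeriv_neg (hf : SmoothAt n f x) (v : TangentSpace (𝓡 n) x) :
    dirDeriv (fun y => -f y) x v = -dirDeriv f x v := by
  simpa using dirDeriv_clm v (-(ContinuousLinearMap.id ℝ 𝕜)) hf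

end Scalar

/-! ### The Koszul expression and its invariance under Killing fields -/

section Koszul

variable {n : ℕ} {M : Type*} [TopologicalSpace M] [ChartedSpace (EuclideanSpace ℝ (Fin n)) M]
  [IsManifold (𝓡 n) ∞ M] (g : PseudoMetric n M) {x : M} {W X Y Z : ∀ x : M, TangentSpace (𝓡 n) x}

local notation "⟦" X ", " Y "⟧" => VectorField.mlieBracket (𝓡 n) X Y

/-- The function `g(X, Y)`. -/
def PseudoMetric.pair (X Y : ∀ x : M, TangentSpace (𝓡 n) x) (y : M) : ℝ := g.val y (X y) (Y y)

theorem PseudoMetric.pair_comm (X Y : ∀ x : M, TangentSpace (𝓡 n) x) : g.pair X Y = g.pair Y X :=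
  funext fun y => g.symm y _ _

theorem SmoothFieldAt.pair (hX : SmoothFieldAt n X x) (hY : SmoothFieldAt n Y x) :
    SmoothAt n (g.pair X Y) x := by
  have : ContMDiffAt (𝓡 n) ((𝓡 n).prod 𝓘(ℝ)) ∞
      (fun m ↦ TotalSpace.mk' ℝ (E := Bundle.Trivial M ℝ) m (g.val m (X m) (Y m))) x := by
    apply ContMDiffAt.clm_bundle_apply₂ (F₁ := EuclideanSpace ℝ (Fin n))
      (F₂ := EuclideanSpace ℝ (Fin n))
    · exact g.smooth.contMDiffAt
    · exact hX
    · exact hY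
  simp only [contMDiffAt_totalSpace] at this
  exact this.2

theorem koszul_eq : koszul g X Y Z x = dirDeriv (g.pair Y Z) x (X x)
    + dirDeriv (g.pair Z X) x (Y x) - dirDeriv (g.pair X Y) x (Z x)
    + g.pair ⟦X, Y⟧ Z x - g.pair ⟦Y, Z⟧ X x + g.pair ⟦Z, X⟧ Y x := rfl

theorem pair_smul_left (a : M → ℝ) : g.pair (fun y => a y • X y) Y = fun y => a y * g.pair X Y y := by
  funext y
  simp [PseudoMetric.pair]

theorem pair_smul_right (a : M → ℝ) : g.pair X (fun y => a y • Y y) = fun y => a y * g.pair X Y y := by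
  funext y
  simp [PseudoMetric.pair]

theorem pair_add_left : g.pair (fun y => X y + Y y) Z = fun y => g.pair X Z y + g.pair Y Z y := by
  funext y
  simp [PseudoMetric.pair]

theorem pair_add_right : g.pair X (fun y => Y y + Z y) = fun y => g.pair X Y y + g.pair X Z y := by
  funext y
  simp [PseudoMetric.pair]

/-- Compatibility of the connection with the metric. -/
theorem koszul_add_swap : koszul g X Y Z x + koszul g X Z Y x = 2 * dirDeriv (g.pair Y Z) x (X x) := by
  have h1 : ∀ A B C : ∀ x : M, TangentSpace (𝓡 n) x, g.pair ⟦A, B⟧ C x = -g.pair ⟦B, A⟧ C x := by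
    intro A B C
    simp only [PseudoMetric.pair]
    rw [bracket_swap, map_neg]
    rfl
  rw [koszul_eq, koszul_eq, h1 X Z, h1 Z Y, h1 Y X, g.pair_comm Z Y, g.pair_comm Z X, g.pair_comm Y X]
  ring

/-- Absence of torsion. With metric compatibility it transfers linearity in the last slot to the
other two. -/
theorem koszul_sub_swap : koszul g X Y Z x - koszul g Y X Z x = 2 * g.pair ⟦X, Y⟧ Z x := by
  have h1 : ∀ A B C : ∀ x : M, TangentSpace (𝓡 n) x, g.pair ⟦A, B⟧ C x = -g.pair ⟦B, A⟧ C x := by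
    intro A B C
    simp only [PseudoMetric.pair]
    rw [bracket_swap, map_neg]
    rfl
  rw [koszul_eq, koszul_eq, h1 Y X, h1 X Z, h1 Z Y, g.pair_comm Z Y, g.pair_comm Z X, g.pair_comm Y X]
  ring

theorem koszul_congr {X' Y' Z' : ∀ x : M, TangentSpace (𝓡 n) x} (hX : ∀ᶠ y in nhds x, X y = X' y)
    (hY : ∀ᶠ y in nhds x, Y y = Y' y) (hZ : ∀ᶠ y in nhds x, Z y = Z' y) :
    koszul g X Y Z x = koszul g X' Y' Z' x := by
  have h : ∀ {A B A' B' : ∀ x : M, TangentSpace (𝓡 n) x}, (∀ᶠ y in nhds x, A y = A' y) →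
      (∀ᶠ y in nhds x, B y = B' y) → g.pair A B =ᶠ[nhds x] g.pair A' B' := by
    intro A B A' B' hA hB
    filter_upwards [hA, hB] with y h1 h2
    rw [PseudoMetric.pair, PseudoMetric.pair, h1, h2]
  rw [koszul_eq, koszul_eq, dirDeriv_congr _ (h hY hZ), dirDeriv_congr _ (h hZ hX),
    dirDeriv_congr _ (h hX hY)]
  simp only [PseudoMetric.pair]
  rw [bracket_congr hX hY, bracket_congr hY hZ, bracket_congr hZ hX, hX.self_of_nhds,
    hY.self_of_nhds, hZ.self_of_nhds]

/-- The derivatives of `a` from the first two terms are cancelled by those that the Leibniz rule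
produces in the last two brackets. -/
theorem koszul_smul_right (hX : SmoothFieldAt n X x) (hY : SmoothFieldAt n Y x)
    (hZ : SmoothFieldAt n Z x) {a : M → ℝ} (ha : SmoothAt n a x) :
    koszul g X Y (fun y => a y • Z y) x = a x * koszul g X Y Z x := by
  rw [koszul_eq, koszul_eq, pair_smul_right, pair_smul_left,
    dirDeriv_mul _ ha (hY.pair g hZ), dirDeriv_mul _ ha (hZ.pair g hX), dirDeriv_smul_vec]
  have e1 : g.pair ⟦X, Y⟧ (fun y => a y • Z y) x = a x * g.pair ⟦X, Y⟧ Z x := by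
    rw [pair_smul_right]
  have e2 : g.pair ⟦Y, fun y => a y • Z y⟧ X x
      = dirDeriv a x (Y x) * g.pair Z X x + a x * g.pair ⟦Y, Z⟧ X x := by
    simp only [PseudoMetric.pair]
    rw [bracket_smul_right ha.mdiff hZ.mdiff]
    simp
  have e3 : g.pair ⟦fun y => a y • Z y, X⟧ Y x
      = -(dirDeriv a x (X x) * g.pair Y Z x) + a x * g.pair ⟦Z, X⟧ Y x := by
    rw [g.pair_comm Y Z]
    simp only [PseudoMetric.pair]
    rw [bracket_swap, bracket_smul_right ha.mdiff hZ.mdiff, bracket_swap (X := Z)]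
    simp
    ring
  rw [e1, e2, e3]
  simp
  ring

theorem koszul_add_right (hX : SmoothFieldAt n X x) (hY : SmoothFieldAt n Y x)
    (hZ : SmoothFieldAt n Z x) (hW : SmoothFieldAt n W x) :
    koszul g X Y (fun y => Z y + W y) x = koszul g X Y Z x + koszul g X Y W x := by
  rw [koszul_eq, koszul_eq, koszul_eq, pair_add_right, pair_add_left,
    dirDeriv_add _ (hY.pair g hZ) (hY.pair g hW), dirDeriv_add _ (hZ.pair g hX) (hW.pair g hX),
    dirDeriv_add_vec]
  have e1 : g.pair ⟦X, Y⟧ (fun y => Z y + W y) x = g.pair ⟦X, Y⟧ Z x + g.pair ⟦X, Y⟧ W x := by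
    rw [pair_add_right]
  have e2 : g.pair ⟦Y, fun y => Z y + W y⟧ X x = g.pair ⟦Y, Z⟧ X x + g.pair ⟦Y, W⟧ X x := by
    simp only [PseudoMetric.pair]
    rw [bracket_add_right hZ.mdiff hW.mdiff]
    simp
  have e3 : g.pair ⟦fun y => Z y + W y, X⟧ Y x = g.pair ⟦Z, X⟧ Y x + g.pair ⟦W, X⟧ Y x := by
    simp only [PseudoMetric.pair]
    rw [bracket_swap, bracket_add_right hZ.mdiff hW.mdiff, bracket_swap (X := Z),
      bracket_swap (X := W)]
    simp
    ring
  rw [e1, e2, e3]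
  ring

theorem koszul_sum_right {J : Type*} (s : Finset J) {Z : J → ∀ x : M, TangentSpace (𝓡 n) x}
    {a : J → M → ℝ} (hX : SmoothFieldAt n X x) (hY : SmoothFieldAt n Y x)
    (hZ : ∀ j, SmoothFieldAt n (Z j) x) (ha : ∀ j, SmoothAt n (a j) x) :
    koszul g X Y (fun y => ∑ j ∈ s, a j y • Z j y) x = ∑ j ∈ s, a j x * koszul g X Y (Z j) x := by
  classical
  induction s using Finset.induction_on with
  | empty =>
    have h := koszul_smul_right g hX hY hX (a := fun _ => 0) contMDiffAt_const
    simpa using h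
  | insert j s hj ih =>
    simp only [Finset.sum_insert hj]
    rw [koszul_add_right g hX hY ((hZ j).smul (ha j)) (.sum fun j _ => (hZ j).smul (ha j)), ih,
      koszul_smul_right g hX hY (hZ j) (ha j)]

/-- Metric compatibility exchanges the second and third slots. The factor 2 in front of the
derivatives of the coefficients is there because the Koszul expression is twice the connection. -/
theorem koszul_sum_mid {J : Type*} (s : Finset J) {Y : J → ∀ x : M, TangentSpace (𝓡 n) x}
    {a : J → M → ℝ} (hX : SmoothFieldAt n X x) (hZ : SmoothFieldAt n Z x)
    (hY : ∀ j, SmoothFieldAt n (Y j) x) (ha : ∀ j, SmoothAt n (a j) x) :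
    koszul g X (fun y => ∑ j ∈ s, a j y • Y j y) Z x = ∑ j ∈ s, (a j x * koszul g X (Y j) Z x
      + 2 * (dirDeriv (a j) x (X x) * g.pair (Y j) Z x)) := by
  have h1 := koszul_add_swap g (x := x) (X := X) (Y := fun y => ∑ j ∈ s, a j y • Y j y) (Z := Z)
  rw [koszul_sum_right g s hX hZ hY ha] at h1
  have h2 : g.pair (fun y => ∑ j ∈ s, a j y • Y j y) Z = fun y => ∑ j ∈ s, a j y * g.pair (Y j) Z y := by
    funext y
    simp [PseudoMetric.pair]
  rw [h2, dirDeriv_sum s (fun j => (ha j).mul' ((hY j).pair g hZ))] at h1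
  rw [eq_sub_of_add_eq h1, Finset.mul_sum, ← Finset.sum_sub_distrib]
  refine Finset.sum_congr rfl fun j _ => ?_
  rw [dirDeriv_mul _ (ha j) ((hY j).pair g hZ), eq_sub_of_add_eq (koszul_add_swap g (Y := Z))]
  rw [g.pair_comm Z]
  ring

theorem bracket_sum_right {J : Type*} (s : Finset J) {Y : J → ∀ x : M, TangentSpace (𝓡 n) x}
    {a : J → M → ℝ} (hY : ∀ j, SmoothFieldAt n (Y j) x) (ha : ∀ j, SmoothAt n (a j) x) :
    ⟦X, fun y => ∑ j ∈ s, a j y • Y j y⟧ x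
      = ∑ j ∈ s, (dirDeriv (a j) x (X x) • Y j x + a j x • ⟦X, Y j⟧ x) := by
  classical
  induction s using Finset.induction_on with
  | empty =>
    simp only [Finset.sum_empty]
    exact congrFun VectorField.mlieBracket_zero_right x
  | insert j s hj ih =>
    simp only [Finset.sum_insert hj]
    rw [bracket_add_right ((hY j).smul (ha j)).mdiff
      (SmoothFieldAt.sum fun j _ => (hY j).smul (ha j)).mdiff, ih,
      bracket_smul_right (ha j).mdiff (hY j).mdiff]

theorem koszul_sum_left {J : Type*} (s : Finset J) {X : J → ∀ x : M, TangentSpace (𝓡 n) x}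
    {a : J → M → ℝ} (hY : SmoothFieldAt n Y x) (hZ : SmoothFieldAt n Z x)
    (hX : ∀ j, SmoothFieldAt n (X j) x) (ha : ∀ j, SmoothAt n (a j) x) :
    koszul g (fun y => ∑ j ∈ s, a j y • X j y) Y Z x = ∑ j ∈ s, a j x * koszul g (X j) Y Z x := by
  have h1 := koszul_sub_swap g (x := x) (X := fun y => ∑ j ∈ s, a j y • X j y) (Y := Y) (Z := Z)
  rw [koszul_sum_mid g s hY hZ hX ha, sub_eq_iff_eq_add] at h1
  have h2 : g.pair ⟦fun y => ∑ j ∈ s, a j y • X j y, Y⟧ Z x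
      = ∑ j ∈ s, (a j x * g.pair ⟦X j, Y⟧ Z x - dirDeriv (a j) x (Y x) * g.pair (X j) Z x) := by
    simp only [PseudoMetric.pair]
    rw [bracket_swap, bracket_sum_right s hX ha]
    simp only [bracket_swap (X := X _), map_neg, map_sum, map_add, map_smul,
      neg_apply, sum_apply, add_apply,
      smul_apply, smul_eq_mul]
    rw [← Finset.sum_neg_distrib]
    exact Finset.sum_congr rfl fun j _ => by ring
  rw [h1, h2, Finset.mul_sum, ← Finset.sum_add_distrib]
  refine Finset.sum_congr rfl fun j _ => ?_
  rw [sub_eq_iff_eq_add.1 (koszul_sub_swap g (X := X j) (Y := Y) (Z := Z) (x := x))]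
  ring

theorem SmoothFieldAt.koszul (hX : SmoothFieldAt n X x) (hY : SmoothFieldAt n Y x)
    (hZ : SmoothFieldAt n Z x) : SmoothAt n (koszul g X Y Z) x :=
  (((((hY.pair g hZ).dirDeriv hX).add ((hZ.pair g hX).dirDeriv hY)).sub
    ((hX.pair g hY).dirDeriv hZ)).add ((hX.bracket hY).pair g hZ)).sub
    ((hY.bracket hZ).pair g hX) |>.add ((hZ.bracket hX).pair g hY)

theorem eventually_field_extend [T2Space M] (hY : ∀ᶠ y in nhds x, SmoothFieldAt n Y y) :
    ∃ Y' : VF n M, ∀ᶠ y in nhds x, Y' y = Y y := by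
  obtain ⟨U, hU, hUo, hx⟩ := eventually_nhds_iff.1 hY
  exact exists_field_eq hUo hx hU

/-- The Killing equation is stated for global fields; frame fields are only local. Both sides depend
only on germs, and a cut-off extends a germ to a global field. -/
theorem IsKilling.dirDeriv_pair [T2Space M] {X : VF n M} (hK : IsKilling g X)
    (hY : ∀ᶠ y in nhds x, SmoothFieldAt n Y y) (hZ : ∀ᶠ y in nhds x, SmoothFieldAt n Z y) :
    dirDeriv (g.pair Y Z) x (X x) = g.pair ⟦X, Y⟧ Z x + g.pair Y ⟦X, Z⟧ x := by
  obtain ⟨Y', hY'⟩ := eventually_field_extend hY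
  obtain ⟨Z', hZ'⟩ := eventually_field_extend hZ
  have h := hK Y' Z' x
  have e1 : (fun y => g.val y (Y' y) (Z' y)) =ᶠ[nhds x] g.pair Y Z := by
    filter_upwards [hY', hZ'] with y h1 h2
    rw [h1, h2]
    rfl
  have e2 : lieBracket X Y' x = ⟦X, Y⟧ x := bracket_congr .rfl hY'
  have e3 : lieBracket X Z' x = ⟦X, Z⟧ x := bracket_congr .rfl hZ'
  rw [dirDeriv_congr _ e1, e2, e3, hY'.self_of_nhds, hZ'.self_of_nhds] at h
  simp only [PseudoMetric.pair] at h ⊢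
  linarith

/-- Interchange `X` and `W` at the cost of `[X, W]`, then apply the Killing equation under the
derivative along `W`. -/
theorem IsKilling.dirDeriv_dirDeriv_pair [T2Space M] {X : VF n M} (hK : IsKilling g X)
    (hW : SmoothFieldAt n W x)
    (hY : ∀ᶠ y in nhds x, SmoothFieldAt n Y y) (hZ : ∀ᶠ y in nhds x, SmoothFieldAt n Z y) :
    dirDeriv (fun y => dirDeriv (g.pair Y Z) y (W y)) x (X x) = dirDeriv (g.pair Y Z) x (⟦X, W⟧ x)
      + dirDeriv (g.pair ⟦X, Y⟧ Z) x (W x) + dirDeriv (g.pair Y ⟦X, Z⟧) x (W x) := by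
  have hX : SmoothFieldAt n X x := X.contMDiff x
  have hYx := hY.self_of_nhds
  have hZx := hZ.self_of_nhds
  have e : (fun y => dirDeriv (g.pair Y Z) y (X y)) =ᶠ[nhds x]
      fun y => g.pair ⟦X, Y⟧ Z y + g.pair Y ⟦X, Z⟧ y := by
    filter_upwards [hY.eventually_nhds, hZ.eventually_nhds] with y h1 h2
    exact hK.dirDeriv_pair g h1 h2
  rw [dirDeriv_bracket (hYx.pair g hZx) hX hW, dirDeriv_congr _ e,
    dirDeriv_add _ ((hX.bracket hYx).pair g hZx) (hYx.pair g (hX.bracket hZx))]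
  ring

theorem IsKilling.dirDeriv_pair_bracket [T2Space M] {X : VF n M} (hK : IsKilling g X)
    (hW : ∀ᶠ y in nhds x, SmoothFieldAt n W y)
    (hY : ∀ᶠ y in nhds x, SmoothFieldAt n Y y) (hZ : ∀ᶠ y in nhds x, SmoothFieldAt n Z y) :
    dirDeriv (g.pair ⟦W, Y⟧ Z) x (X x) = g.pair ⟦⟦X, W⟧, Y⟧ Z x
      + g.pair ⟦W, ⟦X, Y⟧⟧ Z x + g.pair ⟦W, Y⟧ ⟦X, Z⟧ x := by
  have hX : SmoothFieldAt n X x := X.contMDiff x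
  have h1 : ∀ᶠ y in nhds x, SmoothFieldAt n ⟦W, Y⟧ y := by
    filter_upwards [hW, hY] with y h1 h2 using h1.bracket h2
  rw [hK.dirDeriv_pair g h1 hZ]
  simp only [PseudoMetric.pair]
  rw [bracket_jacobi hX hW.self_of_nhds hY.self_of_nhds]
  simp

/-- The Levi-Civita connection is invariant under Killing fields. -/
theorem IsKilling.dirDeriv_koszul [T2Space M] {X : VF n M} (hK : IsKilling g X)
    (hW : ∀ᶠ y in nhds x, SmoothFieldAt n W y)
    (hY : ∀ᶠ y in nhds x, SmoothFieldAt n Y y) (hZ : ∀ᶠ y in nhds x, SmoothFieldAt n Z y) :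
    dirDeriv (koszul g W Y Z) x (X x) = koszul g ⟦X, W⟧ Y Z x + koszul g W ⟦X, Y⟧ Z x
      + koszul g W Y ⟦X, Z⟧ x := by
  have hX : SmoothFieldAt n X x := X.contMDiff x
  have w := hW.self_of_nhds
  have y := hY.self_of_nhds
  have z := hZ.self_of_nhds
  have e : koszul g W Y Z = fun p => dirDeriv (g.pair Y Z) p (W p)
      + (dirDeriv (g.pair Z W) p (Y p) + (-dirDeriv (g.pair W Y) p (Z p)
      + (g.pair ⟦W, Y⟧ Z p + (-g.pair ⟦Y, Z⟧ W p + g.pair ⟦Z, W⟧ Y p)))) := by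
    funext p
    rw [koszul_eq]
    ring
  have s1 := (y.pair g z).dirDeriv w
  have s2 := (z.pair g w).dirDeriv y
  have s3 := (w.pair g y).dirDeriv z
  have s4 := (w.bracket y).pair g z
  have s5 := (y.bracket z).pair g w
  have s6 := (z.bracket w).pair g y
  -- Each of the six Koszul terms is natural under the Killing field: those with a derivative by
  -- `dirDeriv_dirDeriv_pair`, those with a bracket by `dirDeriv_pair_bracket`, which contains the
  -- Jacobi identity.
  rw [e, dirDeriv_add _ s1 (s2.add' (s3.neg'.add' (s4.add' (s5.neg'.add' s6)))),
    dirDeriv_add _ s2 (s3.neg'.add' (s4.add' (s5.neg'.add' s6))),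
    dirDeriv_add _ s3.neg' (s4.add' (s5.neg'.add' s6)), dirDeriv_add _ s4 (s5.neg'.add' s6),
    dirDeriv_add _ s5.neg' s6, dirDeriv_neg s3, dirDeriv_neg s5, hK.dirDeriv_dirDeriv_pair g w hY hZ,
    hK.dirDeriv_dirDeriv_pair g y hZ hW, hK.dirDeriv_dirDeriv_pair g z hW hY,
    hK.dirDeriv_pair_bracket g hW hY hZ, hK.dirDeriv_pair_bracket g hY hZ hW,
    hK.dirDeriv_pair_bracket g hZ hW hY]
  simp only [koszul_eq]
  ring

end Koszul

end SuperKilling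

end

noncomputable section

namespace SuperKilling

namespace SpecialGradedManifold

/-! ### Orthonormal frames: connection forms, `∇X` and changes of frame -/

section Frames

variable {s t : ℕ} {𝕜 S M ι : Type*} [RCLike 𝕜] [AddCommGroup S] [Module 𝕜 S]
  [TopologicalSpace M] [ChartedSpace (EuclideanSpace ℝ (Fin (s + t))) M]
  [IsManifold (𝓡 (s + t)) ∞ M] (G : SpecialGradedManifold s t 𝕜 S M ι)
  {i j : ι} {x : M} {X Y Z : ∀ x : M, TangentSpace (𝓡 (s + t)) x}

local notation "⟦" X ", " Y "⟧" => VectorField.mlieBracket (𝓡 (s + t)) X Y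

theorem mem_idx (x : M) : x ∈ G.spin.U (G.idx x) := (G.spin.cover x).choose_spec

theorem eventually_mem_U (hx : x ∈ G.spin.U i) : ∀ᶠ y in nhds x, y ∈ G.spin.U i :=
  (G.spin.isOpen_U i).mem_nhds hx

theorem smooth_frameField (hx : x ∈ G.spin.U i) (k : Fin s ⊕ Fin t) :
    SmoothFieldAt (s + t) (G.frameField i k) x :=
  (G.spin.frame_smooth i (Pi.single k 1)).contMDiffAt ((G.spin.isOpen_U i).mem_nhds hx)

theorem eventually_smooth_frameField (hx : x ∈ G.spin.U i) (k : Fin s ⊕ Fin t) :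
    ∀ᶠ y in nhds x, SmoothFieldAt (s + t) (G.frameField i k) y := by
  filter_upwards [G.eventually_mem_U hx] with y hy using G.smooth_frameField hy k

theorem pair_frameField (hx : x ∈ G.spin.U i) (k l : Fin s ⊕ Fin t) :
    G.metric.pair (G.frameField i k) (G.frameField i l) x = if k = l then eta k else 0 := by
  rw [PseudoMetric.pair, frameField, frameField, G.spin.frame_orthonormal i x hx]
  rw [Finset.sum_eq_single k]
  · by_cases h : k = l <;> simp [h]
  · intro m _ hm
    simp [hm]
  · simp

theorem dirDeriv_pair_frameField (hx : x ∈ G.spin.U i) (k l : Fin s ⊕ Fin t)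
    (v : TangentSpace (𝓡 (s + t)) x) :
    dirDeriv (G.metric.pair (G.frameField i k) (G.frameField i l)) x v = 0 := by
  rw [dirDeriv_congr (f' := fun _ => if k = l then eta k else 0) v, dirDeriv_const]
  filter_upwards [G.eventually_mem_U hx] with y hy using G.pair_frameField hy k l

theorem frame_eq_sum (w : ModelVec s t) : G.spin.frame i x w = ∑ k, w k • G.frameField i k x := by
  simp only [frameField]
  conv_lhs => rw [pi_eq_sum_univ' w]
  rw [map_sum]
  refine Finset.sum_congr rfl fun k _ => ?_
  rw [← map_smul]

/-- The expansion of a tangent vector in an orthonormal frame. -/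
theorem frame_expand (hx : x ∈ G.spin.U i) (v : TangentSpace (𝓡 (s + t)) x) :
    v = ∑ k, (eta k * G.metric.val x v (G.frameField i k x)) • G.frameField i k x := by
  -- Orthonormality recovers the components of a vector from its image, so the frame is injective;
  -- equality of dimensions then makes it surjective.
  have hinj : Function.Injective (G.spin.frame i x) := by
    rw [← LinearMap.ker_eq_bot, LinearMap.ker_eq_bot']
    intro w hw
    funext k
    have h := G.spin.frame_orthonormal i x hx w (Pi.single k 1)
    rw [hw, Finset.sum_eq_single k] at h
    · have h2 : eta k * w k = 0 := by simpa using h.symm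
      have h3 := eta_mul_self k
      have : w k = eta k * (eta k * w k) := by rw [← mul_assoc, h3, one_mul]
      rw [this, h2, mul_zero]
      rfl
    · intro m _ hm
      simp [hm]
    · simp
  have hfin : FiniteDimensional ℝ (TangentSpace (𝓡 (s + t)) x) :=
    inferInstanceAs (FiniteDimensional ℝ (EuclideanSpace ℝ (Fin (s + t))))
  have hdim : Module.finrank ℝ (ModelVec s t) = Module.finrank ℝ (TangentSpace (𝓡 (s + t)) x) := by
    change _ = Module.finrank ℝ (EuclideanSpace ℝ (Fin (s + t)))
    simp
  obtain ⟨w, rfl⟩ := (LinearMap.injective_iff_surjective_of_finrank_eq_finrank hdim).1 hinj v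
  conv_lhs => rw [G.frame_eq_sum]
  refine Finset.sum_congr rfl fun k _ => ?_
  congr 1
  rw [frameField, G.spin.frame_orthonormal i x hx, Finset.sum_eq_single k]
  · simp [← mul_assoc, eta_mul_self]
  · intro m _ hm
    simp [hm]
  · simp

theorem eventually_frame_expand (hx : x ∈ G.spin.U i) (Z : ∀ x : M, TangentSpace (𝓡 (s + t)) x) :
    ∀ᶠ y in nhds x, Z y
      = ∑ k, (eta k * G.metric.pair Z (G.frameField i k) y) • G.frameField i k y := by
  filter_upwards [G.eventually_mem_U hx] with y hy using G.frame_expand hy (Z y)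

theorem smooth_coeff (hx : x ∈ G.spin.U i) (hZ : SmoothFieldAt (s + t) Z x) (k : Fin s ⊕ Fin t) :
    SmoothAt (s + t) (fun y => eta k * G.metric.pair Z (G.frameField i k) y) x :=
  SmoothAt.mul' contMDiffAt_const (hZ.pair _ (G.smooth_frameField hx k))

theorem koszul_expand_right (hx : x ∈ G.spin.U i) (hX : SmoothFieldAt (s + t) X x)
    (hY : SmoothFieldAt (s + t) Y x) (hZ : SmoothFieldAt (s + t) Z x) :
    koszul G.metric X Y Z x = ∑ k, eta k * G.metric.pair Z (G.frameField i k) x *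
      koszul G.metric X Y (G.frameField i k) x := by
  rw [koszul_congr G.metric (.of_forall fun _ => rfl) (.of_forall fun _ => rfl)
    (G.eventually_frame_expand hx Z), koszul_sum_right G.metric _ hX hY
    (fun k => G.smooth_frameField hx k) (fun k => G.smooth_coeff hx hZ k)]

theorem koszul_expand_left (hx : x ∈ G.spin.U i) (hX : SmoothFieldAt (s + t) X x)
    (hY : SmoothFieldAt (s + t) Y x) (hZ : SmoothFieldAt (s + t) Z x) :
    koszul G.metric X Y Z x = ∑ k, eta k * G.metric.pair X (G.frameField i k) x *
      koszul G.metric (G.frameField i k) Y Z x := by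
  rw [koszul_congr G.metric (G.eventually_frame_expand hx X) (.of_forall fun _ => rfl)
    (.of_forall fun _ => rfl), koszul_sum_left G.metric _ hY hZ
    (fun k => G.smooth_frameField hx k) (fun k => G.smooth_coeff hx hX k)]

theorem koszul_expand_mid (hx : x ∈ G.spin.U i) (hX : SmoothFieldAt (s + t) X x)
    (hY : SmoothFieldAt (s + t) Y x) (hZ : SmoothFieldAt (s + t) Z x) :
    koszul G.metric X Y Z x = ∑ k, (eta k * G.metric.pair Y (G.frameField i k) x *
      koszul G.metric X (G.frameField i k) Z x + 2 * (eta k *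
        dirDeriv (G.metric.pair Y (G.frameField i k)) x (X x)
          * G.metric.pair (G.frameField i k) Z x)) := by
  rw [koszul_congr G.metric (.of_forall fun _ => rfl) (G.eventually_frame_expand hx Y)
    (.of_forall fun _ => rfl), koszul_sum_mid G.metric _ hX hZ
    (fun k => G.smooth_frameField hx k) (fun k => G.smooth_coeff hx hY k)]
  refine Finset.sum_congr rfl fun k _ => ?_
  rw [dirDeriv_mul _ contMDiffAt_const (hY.pair _ (G.smooth_frameField hx k)), dirDeriv_const]
  ring

/-- The Koszul formula. -/
theorem leviCivita_spec (hX : SmoothFieldAt (s + t) X x) (hY : SmoothFieldAt (s + t) Y x)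
    (hZ : SmoothFieldAt (s + t) Z x) :
    G.metric.val x (leviCivita G.metric X Y x) (Z x) = 1 / 2 * koszul G.metric X Y Z x := by
  have hx := G.mem_idx x
  -- The choice in `leviCivita` is meaningful because the vector whose frame components are half the
  -- Koszul expressions satisfies the condition, by linearity in the last slot.
  have key := Classical.epsilon_spec (p := fun w : TangentSpace (𝓡 (s + t)) x =>
    ∀ Z : (∀ y : M, TangentSpace (𝓡 (s + t)) y), SmoothFieldAt (s + t) Z x →
      2 * G.metric.val x w (Z x) = koszul G.metric X Y Z x) ⟨∑ k, (eta k * (1 / 2 *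
        koszul G.metric X Y (G.frameField (G.idx x) k) x)) • G.frameField (G.idx x) k x, by
      intro Z hZ
      rw [G.koszul_expand_right hx hX hY hZ, map_sum, sum_apply, Finset.mul_sum]
      refine Finset.sum_congr rfl fun k _ => ?_
      rw [map_smul, smul_apply, G.metric.pair_comm, PseudoMetric.pair, smul_eq_mul]
      ring⟩
  have := key Z hZ
  rw [leviCivita]
  linarith

/-- The connection form in the frame `i`. -/
def conn (i : ι) (X : VF (s + t) M) (x : M) (k l : Fin s ⊕ Fin t) : ℝ :=
  1 / 2 * koszul G.metric X (G.frameField i k) (G.frameField i l) x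

/-- The matrix of `∇X` in the frame `i`. -/
def cov (i : ι) (X : VF (s + t) M) (x : M) (k l : Fin s ⊕ Fin t) : ℝ :=
  1 / 2 * koszul G.metric (G.frameField i k) X (G.frameField i l) x

variable (V : VF (s + t) M)

theorem connForm_eq (x : M) : G.connForm V x = G.conn (G.idx x) V x := by
  funext k l
  exact G.leviCivita_spec (V.contMDiff x) (G.smooth_frameField (G.mem_idx x) k)
    (G.smooth_frameField (G.mem_idx x) l)

theorem covMatrix_eq (x : M) : G.covMatrix V x = G.cov (G.idx x) V x := by
  funext k l
  exact G.leviCivita_spec (G.smooth_frameField (G.mem_idx x) k) (V.contMDiff x)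
    (G.smooth_frameField (G.mem_idx x) l)

theorem smooth_conn (hx : x ∈ G.spin.U i) (k l : Fin s ⊕ Fin t) :
    SmoothAt (s + t) (fun y => G.conn i V y k l) x :=
  SmoothAt.mul' contMDiffAt_const (SmoothFieldAt.koszul _ (V.contMDiff x)
    (G.smooth_frameField hx k) (G.smooth_frameField hx l))

theorem smooth_cov (hx : x ∈ G.spin.U i) (k l : Fin s ⊕ Fin t) :
    SmoothAt (s + t) (fun y => G.cov i V y k l) x :=
  SmoothAt.mul' contMDiffAt_const (SmoothFieldAt.koszul _
    (G.smooth_frameField hx k) (V.contMDiff x) (G.smooth_frameField hx l))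

theorem conn_antisymm (hx : x ∈ G.spin.U i) (k l : Fin s ⊕ Fin t) :
    G.conn i V x k l = -G.conn i V x l k := by
  have h := koszul_add_swap G.metric (x := x) (X := V) (Y := G.frameField i k)
    (Z := G.frameField i l)
  rw [G.dirDeriv_pair_frameField hx] at h
  simp only [conn]
  linarith

/-- The coefficients of the frame `j` in the frame `i`. -/
def frameChange (i j : ι) (x : M) (k l : Fin s ⊕ Fin t) : ℝ :=
  eta l * G.metric.pair (G.frameField j k) (G.frameField i l) x

theorem smooth_frameChange (hi : x ∈ G.spin.U i) (hj : x ∈ G.spin.U j) (k l : Fin s ⊕ Fin t) :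
    SmoothAt (s + t) (fun y => G.frameChange i j y k l) x :=
  G.smooth_coeff hi (G.smooth_frameField hj k) l

theorem dirDeriv_frameChange (hi : x ∈ G.spin.U i) (hj : x ∈ G.spin.U j) (k l : Fin s ⊕ Fin t)
    (v : TangentSpace (𝓡 (s + t)) x) : dirDeriv (fun y => G.frameChange i j y k l) x v =
      eta l * dirDeriv (G.metric.pair (G.frameField j k) (G.frameField i l)) x v := by
  simp only [frameChange]
  rw [dirDeriv_mul _ contMDiffAt_const ((G.smooth_frameField hj k).pair _ (G.smooth_frameField hi l)),
    dirDeriv_const]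
  ring

theorem trans_mul_gam (hi : x ∈ G.spin.U i) (hj : x ∈ G.spin.U j) (k : Fin s ⊕ Fin t) :
    (G.spin.trans i j x : Cl s t) * gam k
      = ∑ l, G.frameChange i j x k l • (gam l * (G.spin.trans i j x : Cl s t)) := by
  have h := G.spin.trans_frame i j x ⟨hi, hj⟩ (Pi.single k 1) (G.frameChange i j x k) (by
    rw [G.frame_eq_sum (G.frameChange i j x k)]
    exact G.frame_expand hi _)
  rw [ι_eq_sum_gam (G.frameChange i j x k), Finset.sum_mul] at h
  simp only [smul_mul_assoc] at h
  exact h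

/-- Take the connection along `V` on the `k`-th field of frame `j`, paired with the `m`-th field of
frame `i`, and expand it twice: the last slot in frame `j`, and the middle slot in frame `i`. The
second expansion differentiates the coefficients and gives the inhomogeneous term. -/
theorem conn_frameChange (hi : x ∈ G.spin.U i) (hj : x ∈ G.spin.U j) (k m : Fin s ⊕ Fin t) :
    dirDeriv (fun y => G.frameChange i j y k m) x (V x)
      + ∑ l, G.frameChange i j x k l * (eta m * G.conn i V x l m)
      = ∑ l, eta l * G.conn j V x k l * G.frameChange i j x l m := by
  have hV : SmoothFieldAt (s + t) V x := V.contMDiff x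
  have h1 := G.koszul_expand_right hj hV (G.smooth_frameField hj k) (G.smooth_frameField hi m)
  have h2 := G.koszul_expand_mid hi hV (G.smooth_frameField hj k) (G.smooth_frameField hi m)
  rw [h1, Finset.sum_add_distrib, ← Finset.mul_sum, Finset.sum_eq_single (a := m)
    (f := fun l => eta l * dirDeriv (G.metric.pair (G.frameField j k) (G.frameField i l)) x (V x)
      * G.metric.pair (G.frameField i l) (G.frameField i m) x)] at h2
  rotate_left
  · intro l _ hl
    rw [G.pair_frameField hi, if_neg hl, mul_zero]
  · simp
  rw [G.pair_frameField hi, if_pos rfl] at h2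
  have h3 := congrArg (fun r => 1 / 2 * eta m * r) h2
  simp only [mul_add, Finset.mul_sum] at h3
  rw [G.dirDeriv_frameChange hi hj, add_comm]
  have e : ∀ l, eta l * G.conn j V x k l * G.frameChange i j x l m = 1 / 2 * eta m *
      (eta l * G.metric.pair (G.frameField i m) (G.frameField j l) x *
        koszul G.metric V (G.frameField j k) (G.frameField j l) x) := by
    intro l
    rw [conn, frameChange, G.metric.pair_comm (G.frameField i m)]
    ring
  have em := eta_mul_self m
  simp only [e, h3]
  congr 1
  · refine Finset.sum_congr rfl fun l _ => ?_
    rw [conn, frameChange]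
    ring
  · linear_combination (-eta m *
      dirDeriv (G.metric.pair (G.frameField j k) (G.frameField i m)) x (V x)) * em

/-- The skew part of `∇X` in the frame `i`. -/
def skewCov (i : ι) (X : VF (s + t) M) (x : M) (k l : Fin s ⊕ Fin t) : ℝ :=
  1 / 2 * (G.cov i X x k l - G.cov i X x l k)

/-- Here the differentiated slot holds the global field `V`, so all expansions are tensorial and
there is no derivative term: subtracting this matrix from a connection form leaves the
transformation law intact. -/
theorem skewCov_frameChange (hi : x ∈ G.spin.U i) (hj : x ∈ G.spin.U j) (k m : Fin s ⊕ Fin t) :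
    ∑ l, G.frameChange i j x k l * (eta m * G.skewCov i V x l m)
      = ∑ l, eta l * G.skewCov j V x k l * G.frameChange i j x l m := by
  have hV : SmoothFieldAt (s + t) V x := V.contMDiff x
  have h1 := G.koszul_expand_right hj (G.smooth_frameField hj k) hV (G.smooth_frameField hi m)
  have h2 := G.koszul_expand_left hi (G.smooth_frameField hj k) hV (G.smooth_frameField hi m)
  have h3 := G.koszul_expand_left hj (G.smooth_frameField hi m) hV (G.smooth_frameField hj k)
  have h4 := G.koszul_expand_right hi (G.smooth_frameField hi m) hV (G.smooth_frameField hj k)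
  have e1 : ∑ l, G.frameChange i j x k l * (eta m * G.skewCov i V x l m)
    = 1 / 4 * eta m * (koszul G.metric (G.frameField j k) V (G.frameField i m) x
      - koszul G.metric (G.frameField i m) V (G.frameField j k) x) := by
    rw [h2, h4, ← Finset.sum_sub_distrib, Finset.mul_sum]
    refine Finset.sum_congr rfl fun l _ => ?_
    rw [skewCov, cov, cov, frameChange]
    ring
  have e2 : ∑ l, eta l * G.skewCov j V x k l * G.frameChange i j x l m
    = 1 / 4 * eta m * (koszul G.metric (G.frameField j k) V (G.frameField i m) x
      - koszul G.metric (G.frameField i m) V (G.frameField j k) x) := by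
    rw [h1, h3, ← Finset.sum_sub_distrib, Finset.mul_sum]
    refine Finset.sum_congr rfl fun l _ => ?_
    rw [skewCov, cov, cov, frameChange, G.metric.pair_comm (G.frameField i m)]
    ring
  rw [e1, e2]

theorem trace_cov_eq (hi : x ∈ G.spin.U i) (hj : x ∈ G.spin.U j) :
    ∑ k, eta k * G.cov i V x k k = ∑ k, eta k * G.cov j V x k k := by
  have hV : SmoothFieldAt (s + t) V x := V.contMDiff x
  simp only [cov]
  calc _ = ∑ k, ∑ m, eta k * (1 / 2 * (eta m * G.metric.pair (G.frameField i k)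
          (G.frameField j m) x * koszul G.metric (G.frameField i k) V (G.frameField j m) x)) := by
        refine Finset.sum_congr rfl fun k _ => ?_
        rw [G.koszul_expand_right hj (G.smooth_frameField hi k) hV (G.smooth_frameField hi k)]
        simp only [Finset.mul_sum]
    _ = _ := by
        rw [Finset.sum_comm]
        refine Finset.sum_congr rfl fun m _ => ?_
        rw [G.koszul_expand_left hi (G.smooth_frameField hj m) hV (G.smooth_frameField hj m)]
        simp only [Finset.mul_sum]
        refine Finset.sum_congr rfl fun k _ => ?_
        rw [G.metric.pair_comm (G.frameField i k)]
        ring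

/-! ### Frame matrices of a Killing field -/

section Killing

variable {G V} [T2Space M]

/-- Metric compatibility minus the Killing equation, with absence of torsion replacing the brackets
by covariant derivatives. -/
theorem cov_antisymm (hK : IsKilling G.metric V) (hx : x ∈ G.spin.U i) (k l : Fin s ⊕ Fin t) :
    G.cov i V x k l = -G.cov i V x l k := by
  have h1 := koszul_sub_swap G.metric (x := x) (X := V) (Y := G.frameField i k)
    (Z := G.frameField i l)
  have h2 := koszul_sub_swap G.metric (x := x) (X := V) (Y := G.frameField i l)
    (Z := G.frameField i k)
  have h3 := koszul_add_swap G.metric (x := x) (X := V) (Y := G.frameField i k)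
    (Z := G.frameField i l)
  rw [hK.dirDeriv_pair _ (G.eventually_smooth_frameField hx k) (G.eventually_smooth_frameField hx l),
    G.metric.pair_comm (G.frameField i k)] at h3
  simp only [cov]
  linarith

/-- For a Killing field the skew part is all of `∇V`, and `∇_V e_k - ∇_{e_k} V = [V, e_k]`. -/
theorem conn_sub_skewCov (hK : IsKilling G.metric V) (hx : x ∈ G.spin.U i) (k l : Fin s ⊕ Fin t) :
    G.conn i V x k l - G.skewCov i V x k l
      = G.metric.pair ⟦V, G.frameField i k⟧ (G.frameField i l) x := by
  have h1 := koszul_sub_swap G.metric (x := x) (X := V) (Y := G.frameField i k)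
    (Z := G.frameField i l)
  have h2 := cov_antisymm hK hx l k
  rw [skewCov, h2]
  simp only [cov, conn]
  linarith

theorem trace_cov_eq_zero (hK : IsKilling G.metric V) (hx : x ∈ G.spin.U i) :
    ∑ k, eta k * G.cov i V x k k = 0 := by
  refine Finset.sum_eq_zero fun k _ => ?_
  have := cov_antisymm hK hx k k
  have : G.cov i V x k k = 0 := by linarith
  rw [this, mul_zero]

end Killing

end Frames

end SpecialGradedManifold

end SuperKilling

end

noncomputable section

namespace SuperKilling

/-! ### Differentiation in vector spaces without topology, through linear functionals -/

section Weak

variable {n : ℕ} {M : Type*} [TopologicalSpace M] [ChartedSpace (EuclideanSpace ℝ (Fin n)) M]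
  {𝕜 : Type*} [RCLike 𝕜] {E E' E'' : Type*} [AddCommGroup E] [Module 𝕜 E] [AddCommGroup E']
  [Module 𝕜 E'] [AddCommGroup E''] [Module 𝕜 E'']

/-- Smoothness of a map with values in a vector space without topology. -/
def WSmoothAt (n : ℕ) {M : Type*} [TopologicalSpace M] [ChartedSpace (EuclideanSpace ℝ (Fin n)) M]
    (𝕜 : Type*) [RCLike 𝕜] {E : Type*} [AddCommGroup E] [Module 𝕜 E] (F : M → E) (x : M) : Prop :=
  ∀ ℓ : Module.Dual 𝕜 E, SmoothAt n (fun y => ℓ (F y)) x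

/-- `F` is smooth at `x`, with derivative `F'` along `v`. -/
def HasWDeriv (n : ℕ) {M : Type*} [TopologicalSpace M] [ChartedSpace (EuclideanSpace ℝ (Fin n)) M]
    (𝕜 : Type*) [RCLike 𝕜] {E : Type*} [AddCommGroup E] [Module 𝕜 E] (F : M → E) (F' : E) {x : M}
    (v : TangentSpace (𝓡 n) x) : Prop :=
  ∀ ℓ : Module.Dual 𝕜 E, SmoothAt n (fun y => ℓ (F y)) x ∧
    dirDeriv (fun y => ℓ (F y)) x v = ℓ F'

variable {x : M} {v : TangentSpace (𝓡 n) x} {F H : M → E} {F' H' : E}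

theorem HasWDeriv.wsmooth (h : HasWDeriv n 𝕜 F F' v) : WSmoothAt n 𝕜 F x := fun ℓ => (h ℓ).1

theorem WSmoothAt.congr (h : WSmoothAt n 𝕜 F x) (he : H =ᶠ[nhds x] F) : WSmoothAt n 𝕜 H x :=
  fun ℓ => (h ℓ).congr_of_eventuallyEq (by filter_upwards [he] with y hy; rw [hy])

theorem HasWDeriv.congr (h : HasWDeriv n 𝕜 F F' v) (he : H =ᶠ[nhds x] F) :
    HasWDeriv n 𝕜 H F' v := by
  intro ℓ
  have he' : (fun y => ℓ (H y)) =ᶠ[nhds x] fun y => ℓ (F y) := by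
    filter_upwards [he] with y hy
    rw [hy]
  exact ⟨(h ℓ).1.congr_of_eventuallyEq he', (dirDeriv_congr v he').trans (h ℓ).2⟩

/-- Functionals separate points. This is the device for differentiating identities: compute the
derivative of the same map in two ways and compare. -/
theorem HasWDeriv.unique (h : HasWDeriv n 𝕜 F F' v) (h' : HasWDeriv n 𝕜 F H' v) : F' = H' := by
  rw [← sub_eq_zero, ← Module.forall_dual_apply_eq_zero_iff 𝕜]
  intro ℓ
  rw [map_sub, ← (h ℓ).2, ← (h' ℓ).2, sub_self]

theorem HasWDeriv.add (h : HasWDeriv n 𝕜 F F' v) (h' : HasWDeriv n 𝕜 H H' v) :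
    HasWDeriv n 𝕜 (fun y => F y + H y) (F' + H') v := by
  intro ℓ
  simp only [map_add]
  exact ⟨(h ℓ).1.add' (h' ℓ).1, by rw [dirDeriv_add _ (h ℓ).1 (h' ℓ).1, (h ℓ).2, (h' ℓ).2]⟩

theorem hasWDeriv_const (c : E) : HasWDeriv n 𝕜 (fun _ : M => c) 0 v := by
  intro ℓ
  exact ⟨contMDiffAt_const, by rw [dirDeriv_const, map_zero]⟩

theorem HasWDeriv.sum {J : Type*} {A : Finset J} {F : J → M → E} {F' : J → E}
    (h : ∀ j, HasWDeriv n 𝕜 (F j) (F' j) v) :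
    HasWDeriv n 𝕜 (fun y => ∑ j ∈ A, F j y) (∑ j ∈ A, F' j) v := by
  intro ℓ
  simp only [map_sum]
  exact ⟨SmoothAt.sum' fun j => (h j ℓ).1, by
    rw [dirDeriv_sum _ fun j => (h j ℓ).1]
    exact Finset.sum_congr rfl fun j _ => (h j ℓ).2⟩

theorem HasWDeriv.smul {f : M → 𝕜} (hf : SmoothAt n f x) (h : HasWDeriv n 𝕜 H H' v) :
    HasWDeriv n 𝕜 (fun y => f y • H y) (dirDeriv f x v • H x + f x • H') v := by
  intro ℓ
  simp only [map_smul, map_add, smul_eq_mul]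
  exact ⟨hf.mul' (h ℓ).1, by rw [dirDeriv_mul _ hf (h ℓ).1, (h ℓ).2]⟩

theorem HasWDeriv.smul_const {f : M → 𝕜} (hf : SmoothAt n f x) (c : E) :
    HasWDeriv n 𝕜 (fun y => f y • c) (dirDeriv f x v • c) v := by
  simpa using HasWDeriv.smul hf (hasWDeriv_const (v := v) c)

theorem HasWDeriv.clm (L : E →ₗ[𝕜] E') (h : HasWDeriv n 𝕜 F F' v) :
    HasWDeriv n 𝕜 (fun y => L (F y)) (L F') v := fun ℓ => h (ℓ ∘ₗ L)

theorem WSmoothAt.hasWDeriv {J : Type*} [Fintype J] (b : Module.Basis J 𝕜 E)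
    (h : ∀ j, SmoothAt n (fun y => b.coord j (F y)) x) (v : TangentSpace (𝓡 n) x) :
    HasWDeriv n 𝕜 F (∑ j, dirDeriv (fun y => b.coord j (F y)) x v • b j) v := by
  have h1 := HasWDeriv.sum (A := Finset.univ) fun j => HasWDeriv.smul_const (v := v) (h j) (b j)
  refine h1.congr (.of_forall fun y => ?_)
  exact (b.sum_repr (F y)).symm

variable [FiniteDimensional 𝕜 E]

theorem WSmoothAt.exists_hasWDeriv (h : WSmoothAt n 𝕜 F x) (v : TangentSpace (𝓡 n) x) :
    ∃ F', HasWDeriv n 𝕜 F F' v :=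
  ⟨_, WSmoothAt.hasWDeriv (Module.finBasis 𝕜 E) (fun _ => h _) v⟩

theorem HasWDeriv.bilin (β : E →ₗ[𝕜] E' →ₗ[𝕜] E'') {H : M → E'} {H' : E'}
    (h : HasWDeriv n 𝕜 F F' v) (h' : HasWDeriv n 𝕜 H H' v) :
    HasWDeriv n 𝕜 (fun y => β (F y) (H y)) (β F' (H x) + β (F x) H') v := by
  let b := Module.finBasis 𝕜 E
  have h1 := HasWDeriv.sum (A := Finset.univ) fun j =>
    HasWDeriv.smul (h (b.coord j)).1 (h'.clm (β (b j)))
  have e : ∀ m m', β m m' = ∑ j, b.coord j m • β (b j) m' := by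
    intro m m'
    conv_lhs => rw [← b.sum_repr m, map_sum]
    simp
  rw [e F', e (F x), ← Finset.sum_add_distrib]
  simp only [(h _).2] at h1
  exact h1.congr (.of_forall fun y => e _ _)

/-- Bridges two scalar fields: the Clifford algebra is real, while the spinor endomorphisms form a
space over `𝕜`. -/
theorem HasWDeriv.realLinear {C : Type*} [AddCommGroup C] [Module ℝ C] [FiniteDimensional ℝ C]
    (L : C →+ E') (hL : ∀ (r : ℝ) z, L (r • z) = (r : 𝕜) • L z) {a : M → C} {a' : C}
    (h : HasWDeriv n ℝ a a' v) : HasWDeriv n 𝕜 (fun y => L (a y)) (L a') v := by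
  let b := Module.finBasis ℝ C
  have e : ∀ z, L z = ∑ j, ((b.coord j z : ℝ) : 𝕜) • L (b j) := by
    intro z
    conv_lhs => rw [← b.sum_repr z, map_sum]
    exact Finset.sum_congr rfl fun j _ => hL _ _
  have h1 := HasWDeriv.sum (A := Finset.univ) fun j =>
    HasWDeriv.smul_const (v := v) (SmoothAt.ofReal (𝕜 := 𝕜) (h (b.coord j)).1) (L (b j))
  rw [e a']
  have h2 : ∀ j, dirDeriv (fun y => ((b.coord j (a y) : ℝ) : 𝕜)) x v = (b.coord j a' : ℝ) := by
    intro j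
    rw [← (h (b.coord j)).2]
    exact dirDeriv_clm v (RCLike.ofRealCLM (K := 𝕜)) (h (b.coord j)).1
  simp only [h2] at h1
  exact h1.congr (.of_forall fun y => e _)

end Weak

/-! ### Product rules in the exterior algebra -/

section ExteriorWeak

variable {n : ℕ} {M : Type*} [TopologicalSpace M] [ChartedSpace (EuclideanSpace ℝ (Fin n)) M]
  {𝕜 S : Type*} [RCLike 𝕜] [AddCommGroup S] [Module 𝕜 S]
  {x : M} {v : TangentSpace (𝓡 n) x}

/-- Values of smooth maps in a kernel have derivatives in the kernel. -/
theorem HasWDeriv.apply_eq {F : M → ExteriorAlgebra 𝕜 S} {F' : ExteriorAlgebra 𝕜 S}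
    (h : HasWDeriv n 𝕜 F F' v) (L L' : ExteriorAlgebra 𝕜 S →ₗ[𝕜] ExteriorAlgebra 𝕜 S)
    (hL : ∀ᶠ y in nhds x, L (F y) = L' (F y)) : L F' = L' F' :=
  (h.clm L).unique ((h.clm L').congr hL)

variable [FiniteDimensional 𝕜 S]

instance : FiniteDimensional 𝕜 (ExteriorAlgebra 𝕜 S) :=
  Module.Basis.finiteDimensional_of_finite (Module.finBasis 𝕜 S).ExteriorAlgebra

instance {s t : ℕ} : FiniteDimensional ℝ (Cl s t) :=
  (CliffordAlgebra.equivExterior (cliffordForm s t)).symm.finiteDimensional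

/-- The derivative of a map into the exterior algebra. -/
def vderiv (F : M → ExteriorAlgebra 𝕜 S) (x : M) (v : TangentSpace (𝓡 n) x) :
    ExteriorAlgebra 𝕜 S :=
  ∑ J, dirDeriv (fun y => (Module.finBasis 𝕜 S).ExteriorAlgebra.coord J (F y)) x v •
    (Module.finBasis 𝕜 S).ExteriorAlgebra J

theorem WSmoothAt.vderiv {F : M → ExteriorAlgebra 𝕜 S} (h : WSmoothAt n 𝕜 F x)
    (v : TangentSpace (𝓡 n) x) : HasWDeriv n 𝕜 F (vderiv F x v) v :=
  WSmoothAt.hasWDeriv _ (fun _ => h _) v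

theorem HasWDeriv.vderiv_eq {F : M → ExteriorAlgebra 𝕜 S} {F' : ExteriorAlgebra 𝕜 S}
    (h : HasWDeriv n 𝕜 F F' v) : vderiv F x v = F' :=
  (h.wsmooth.vderiv v).unique h

theorem HasWDeriv.mul {F H : M → ExteriorAlgebra 𝕜 S} {F' H' : ExteriorAlgebra 𝕜 S}
    (h : HasWDeriv n 𝕜 F F' v) (h' : HasWDeriv n 𝕜 H H' v) :
    HasWDeriv n 𝕜 (fun y => F y * H y) (F' * H x + F x * H') v :=
  h.bilin (LinearMap.mul 𝕜 (ExteriorAlgebra 𝕜 S)) h'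

theorem HasWDeriv.derivExt {A : M → Module.End 𝕜 S} {A' : Module.End 𝕜 S}
    {F : M → ExteriorAlgebra 𝕜 S} {F' : ExteriorAlgebra 𝕜 S}
    (hA : HasWDeriv n 𝕜 A A' v) (h : HasWDeriv n 𝕜 F F' v) :
    HasWDeriv n 𝕜 (fun y => derivExt (A y) (F y)) (derivExt A' (F x) + derivExt (A x) F') v :=
  hA.bilin (derivExtHom 𝕜 S) h

/-- The induced map is an algebra homomorphism for each point, so its logarithmic derivative is a
derivation; on generators it is `T`. -/
theorem HasWDeriv.map_apply {A : M → Module.End 𝕜 S} {T A' : Module.End 𝕜 S}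
    (hA : HasWDeriv n 𝕜 A A' v) (hT : A' = T * A x) (m : ExteriorAlgebra 𝕜 S) :
    HasWDeriv n 𝕜 (fun y => ExteriorAlgebra.map (A y) m)
      (SuperKilling.derivExt T (ExteriorAlgebra.map (A x) m)) v := by
  induction m using ExteriorAlgebra.induction with
  | algebraMap r =>
    simp only [AlgHom.commutes, derivExt_algebraMap]
    exact hasWDeriv_const _
  | ι w =>
    simp only [ExteriorAlgebra.map_apply_ι, derivExt_ι]
    have h1 := hA.clm ((ExteriorAlgebra.ι 𝕜) ∘ₗ LinearMap.applyₗ w)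
    simpa [hT] using h1
  | mul a b ha hb =>
    simp only [map_mul, derivExt_mul]
    exact ha.mul hb
  | add a b ha hb =>
    simp only [map_add]
    exact ha.add hb

/-- The induced map is not linear in `A`, so the bilinear product rule does not apply; expanding `F`
in a constant basis reduces to `map_apply`. -/
theorem HasWDeriv.map {A : M → Module.End 𝕜 S} {T A' : Module.End 𝕜 S}
    {F : M → ExteriorAlgebra 𝕜 S} {F' : ExteriorAlgebra 𝕜 S}
    (hA : HasWDeriv n 𝕜 A A' v) (hT : A' = T * A x) (hF : HasWDeriv n 𝕜 F F' v) :
    HasWDeriv n 𝕜 (fun y => ExteriorAlgebra.map (A y) (F y))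
      (SuperKilling.derivExt T (ExteriorAlgebra.map (A x) (F x)) + ExteriorAlgebra.map (A x) F') v := by
  let b := Module.finBasis 𝕜 (ExteriorAlgebra 𝕜 S)
  have e : ∀ (g : ExteriorAlgebra 𝕜 S →ₗ[𝕜] ExteriorAlgebra 𝕜 S) m,
      g m = ∑ j, b.coord j m • g (b j) := by
    intro g m
    conv_lhs => rw [← b.sum_repr m, map_sum]
    simp
  have h1 := HasWDeriv.sum (A := Finset.univ) fun j =>
    HasWDeriv.smul (hF (b.coord j)).1 (hA.map_apply hT (b j))
  have e1 := e (ExteriorAlgebra.map (A x)).toLinearMap F'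
  have e2 := e (SuperKilling.derivExt T ∘ₗ (ExteriorAlgebra.map (A x)).toLinearMap) (F x)
  simp only [AlgHom.toLinearMap_apply, LinearMap.comp_apply] at e1 e2
  rw [e1, e2, ← Finset.sum_add_distrib]
  simp only [(hF _).2] at h1
  have h2 := h1.congr (H := fun y => ExteriorAlgebra.map (A y) (F y))
    (.of_forall fun y => e (ExteriorAlgebra.map (A y)).toLinearMap _)
  simpa only [add_comm] using h2

/-- Contraction as a bilinear map. -/
def contractHom (𝕜 S : Type*) [RCLike 𝕜] [AddCommGroup S] [Module 𝕜 S] :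
    Module.Dual 𝕜 S →ₗ[𝕜] ExteriorAlgebra 𝕜 S →ₗ[𝕜] ExteriorAlgebra 𝕜 S :=
  CliffordAlgebra.contractLeft

theorem HasWDeriv.contractLeft {d : M → Module.Dual 𝕜 S} {d' : Module.Dual 𝕜 S}
    {F : M → ExteriorAlgebra 𝕜 S} {F' : ExteriorAlgebra 𝕜 S}
    (hd : HasWDeriv n 𝕜 d d' v) (h : HasWDeriv n 𝕜 F F' v) :
    HasWDeriv n 𝕜 (fun y => (CliffordAlgebra.contractLeft (d y) (F y) : ExteriorAlgebra 𝕜 S))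
      (CliffordAlgebra.contractLeft d' (F x) + CliffordAlgebra.contractLeft (d x) F') v :=
  hd.bilin (contractHom 𝕜 S) h

end ExteriorWeak

end SuperKilling

end

noncomputable section

namespace SuperKilling

namespace SpecialGradedManifold

/-! ### Gauge-covariant first-order operators on the exterior bundle -/

section Operators

variable {s t : ℕ} {𝕜 S M ι : Type*} [RCLike 𝕜] [AddCommGroup S] [Module 𝕜 S]
  [TopologicalSpace M] [ChartedSpace (EuclideanSpace ℝ (Fin (s + t))) M]
  [IsManifold (𝓡 (s + t)) ∞ M] (G : SpecialGradedManifold s t 𝕜 S M ι)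
  {i j : ι} {x : M}

local notation "⟦" X ", " Y "⟧" => VectorField.mlieBracket (𝓡 (s + t)) X Y

/-- The cocycle condition makes it idempotent, and it is invertible. -/
theorem trans_self (hx : x ∈ G.spin.U i) : G.spin.trans i i x = 1 := by
  have h := G.spin.trans_cocycle i i i x ⟨⟨hx, hx⟩, hx⟩
  have hu : (G.spin.trans i i x : Cl s t) * G.spin.trans i i x = G.spin.trans i i x :=
    congrArg Subtype.val h
  have h1 : star (G.spin.trans i i x : Cl s t) * G.spin.trans i i x = 1 :=
    spinGroup.star_mul_self_of_mem (G.spin.trans i i x).2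
  have h2 : (G.spin.trans i i x : Cl s t) = 1 := by
    have := congrArg (fun z => star (G.spin.trans i i x : Cl s t) * z) hu
    simpa only [← mul_assoc, h1, one_mul] using this
  exact Subtype.ext h2

theorem superLocal_idx (f : M → ExteriorAlgebra 𝕜 S) (x : M) :
    G.superLocal (G.idx x) f x = f x := by
  rw [superLocal, G.trans_self (G.mem_idx x), SpinModule.act_one]
  exact congrArg (fun A => A (f x)) ExteriorAlgebra.map_id

theorem spinorLocal_idx (φ : M → S) (x : M) : G.spinorLocal (G.idx x) φ x = φ x := by
  rw [spinorLocal, G.trans_self (G.mem_idx x), SpinModule.act_one]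
  rfl

theorem superLocal_trans (hi : x ∈ G.spin.U i) (hj : x ∈ G.spin.U j)
    (f : M → ExteriorAlgebra 𝕜 S) : G.superLocal i f x
      = ExteriorAlgebra.map (G.fibre.act (G.spin.trans i j x)) (G.superLocal j f x) := by
  rw [superLocal, superLocal, ← G.spin.trans_cocycle i j (G.idx x) x ⟨⟨hi, hj⟩, G.mem_idx x⟩,
    SpinModule.act_mul]
  exact (DFunLike.congr_fun (ExteriorAlgebra.map_comp_map
    (G.fibre.act (G.spin.trans j (G.idx x) x)) (G.fibre.act (G.spin.trans i j x))) (f x)).symm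

theorem superLocal_mul (f f' : M → ExteriorAlgebra 𝕜 S) (x : M) :
    G.superLocal i (f * f') x = G.superLocal i f x * G.superLocal i f' x := by
  simp [superLocal]

theorem superLocal_add (f f' : M → ExteriorAlgebra 𝕜 S) (x : M) :
    G.superLocal i (f + f') x = G.superLocal i f x + G.superLocal i f' x := by
  simp [superLocal]

theorem superLocal_smul (c : 𝕜) (f : M → ExteriorAlgebra 𝕜 S) (x : M) :
    G.superLocal i (c • f) x = c • G.superLocal i f x := by
  simp [superLocal]

variable {G}

theorem smooth_spinorLocal (φ : G.SpinorField) (hx : x ∈ G.spin.U i) :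
    WSmoothAt (s + t) 𝕜 (G.spinorLocal i φ.1) x := fun ℓ =>
  (φ.2 i ℓ).contMDiffAt ((G.spin.isOpen_U i).mem_nhds hx)

variable [FiniteDimensional 𝕜 S]

theorem smooth_superLocal (f : G.superFunctions) (hx : x ∈ G.spin.U i) :
    WSmoothAt (s + t) 𝕜 (G.superLocal i f.1) x := fun ℓ =>
  (f.2 i ℓ).contMDiffAt ((G.spin.isOpen_U i).mem_nhds hx)

theorem mem_superFunctions {f : M → ExteriorAlgebra 𝕜 S}
    (h : ∀ i, ∀ x ∈ G.spin.U i, WSmoothAt (s + t) 𝕜 (G.superLocal i f) x) :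
    f ∈ G.superFunctions := fun i ℓ x hx => (h i x hx ℓ).contMDiffWithinAt

variable (G)

/-- The local data of an operator `X + B + c` on the exterior bundle, where the skew matrices `B`
act through the spin representation and transform like a connection form. -/
structure GaugeOperator (X : VF (s + t) M) where
  B : ι → M → Fin s ⊕ Fin t → Fin s ⊕ Fin t → ℝ
  c : M → 𝕜
  antisymm : ∀ i, ∀ x ∈ G.spin.U i, ∀ k l, B i x k l = -B i x l k
  smooth_B : ∀ i, ∀ x ∈ G.spin.U i, ∀ k l, SmoothAt (s + t) (fun y => B i y k l) x
  smooth_c : ∀ x, SmoothAt (s + t) c x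
  frameChange : ∀ i j, ∀ x ∈ G.spin.U i ∩ G.spin.U j, ∀ k m,
    dirDeriv (fun y => G.frameChange i j y k m) x (X x)
      + ∑ l, G.frameChange i j x k l * (eta m * B i x l m)
      = ∑ l, eta l * B j x k l * G.frameChange i j x l m

namespace GaugeOperator

variable {G} {X Y : VF (s + t) M} (L : G.GaugeOperator X)

/-- The endomorphism `B` acting on the fibre. -/
def spin (i : ι) (x : M) : Module.End 𝕜 S := G.fibre.repCl (spinElt (L.B i x))

/-- The operator in the frame `i`. -/
def loc (i : ι) (F : M → ExteriorAlgebra 𝕜 S) (x : M) : ExteriorAlgebra 𝕜 S :=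
  vderiv F x (X x) + derivExt (L.spin i x) (F x) + L.c x • derivExt 1 (F x)

theorem loc_eq (i : ι) (F : M → ExteriorAlgebra 𝕜 S) (x : M) : L.loc i F x =
    vderiv F x (X x) + derivExt (L.spin i x) (F x) + L.c x • derivExt 1 (F x) := rfl

/-- The operator on sections. -/
def op (f : M → ExteriorAlgebra 𝕜 S) (x : M) : ExteriorAlgebra 𝕜 S :=
  L.loc (G.idx x) (G.superLocal (G.idx x) f) x

omit [FiniteDimensional 𝕜 S] in
/-- The derivative of the transition functions along `X`. -/
theorem spin_trans (hi : x ∈ G.spin.U i) (hj : x ∈ G.spin.U j) : ∃ T A' : Module.End 𝕜 S,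
    HasWDeriv (s + t) 𝕜 (fun y => G.fibre.act (G.spin.trans i j y)) A' (X x) ∧
    A' = T * G.fibre.act (G.spin.trans i j x) ∧
    G.fibre.act (G.spin.trans i j x) * L.spin j x
      = (T + L.spin i x) * G.fibre.act (G.spin.trans i j x) := by
  classical
  have hUU : ∀ᶠ y in nhds x, y ∈ G.spin.U i ∩ G.spin.U j :=
    ((G.spin.isOpen_U i).inter (G.spin.isOpen_U j)).mem_nhds ⟨hi, hj⟩
  have hs : WSmoothAt (s + t) ℝ (fun y => (G.spin.trans i j y : Cl s t)) x := fun ℓ =>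
    (G.spin.trans_smooth i j ℓ).contMDiffAt
      (((G.spin.isOpen_U i).inter (G.spin.isOpen_U j)).mem_nhds ⟨hi, hj⟩)
  obtain ⟨a', ha'⟩ := hs.exists_hasWDeriv (X x)
  set a : M → Cl s t := fun y => (G.spin.trans i j y : Cl s t) with ha
  have hev : ∀ y, CliffordAlgebra.involute (a y) = a y := fun y =>
    spinGroup.involute_eq (G.spin.trans i j y).2
  have h1 : ∀ y, star (a y) * a y = 1 := fun y => spinGroup.star_mul_self_of_mem (G.spin.trans i j y).2
  have h1' : ∀ y, a y * star (a y) = 1 := fun y => spinGroup.mul_star_self_of_mem (G.spin.trans i j y).2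
  have hev' : CliffordAlgebra.involute a' = a' := by
    have h := ha'.clm (CliffordAlgebra.involute (Q := cliffordForm s t)).toLinearMap
    exact (h.congr (.of_forall fun y => (hev y).symm)).unique ha'
  have hstar : ∀ z : Cl s t, star z = CliffordAlgebra.reverse (CliffordAlgebra.involute z) :=
    fun z => rfl
  -- The derivative of `star a * a = 1`; likewise `hev'` and `hΛ'` differentiate evenness and the
  -- relation with the change of frame. These are the inputs of `add_spinElt_mul_eq`.
  have h2 : star a' * a x + star (a x) * a' = 0 := by
    have h := (ha'.clm (CliffordAlgebra.reverse ∘ₗ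
      (CliffordAlgebra.involute (Q := cliffordForm s t)).toLinearMap)).bilin
      (LinearMap.mul ℝ (Cl s t)) ha'
    exact (h.congr (H := fun _ => 1) (.of_forall fun y => (h1 y).symm)).unique (hasWDeriv_const _)
  have hΛ' : ∀ k, a' * gam k = ∑ l, dirDeriv (fun y => G.frameChange i j y k l) x (X x) •
      (gam l * a x) + ∑ l, G.frameChange i j x k l • (gam l * a') := by
    intro k
    have e1 := ha'.clm (LinearMap.mulRight ℝ (gam k))
    have e2 := HasWDeriv.sum (A := Finset.univ) fun l =>
      HasWDeriv.smul (G.smooth_frameChange hi hj k l) (ha'.clm (LinearMap.mulLeft ℝ (gam l)))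
    rw [Finset.sum_add_distrib] at e2
    refine e1.unique (e2.congr ?_)
    filter_upwards [hUU] with y hy using G.trans_mul_gam hy.1 hy.2 k
  have key := add_spinElt_mul_eq (hev x) hev' (h1 x) (h1' x) h2 (L.antisymm i x hi)
    (L.antisymm j x hj) (G.trans_mul_gam hi hj) hΛ' (L.frameChange i j x ⟨hi, hj⟩)
  -- The witness `T` is the image of the logarithmic derivative `a' a⁻¹`, where `a⁻¹ = star a`.
  have hT : a' = a' * star (a x) * a x := by rw [mul_assoc, h1, mul_one]
  have hst : CliffordAlgebra.involute (a' * star (a x)) = a' * star (a x) := by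
    rw [map_mul, hev', hstar, CliffordAlgebra.reverse_involute, CliffordAlgebra.involute_involute,
      ← CliffordAlgebra.reverse_involute, hev]
  refine ⟨G.fibre.repCl (a' * star (a x)), G.fibre.repCl a', ?_, ?_, ?_⟩
  · simp only [SpinModule.act_eq_repCl]
    exact HasWDeriv.realLinear (⟨⟨G.fibre.repCl, by
      simpa using G.fibre.repCl_smul 0 0⟩, G.fibre.repCl_add⟩) G.fibre.repCl_smul ha'
  · rw [SpinModule.act_eq_repCl, ← SpinModule.repCl_mul _ hst (hev x)]
    exact congrArg _ hT
  · rw [SpinModule.act_eq_repCl, spin, spin, add_mul, ← SpinModule.repCl_mul _ hst (hev x),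
      ← SpinModule.repCl_mul _ (hev x) (involute_spinElt _),
      ← SpinModule.repCl_mul _ (involute_spinElt _) (hev x), ← SpinModule.repCl_add, ← hT]
    exact congrArg _ key.symm

/-- Differentiating the transition function produces the derivation of `T`; the transformation law
of the matrices supplies the same term in the endomorphism part. The degree term commutes with all
induced maps. -/
theorem loc_trans (hi : x ∈ G.spin.U i) (hj : x ∈ G.spin.U j) (f : G.superFunctions) :
    L.loc i (G.superLocal i f.1) x = ExteriorAlgebra.map (G.fibre.act (G.spin.trans i j x))
      (L.loc j (G.superLocal j f.1) x) := by
  obtain ⟨T, A', h1, h2, h3⟩ := L.spin_trans hi hj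
  have h4 := h1.map h2 ((smooth_superLocal f hj).vderiv (X x))
  have h5 := h4.congr (H := G.superLocal i f.1) (by
    filter_upwards [G.eventually_mem_U hi, G.eventually_mem_U hj] with y yi yj
    exact G.superLocal_trans yi yj f.1)
  have h6 := map_derivExt (L.spin j x) h3 (G.superLocal j f.1 x)
  have h7 := map_derivExt (g := G.fibre.act (G.spin.trans i j x)) 1 (A' := 1) (by simp)
    (G.superLocal j f.1 x)
  rw [loc, loc, h5.vderiv_eq, map_add, map_add, map_smul, h6, h7, derivExt_add,
    ← G.superLocal_trans hi hj,
    LinearMap.add_apply]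
  abel

theorem superLocal_op (hi : x ∈ G.spin.U i) (f : G.superFunctions) :
    G.superLocal i (L.op f.1) x = L.loc i (G.superLocal i f.1) x := by
  rw [L.loc_trans hi (G.mem_idx x), superLocal]
  rfl

omit [FiniteDimensional 𝕜 S] in
theorem hasWDeriv_spin (hi : x ∈ G.spin.U i) (v : TangentSpace (𝓡 (s + t)) x) :
    HasWDeriv (s + t) 𝕜 (L.spin i)
      (G.fibre.repCl (spinElt fun k l => dirDeriv (fun y => L.B i y k l) x v)) v := by
  have h : HasWDeriv (s + t) ℝ (fun y => spinElt (L.B i y))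
      (spinElt fun k l => dirDeriv (fun y => L.B i y k l) x v) v := by
    simp only [spinElt_eq]
    suffices h : HasWDeriv (s + t) ℝ (fun y => ∑ k, ∑ l, (eta k * eta l * L.B i y k l) •
        (gam (s := s) (t := t) k * gam l)) (∑ k, ∑ l,
        (eta k * eta l * dirDeriv (fun y => L.B i y k l) x v) • (gam k * gam l)) v from
      h.clm ((1 / 4 : ℝ) • (LinearMap.id : Cl s t →ₗ[ℝ] Cl s t))
    refine HasWDeriv.sum fun k => HasWDeriv.sum fun l => ?_
    have h := (L.smooth_B i x hi k l)
    have h2 := HasWDeriv.smul_const (v := v) (SmoothAt.mul' (SmoothAt.const (eta k * eta l)) h)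
      (gam (s := s) (t := t) k * gam l)
    rw [dirDeriv_mul _ (SmoothAt.const _) h, dirDeriv_const, zero_mul, zero_add] at h2
    exact h2
  exact HasWDeriv.realLinear (⟨⟨G.fibre.repCl, by
      simpa using G.fibre.repCl_smul 0 0⟩, G.fibre.repCl_add⟩) G.fibre.repCl_smul h

/-- The second derivative of a map into the exterior algebra. -/
theorem hasWDeriv_vderiv {F : M → ExteriorAlgebra 𝕜 S} (hF : ∀ᶠ y in nhds x, WSmoothAt (s + t) 𝕜 F y)
    (v : TangentSpace (𝓡 (s + t)) x) : HasWDeriv (s + t) 𝕜 (fun y => vderiv F y (X y))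
      (vderiv (fun y => vderiv F y (X y)) x v) v := by
  refine WSmoothAt.vderiv (fun ℓ => ?_) v
  refine ((hF.self_of_nhds ℓ).dirDeriv (X.contMDiff x)).congr_of_eventuallyEq ?_
  filter_upwards [hF] with y hy
  exact ((hy.vderiv (X y) ℓ).2).symm

theorem hasWDeriv_loc (hi : x ∈ G.spin.U i) {F : M → ExteriorAlgebra 𝕜 S}
    (hF : ∀ᶠ y in nhds x, WSmoothAt (s + t) 𝕜 F y) (v : TangentSpace (𝓡 (s + t)) x) :
    HasWDeriv (s + t) 𝕜 (L.loc i F)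
      (vderiv (fun y => vderiv F y (X y)) x v
        + (derivExt (G.fibre.repCl (spinElt fun k l => dirDeriv (fun y => L.B i y k l) x v)) (F x)
          + derivExt (L.spin i x) (vderiv F x v))
        + (dirDeriv L.c x v • derivExt 1 (F x) + L.c x • derivExt 1 (vderiv F x v))) v := by
  have h1 := hF.self_of_nhds.vderiv v
  exact ((hasWDeriv_vderiv hF v).add ((L.hasWDeriv_spin hi v).derivExt h1)).add
    ((h1.clm (derivExt 1)).smul (L.smooth_c x))

theorem eventually_smooth_superLocal (f : G.superFunctions) (hi : x ∈ G.spin.U i) :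
    ∀ᶠ y in nhds x, WSmoothAt (s + t) 𝕜 (G.superLocal i f.1) y := by
  filter_upwards [G.eventually_mem_U hi] with y hy using smooth_superLocal f hy

theorem op_mem (f : G.superFunctions) : L.op f.1 ∈ G.superFunctions := by
  refine mem_superFunctions fun i x hi => ?_
  -- Only the smoothness is used, so the direction is arbitrary.
  have h := (L.hasWDeriv_loc hi (eventually_smooth_superLocal f hi) 0).wsmooth
  refine h.congr ?_
  filter_upwards [G.eventually_mem_U hi] with y hy using L.superLocal_op hy f

theorem vderiv_superLocal_add (f f' : G.superFunctions) (hi : x ∈ G.spin.U i)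
    (v : TangentSpace (𝓡 (s + t)) x) : vderiv (G.superLocal i (f + f' : G.superFunctions).1) x v
      = vderiv (G.superLocal i f.1) x v + vderiv (G.superLocal i f'.1) x v :=
  (((smooth_superLocal f hi).vderiv v).add ((smooth_superLocal f' hi).vderiv v)).congr
    (.of_forall fun y => G.superLocal_add f.1 f'.1 y) |>.vderiv_eq

theorem vderiv_superLocal_smul (c : 𝕜) (f : G.superFunctions) (hi : x ∈ G.spin.U i)
    (v : TangentSpace (𝓡 (s + t)) x) : vderiv (G.superLocal i (c • f : G.superFunctions).1) x v
      = c • vderiv (G.superLocal i f.1) x v :=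
  (((smooth_superLocal f hi).vderiv v).clm
    (c • (LinearMap.id : ExteriorAlgebra 𝕜 S →ₗ[𝕜] ExteriorAlgebra 𝕜 S))).congr
    (.of_forall fun y => G.superLocal_smul c f.1 y) |>.vderiv_eq

theorem vderiv_superLocal_mul (f f' : G.superFunctions) (hi : x ∈ G.spin.U i)
    (v : TangentSpace (𝓡 (s + t)) x) : vderiv (G.superLocal i (f * f' : G.superFunctions).1) x v
      = vderiv (G.superLocal i f.1) x v * G.superLocal i f'.1 x
        + G.superLocal i f.1 x * vderiv (G.superLocal i f'.1) x v :=
  (((smooth_superLocal f hi).vderiv v).mul ((smooth_superLocal f' hi).vderiv v)).congr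
    (.of_forall fun y => G.superLocal_mul f.1 f'.1 y) |>.vderiv_eq

/-- The operator as an endomorphism of the algebra of functions. -/
def toEnd : Module.End 𝕜 G.superFunctions where
  toFun f := ⟨L.op f.1, L.op_mem f⟩
  map_add' f f' := by
    apply Subtype.ext
    funext x
    have h := vderiv_superLocal_add f f' (G.mem_idx x) (X x)
    have h2 : G.superLocal (G.idx x) (f + f' : G.superFunctions).1 x
        = G.superLocal (G.idx x) f.1 x + G.superLocal (G.idx x) f'.1 x :=
      G.superLocal_add f.1 f'.1 x
    change L.op (f + f' : G.superFunctions).1 x = L.op f.1 x + L.op f'.1 x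
    rw [op, loc, h, h2]
    simp only [op, loc, map_add, smul_add]
    abel
  map_smul' c f := by
    apply Subtype.ext
    funext x
    have h := vderiv_superLocal_smul c f (G.mem_idx x) (X x)
    have h2 : G.superLocal (G.idx x) (c • f : G.superFunctions).1 x
        = c • G.superLocal (G.idx x) f.1 x := G.superLocal_smul c f.1 x
    change L.op (c • f : G.superFunctions).1 x = c • L.op f.1 x
    rw [op, loc, h, h2]
    simp only [op, loc, map_smul, smul_add]
    rw [smul_comm c]

theorem toEnd_apply (f : G.superFunctions) (x : M) : (L.toEnd f).1 x = L.op f.1 x := rfl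

theorem toEnd_mul (f f' : G.superFunctions) : L.toEnd (f * f') = L.toEnd f * f' + f * L.toEnd f' := by
  apply Subtype.ext
  funext x
  have h := vderiv_superLocal_mul f f' (G.mem_idx x) (X x)
  have h2 := G.superLocal_mul (i := G.idx x) f.1 f'.1 x
  change L.op (f * f' : G.superFunctions).1 x = L.op f.1 x * f'.1 x + f.1 x * L.op f'.1 x
  rw [op, loc, h]
  change _ + derivExt _ (G.superLocal (G.idx x) (f.1 * f'.1) x)
    + _ • derivExt _ (G.superLocal (G.idx x) (f.1 * f'.1) x) = _
  rw [h2]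
  simp only [op, loc, derivExt_mul, G.superLocal_idx, smul_add, add_mul, mul_add, smul_mul_assoc,
    mul_smul_comm]
  abel

theorem toEnd_mem : L.toEnd ∈ G.derivations 0 := by
  intro q f hf
  refine ⟨fun x => ?_, fun f' => ?_⟩
  · rw [zero_add, mem_parity_iff, toEnd_apply, op, loc]
    have hF : ∀ y, CliffordAlgebra.involute (G.superLocal (G.idx x) f.1 y)
        = superSign q 1 • G.superLocal (G.idx x) f.1 y := by
      intro y
      rw [superLocal, involute_map, mem_parity_iff.1 (hf y), map_zsmul]
    -- Parity is the linear equation of `mem_parity_iff`, which holds at all points and hence for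
    -- the derivative.
    have h1 := ((smooth_superLocal f (G.mem_idx x)).vderiv (X x)).apply_eq
      CliffordAlgebra.involute.toLinearMap
      ((superSign q 1 : 𝕜) • (LinearMap.id : ExteriorAlgebra 𝕜 S →ₗ[𝕜] ExteriorAlgebra 𝕜 S))
      (.of_forall fun y => (hF y).trans (Int.cast_smul_eq_zsmul 𝕜 _ _).symm)
    have h1' : CliffordAlgebra.involute (vderiv (G.superLocal (G.idx x) f.1) x (X x))
      = superSign q 1 • vderiv (G.superLocal (G.idx x) f.1) x (X x) :=
      h1.trans (Int.cast_smul_eq_zsmul 𝕜 _ _)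
    rw [map_add, map_add, map_smul, involute_derivExt, involute_derivExt, h1', hF]
    simp only [map_zsmul, smul_add]
    rw [smul_comm (L.c x)]
  · rw [L.toEnd_mul f f']
    simp [superSign]

/-- The commutator of two operators. -/
theorem lie_toEnd (L' : G.GaugeOperator Y) (L'' : G.GaugeOperator (lieBracket X Y))
    (h : L.c = 0) (h' : L'.c = 0) (h'' : L''.c = 0)
    (hB : ∀ i, ∀ x ∈ G.spin.U i, ∀ m p, L''.B i x m p
      = dirDeriv (fun y => L'.B i y m p) x (X x) - dirDeriv (fun y => L.B i y m p) x (Y x)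
        + ∑ l, eta l * (L'.B i x m l * L.B i x l p - L.B i x m l * L'.B i x l p)) :
    ⁅L.toEnd, L'.toEnd⁆ = L''.toEnd := by
  apply LinearMap.ext
  intro f
  apply Subtype.ext
  funext x
  set i := G.idx x with hi
  have hx : x ∈ G.spin.U i := G.mem_idx x
  set F := G.superLocal i f.1 with hF
  have hFs : ∀ᶠ y in nhds x, WSmoothAt (s + t) 𝕜 F y := eventually_smooth_superLocal f hx
  have e1 : (L.toEnd (L'.toEnd f)).1 x = L.loc i (L'.loc i F) x := by
    have h0 : G.superLocal i (L'.toEnd f).1 =ᶠ[nhds x] L'.loc i F := by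
      filter_upwards [G.eventually_mem_U hx] with y hy using L'.superLocal_op hy f
    change L.loc i (G.superLocal i (L'.toEnd f).1) x = _
    rw [loc, loc, h0.self_of_nhds,
      (((L'.hasWDeriv_loc hx hFs (X x))).congr h0).vderiv_eq,
      ((L'.hasWDeriv_loc hx hFs (X x))).vderiv_eq]
  have e2 : (L'.toEnd (L.toEnd f)).1 x = L'.loc i (L.loc i F) x := by
    have h0 : G.superLocal i (L.toEnd f).1 =ᶠ[nhds x] L.loc i F := by
      filter_upwards [G.eventually_mem_U hx] with y hy using L.superLocal_op hy f
    change L'.loc i (G.superLocal i (L.toEnd f).1) x = _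
    rw [loc, loc, h0.self_of_nhds,
      (((L.hasWDeriv_loc hx hFs (Y x))).congr h0).vderiv_eq,
      ((L.hasWDeriv_loc hx hFs (Y x))).vderiv_eq]
  -- The second derivatives of `F` enter only through their commutator, which is the derivative
  -- along the Lie bracket.
  have e3 : vderiv F x (lieBracket X Y x) = vderiv (fun y => vderiv F y (Y y)) x (X x)
      - vderiv (fun y => vderiv F y (X y)) x (Y x) := by
    rw [← sub_eq_zero, ← Module.forall_dual_apply_eq_zero_iff 𝕜]
    intro ℓ
    have a1 : ∀ Z : VF (s + t) M, (fun y => ℓ (vderiv F y (Z y)))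
        =ᶠ[nhds x] fun y => dirDeriv (fun z => ℓ (F z)) y (Z y) := by
      intro Z
      filter_upwards [hFs] with y hy
      exact ((hy.vderiv (Z y) ℓ).2).symm
    have a2 := (hasWDeriv_vderiv (X := Y) hFs (X x) ℓ).2
    have a3 := (hasWDeriv_vderiv (X := X) hFs (Y x) ℓ).2
    have a4 := (hFs.self_of_nhds.vderiv (lieBracket X Y x) ℓ).2
    rw [dirDeriv_congr _ (a1 _)] at a2 a3
    have a5 := dirDeriv_bracket (hFs.self_of_nhds ℓ) (X.contMDiff x) (Y.contMDiff x)
    rw [map_sub, map_sub, ← a2, ← a3, ← a4, sub_eq_zero]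
    exact a5
  change (L.toEnd (L'.toEnd f)).1 x - (L'.toEnd (L.toEnd f)).1 x = L''.loc i F x
  rw [e1, e2, L.loc_eq i (L'.loc i F), (L'.hasWDeriv_loc hx hFs (X x)).vderiv_eq, L'.loc_eq i (L.loc i F),
    (L.hasWDeriv_loc hx hFs (Y x)).vderiv_eq,
    L.loc_eq i F, L'.loc_eq i F, L''.loc_eq i F, e3, h, h', h'']
  have hD : ∀ Z : VF (s + t) M, ∀ {W : VF (s + t) M} (K : G.GaugeOperator W), ∀ k l,
      dirDeriv (fun y => K.B i y k l) x (Z x) = -dirDeriv (fun y => K.B i y l k) x (Z x) := by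
    intro Z W K k l
    rw [← dirDeriv_neg (K.smooth_B i x hx l k)]
    refine dirDeriv_congr _ ?_
    filter_upwards [G.eventually_mem_U hx] with y hy using K.antisymm i y hy k l
  -- The zeroth-order part of the commutator: derivatives of the matrices plus the commutator of
  -- their spin images. The mixed first-order terms cancel in the final `abel`.
  have key := spinElt_lie (L.antisymm i x hx) (L'.antisymm i x hx) (D := fun m p =>
    dirDeriv (fun y => L'.B i y m p) x (X x) - dirDeriv (fun y => L.B i y m p) x (Y x))
    (fun k l => by rw [hD X L', hD Y L]; ring) (L''.antisymm i x hx) (hB i x hx)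
  have hs : spinElt (fun m p =>
      dirDeriv (fun y => L'.B i y m p) x (X x) - dirDeriv (fun y => L.B i y m p) x (Y x))
      = spinElt (fun m p => dirDeriv (fun y => L'.B i y m p) x (X x))
        - spinElt (fun m p => dirDeriv (fun y => L.B i y m p) x (Y x)) := by
    simp only [spinElt_eq, mul_sub, sub_smul, Finset.sum_sub_distrib, smul_sub]
  have hsub : ∀ a b, G.fibre.repCl (a - b) = G.fibre.repCl a - G.fibre.repCl b := by
    intro a b
    rw [eq_sub_iff_add_eq, ← SpinModule.repCl_add, sub_add_cancel]
  have hev := fun B => involute_spinElt (s := s) (t := t) B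
  have key2 := congrArg (fun z => derivExt (G.fibre.repCl z) (F x)) key
  simp only [hs, SpinModule.repCl_add, hsub, SpinModule.repCl_mul _ (hev _) (hev _)] at key2
  rw [derivExt_add, derivExt_sub, LinearMap.add_apply, LinearMap.sub_apply, ← derivExt_lie] at key2
  change _ = _ + derivExt (G.fibre.repCl (spinElt (L''.B i x))) (F x) + _
  have z1 : ∀ v : TangentSpace (𝓡 (s + t)) x, dirDeriv (0 : M → 𝕜) x v = 0 := fun v =>
    dirDeriv_const v (0 : 𝕜)
  rw [← key2]
  simp only [spin, z1, Pi.zero_apply, zero_smul, add_zero, map_add]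
  abel

end GaugeOperator

end Operators

end SpecialGradedManifold

end SuperKilling

end

noncomputable section

namespace SuperKilling

namespace SpecialGradedManifold

/-! ### The operators `∇_X` and `𝔢_α(X)` -/

section Lifts

variable {s t : ℕ} {𝕜 S M ι : Type*} [RCLike 𝕜] [AddCommGroup S] [Module 𝕜 S]
  [TopologicalSpace M] [ChartedSpace (EuclideanSpace ℝ (Fin (s + t))) M]
  [IsManifold (𝓡 (s + t)) ∞ M] (G : SpecialGradedManifold s t 𝕜 S M ι)
  {i j : ι} {x : M}

local notation "⟦" X ", " Y "⟧" => VectorField.mlieBracket (𝓡 (s + t)) X Y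

/-- The local data of `∇_X`. -/
def nablaOp (X : VF (s + t) M) : G.GaugeOperator X where
  B i := G.conn i X
  c := 0
  antisymm _ _ hx := G.conn_antisymm X hx
  smooth_B _ _ hx := G.smooth_conn X hx
  smooth_c _ := contMDiffAt_const
  frameChange _ _ _ hx := G.conn_frameChange X hx.1 hx.2

theorem traceCov_eq (X : VF (s + t) M) (hx : x ∈ G.spin.U i) :
    G.traceCov X x = ∑ k, eta k * G.cov i X x k k := by
  rw [traceCov, covMatrix_eq]
  exact G.trace_cov_eq X (G.mem_idx x) hx

theorem smooth_traceCov (X : VF (s + t) M) (x : M) : SmoothAt (s + t) (G.traceCov X) x := by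
  have h : SmoothAt (s + t) (fun y => ∑ k, eta k * G.cov (G.idx x) X y k k) x :=
    SmoothAt.sum' fun k => SmoothAt.mul' contMDiffAt_const (G.smooth_cov X (G.mem_idx x) k k)
  refine h.congr_of_eventuallyEq ?_
  filter_upwards [G.eventually_mem_U (G.mem_idx x)] with y hy using G.traceCov_eq X hy

theorem smooth_skewCov (X : VF (s + t) M) (hx : x ∈ G.spin.U i) (k l : Fin s ⊕ Fin t) :
    SmoothAt (s + t) (fun y => G.skewCov i X y k l) x :=
  SmoothAt.mul' contMDiffAt_const ((G.smooth_cov X hx k l).sub' (G.smooth_cov X hx l k))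

/-- The local data of `∇_X - (∇X)_𝔞 + α tr(∇X)`. -/
def evenGauge (α : 𝕜) (X : VF (s + t) M) : G.GaugeOperator X where
  B i x k l := G.conn i X x k l - G.skewCov i X x k l
  c x := α * (G.traceCov X x : 𝕜)
  antisymm i x hx k l := by
    rw [G.conn_antisymm X hx, skewCov, skewCov]
    ring
  smooth_B _ _ hx k l := (G.smooth_conn X hx k l).sub' (G.smooth_skewCov X hx k l)
  smooth_c x := SmoothAt.mul' contMDiffAt_const (G.smooth_traceCov X x).ofReal
  frameChange i j x hx k m := by
    have h1 := G.conn_frameChange X hx.1 hx.2 k m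
    have h2 := G.skewCov_frameChange X hx.1 hx.2 k m
    simp only [mul_sub, sub_mul, Finset.sum_sub_distrib]
    rw [← h2, ← h1]
    ring

/-- A skew matrix has no trace, so the term with `α` drops out for Killing fields. -/
theorem evenGauge_c_eq_zero [T2Space M] (α : 𝕜) {X : VF (s + t) M} (hX : IsKilling G.metric X) :
    (G.evenGauge α X).c = 0 := by
  funext x
  change α * (G.traceCov X x : 𝕜) = 0
  rw [G.traceCov_eq X (G.mem_idx x), trace_cov_eq_zero hX (G.mem_idx x)]
  simp

variable {G}

/-- The Lie derivative of `g` along a bracket is the commutator of Lie derivatives; the Jacobi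
identity handles the bracket terms, and the mixed products cancel. -/
theorem isKilling_lieBracket [T2Space M] {X Y : VF (s + t) M} (hX : IsKilling G.metric X)
    (hY : IsKilling G.metric Y) : IsKilling G.metric (lieBracket X Y) := by
  intro A B x
  have sX := X.contMDiff
  have sY := Y.contMDiff
  have sA : ∀ y, SmoothFieldAt (s + t) A y := A.contMDiff
  have sB : ∀ y, SmoothFieldAt (s + t) B y := B.contMDiff
  have sYA : ∀ y, SmoothFieldAt (s + t) ⟦Y, A⟧ y := fun y => SmoothFieldAt.bracket (sY y) (sA y)
  have sYB : ∀ y, SmoothFieldAt (s + t) ⟦Y, B⟧ y := fun y => SmoothFieldAt.bracket (sY y) (sB y)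
  have sXA : ∀ y, SmoothFieldAt (s + t) ⟦X, A⟧ y := fun y => SmoothFieldAt.bracket (sX y) (sA y)
  have sXB : ∀ y, SmoothFieldAt (s + t) ⟦X, B⟧ y := fun y => SmoothFieldAt.bracket (sX y) (sB y)
  have e : ∀ {Z : VF (s + t) M}, IsKilling G.metric Z → ∀ {A B : ∀ x, TangentSpace (𝓡 (s + t)) x},
      (∀ y, SmoothFieldAt (s + t) A y) → (∀ y, SmoothFieldAt (s + t) B y) →
      ∀ y, dirDeriv (G.metric.pair A B) y (Z y)
        = G.metric.pair ⟦Z, A⟧ B y + G.metric.pair A ⟦Z, B⟧ y :=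
    fun hZ _ _ hA hB y => hZ.dirDeriv_pair _ (.of_forall hA) (.of_forall hB)
  have h0 := dirDeriv_bracket ((sA x).pair G.metric (sB x)) (sX x) (sY x)
  simp only [e hX sA sB, e hY sA sB] at h0
  rw [dirDeriv_add _ ((sYA x).pair _ (sB x)) ((sA x).pair _ (sYB x)),
    dirDeriv_add _ ((sXA x).pair _ (sB x)) ((sA x).pair _ (sXB x)), e hX sYA sB, e hX sA sYB,
    e hY sXA sB, e hY sA sXB] at h0
  have j1 := bracket_jacobi (sX x) (sY x) (sA x)
  have j2 := bracket_jacobi (sX x) (sY x) (sB x)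
  have h1 : G.metric.pair ⟦⟦X, Y⟧, A⟧ B x
      = G.metric.pair ⟦X, ⟦Y, A⟧⟧ B x - G.metric.pair ⟦Y, ⟦X, A⟧⟧ B x := by
    simp only [PseudoMetric.pair]
    rw [j1]
    simp
  have h2 : G.metric.pair A ⟦⟦X, Y⟧, B⟧ x
      = G.metric.pair A ⟦X, ⟦Y, B⟧⟧ x - G.metric.pair A ⟦Y, ⟦X, B⟧⟧ x := by
    simp only [PseudoMetric.pair]
    rw [j2]
    simp
  change dirDeriv (G.metric.pair A B) x (⟦X, Y⟧ x) - G.metric.pair ⟦⟦X, Y⟧, A⟧ B x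
    - G.metric.pair A ⟦⟦X, Y⟧, B⟧ x = 0
  rw [h0, h1, h2]
  ring

theorem pair_expand (hx : x ∈ G.spin.U i) (X Y : ∀ x, TangentSpace (𝓡 (s + t)) x) :
    G.metric.pair X Y x = ∑ l, eta l * (G.metric.pair X (G.frameField i l) x
      * G.metric.pair Y (G.frameField i l) x) := by
  conv_lhs => rw [PseudoMetric.pair, G.frame_expand hx (Y x), map_sum]
  refine Finset.sum_congr rfl fun l _ => ?_
  rw [map_smul, smul_eq_mul]
  simp only [PseudoMetric.pair]
  ring

/-! ### Brackets with `𝔢_α(X)` for a Killing field -/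

section Brackets

variable [T2Space M] {X Y : VF (s + t) M} (hX : IsKilling G.metric X) (α : 𝕜)

include hX

theorem evenGauge_B (hx : x ∈ G.spin.U i) (k l : Fin s ⊕ Fin t) : (G.evenGauge α X).B i x k l
    = G.metric.pair ⟦X, G.frameField i k⟧ (G.frameField i l) x :=
  conn_sub_skewCov hX hx k l

theorem dirDeriv_evenGauge_B (hx : x ∈ G.spin.U i) (k l : Fin s ⊕ Fin t)
    (v : TangentSpace (𝓡 (s + t)) x) : dirDeriv (fun y => (G.evenGauge α X).B i y k l) x v
    = dirDeriv (G.metric.pair ⟦X, G.frameField i k⟧ (G.frameField i l)) x v := by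
  refine dirDeriv_congr _ ?_
  filter_upwards [G.eventually_mem_U hx] with y hy using evenGauge_B hX α hy k l

omit [T2Space M] hX in
theorem eventually_smooth_bracket_frameField (hx : x ∈ G.spin.U i) (k : Fin s ⊕ Fin t) :
    ∀ᶠ y in nhds x, SmoothFieldAt (s + t) ⟦X, G.frameField i k⟧ y := by
  filter_upwards [G.eventually_smooth_frameField hx k] with y hy
  exact SmoothFieldAt.bracket (X.contMDiff y) hy

/-- With both matrices of the form `g([X, e_m], e_p)`, the Killing equation turns their derivatives
into double brackets and products of single brackets. The double brackets combine by the Jacobi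
identity; the products, expanded in the frame by `pair_expand`, cancel the matrix commutator. -/
theorem lie_evenGauge [FiniteDimensional 𝕜 S] (hY : IsKilling G.metric Y) :
    ⁅(G.evenGauge α X).toEnd, (G.evenGauge α Y).toEnd⁆ = (G.evenGauge α (lieBracket X Y)).toEnd := by
  refine GaugeOperator.lie_toEnd _ _ _ (G.evenGauge_c_eq_zero α hX) (G.evenGauge_c_eq_zero α hY)
    (G.evenGauge_c_eq_zero α (isKilling_lieBracket hX hY)) fun i x hx m p => ?_
  have sm := G.smooth_frameField hx m
  rw [dirDeriv_evenGauge_B hY α hx, dirDeriv_evenGauge_B hX α hx,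
    evenGauge_B (isKilling_lieBracket hX hY) α hx,
    hX.dirDeriv_pair _ (eventually_smooth_bracket_frameField hx m)
      (G.eventually_smooth_frameField hx p),
    hY.dirDeriv_pair _ (eventually_smooth_bracket_frameField hx m)
      (G.eventually_smooth_frameField hx p)]
  have j1 := bracket_jacobi (X.contMDiff x) (Y.contMDiff x) sm
  have h1 : G.metric.pair ⟦lieBracket X Y, G.frameField i m⟧ (G.frameField i p) x
      = G.metric.pair ⟦X, ⟦Y, G.frameField i m⟧⟧ (G.frameField i p) x
        - G.metric.pair ⟦Y, ⟦X, G.frameField i m⟧⟧ (G.frameField i p) x := by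
    simp only [PseudoMetric.pair]
    rw [j1]
    simp only [map_add, add_apply, add_sub_cancel_right]
    rfl
  rw [h1, pair_expand hx ⟦Y, G.frameField i m⟧ ⟦X, G.frameField i p⟧,
    pair_expand hx ⟦X, G.frameField i m⟧ ⟦Y, G.frameField i p⟧]
  have e : ∀ l, eta l * ((G.evenGauge α Y).B i x m l * (G.evenGauge α X).B i x l p
      - (G.evenGauge α X).B i x m l * (G.evenGauge α Y).B i x l p)
      = eta l * (G.metric.pair ⟦X, G.frameField i m⟧ (G.frameField i l) x
      * G.metric.pair ⟦Y, G.frameField i p⟧ (G.frameField i l) x)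
      - eta l * (G.metric.pair ⟦Y, G.frameField i m⟧ (G.frameField i l) x
      * G.metric.pair ⟦X, G.frameField i p⟧ (G.frameField i l) x) := by
    intro l
    rw [(G.evenGauge α X).antisymm i x hx l p, (G.evenGauge α Y).antisymm i x hx l p,
      evenGauge_B hX α hx, evenGauge_B hX α hx, evenGauge_B hY α hx, evenGauge_B hY α hx]
    ring
  simp only [e, Finset.sum_sub_distrib]
  ring

/-- Only `X` has to be Killing. Naturality of the Koszul expression (`dirDeriv_koszul`)
differentiates the connection form along `X`. Expanding `[X, e_m]` and `[X, e_p]` in the frame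
yields the matrix commutator, and the derivative term from the middle slot cancels the derivative of
the matrix of `X`. -/
theorem lie_evenGauge_nablaOp [FiniteDimensional 𝕜 S] (Y : VF (s + t) M) :
    ⁅(G.evenGauge α X).toEnd, (G.nablaOp Y).toEnd⁆ = (G.nablaOp (lieBracket X Y)).toEnd := by
  refine GaugeOperator.lie_toEnd _ _ _ (G.evenGauge_c_eq_zero α hX) rfl rfl fun i x hx m p => ?_
  have sm := G.smooth_frameField hx m
  have sp := G.smooth_frameField hx p
  have sY : SmoothFieldAt (s + t) Y x := Y.contMDiff x
  have sXm := (eventually_smooth_bracket_frameField (X := X) hx m).self_of_nhds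
  have sXp := (eventually_smooth_bracket_frameField (X := X) hx p).self_of_nhds
  rw [dirDeriv_evenGauge_B hX α hx]
  have h1 : dirDeriv (fun y => (G.nablaOp Y).B i y m p) x (X x) = 1 / 2 *
      (koszul G.metric ⟦X, Y⟧ (G.frameField i m) (G.frameField i p) x
      + koszul G.metric Y ⟦X, G.frameField i m⟧ (G.frameField i p) x
      + koszul G.metric Y (G.frameField i m) ⟦X, G.frameField i p⟧ x) := by
    rw [← hX.dirDeriv_koszul _ (.of_forall Y.contMDiff) (G.eventually_smooth_frameField hx m)
      (G.eventually_smooth_frameField hx p)]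
    change dirDeriv (fun y => 1 / 2 * koszul G.metric Y (G.frameField i m) (G.frameField i p) y) x _
      = _
    rw [dirDeriv_mul _ contMDiffAt_const (SmoothFieldAt.koszul _ sY sm sp), dirDeriv_const]
    ring
  have h2 := G.koszul_expand_mid hx sY sXm sp
  have h3 := G.koszul_expand_right hx sY sm sXp
  rw [Finset.sum_add_distrib, ← Finset.mul_sum, Finset.sum_eq_single (a := p)
    (f := fun l => eta l * dirDeriv (G.metric.pair ⟦X, G.frameField i m⟧ (G.frameField i l)) x (Y x)
      * G.metric.pair (G.frameField i l) (G.frameField i p) x)] at h2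
  rotate_left
  · intro l _ hl
    rw [G.pair_frameField hx, if_neg hl, mul_zero]
  · simp
  rw [G.pair_frameField hx, if_pos rfl] at h2
  have e1 : ∀ l, eta l * ((G.nablaOp Y).B i x m l * (G.evenGauge α X).B i x l p
      - (G.evenGauge α X).B i x m l * (G.nablaOp Y).B i x l p)
      = -(1 / 2 * (eta l * G.metric.pair ⟦X, G.frameField i p⟧ (G.frameField i l) x
          * koszul G.metric Y (G.frameField i m) (G.frameField i l) x))
        - 1 / 2 * (eta l * G.metric.pair ⟦X, G.frameField i m⟧ (G.frameField i l) x
          * koszul G.metric Y (G.frameField i l) (G.frameField i p) x) := by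
    intro l
    rw [(G.evenGauge α X).antisymm i x hx l p, evenGauge_B hX α hx, evenGauge_B hX α hx]
    simp only [nablaOp, conn]
    ring
  simp only [e1, Finset.sum_sub_distrib, Finset.sum_neg_distrib, ← Finset.mul_sum]
  rw [← h3, h1, h2]
  change 1 / 2 * koszul G.metric ⟦X, Y⟧ (G.frameField i m) (G.frameField i p) x = _
  linear_combination -dirDeriv (G.metric.pair ⟦X, G.frameField i m⟧ (G.frameField i p)) x (Y x)
    * eta_mul_self p

end Brackets

/-! ### Contraction with spinor fields -/

section Interior

variable [FiniteDimensional 𝕜 S] (G)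

omit [FiniteDimensional 𝕜 S] in
-- Invariance of the form under the spin group makes contraction independent of the frame.
theorem superLocal_interior (φ : M → S) (f : M → ExteriorAlgebra 𝕜 S) (x : M) :
    G.superLocal i (G.interior φ f) x
      = CliffordAlgebra.contractLeft (G.fibre.charge (G.spinorLocal i φ x)) (G.superLocal i f x) := by
  rw [superLocal, superLocal, interior, spinorLocal]
  set g := G.fibre.act (G.spin.trans i (G.idx x) x) with hg
  have h : G.fibre.charge (φ x) = G.fibre.charge (g (φ x)) ∘ₗ g := by
    ext ψ
    exact (G.fibre.charge_act _ _ _).symm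
  rw [h]
  exact map_contractLeft g _ _

variable {G}

theorem hasWDeriv_interior {Φ : M → S} {Φ' : S} {F : M → ExteriorAlgebra 𝕜 S}
    {F' : ExteriorAlgebra 𝕜 S} {v : TangentSpace (𝓡 (s + t)) x}
    (hΦ : HasWDeriv (s + t) 𝕜 Φ Φ' v) (hF : HasWDeriv (s + t) 𝕜 F F' v) :
    HasWDeriv (s + t) 𝕜
      (fun y => (CliffordAlgebra.contractLeft (G.fibre.charge (Φ y)) (F y) : ExteriorAlgebra 𝕜 S))
      (CliffordAlgebra.contractLeft (G.fibre.charge Φ') (F x)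
        + CliffordAlgebra.contractLeft (G.fibre.charge (Φ x)) F') v :=
  (hΦ.clm G.fibre.charge).contractLeft hF

theorem interior_mem (φ : G.SpinorField) (f : G.superFunctions) :
    G.interior φ.1 f.1 ∈ G.superFunctions := by
  refine mem_superFunctions fun i x hx => ?_
  obtain ⟨Φ', hΦ⟩ := (smooth_spinorLocal φ hx).exists_hasWDeriv 0
  exact (hasWDeriv_interior hΦ ((smooth_superLocal f hx).vderiv 0)).wsmooth.congr
    (.of_forall fun y => G.superLocal_interior φ.1 f.1 y)

/-- Interior multiplication as an endomorphism of the algebra of functions. -/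
def interiorEnd (φ : G.SpinorField) : Module.End 𝕜 G.superFunctions where
  toFun f := ⟨G.interior φ.1 f.1, interior_mem φ f⟩
  map_add' f f' := Subtype.ext (funext fun x => map_add
    (CliffordAlgebra.contractLeft (G.fibre.charge (φ.1 x))) (f.1 x) (f'.1 x))
  map_smul' c f := Subtype.ext (funext fun x => map_smul
    (CliffordAlgebra.contractLeft (G.fibre.charge (φ.1 x))) c (f.1 x))

theorem interiorEnd_mem (φ : G.SpinorField) : interiorEnd φ ∈ G.derivations 1 := by
  intro q f hf
  have hs : ∀ q : ZMod 2, superSign (1 + q) 1 = -superSign q 1 ∧ superSign 1 q = superSign q 1 := by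
    decide
  refine ⟨fun x => ?_, fun f' => ?_⟩
  · change CliffordAlgebra.contractLeft (G.fibre.charge (φ.1 x)) (f.1 x) ∈ _
    rw [mem_parity_iff, involute_contractLeft, mem_parity_iff.1 (hf x), map_zsmul, (hs q).1, neg_smul]
  · apply Subtype.ext
    funext x
    change CliffordAlgebra.contractLeft (G.fibre.charge (φ.1 x)) (f.1 x * f'.1 x) = _
    rw [contractLeft_mul, mem_parity_iff.1 (hf x), (hs q).2, smul_mul_assoc]
    rfl

namespace GaugeOperator

variable {X : VF (s + t) M} (L : G.GaugeOperator X)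

/-- A spinor field as a function on the graded manifold. -/
def _root_.SuperKilling.SpecialGradedManifold.spinorFunction (φ : G.SpinorField) :
    G.superFunctions :=
  ⟨fun x => ExteriorAlgebra.ι 𝕜 (φ.1 x), mem_superFunctions fun i x hx ℓ => by
    have h := smooth_spinorLocal φ hx (ℓ ∘ₗ ExteriorAlgebra.ι 𝕜)
    refine h.congr_of_eventuallyEq (.of_forall fun y => ?_)
    simp [superLocal, spinorLocal]⟩

theorem _root_.SuperKilling.SpecialGradedManifold.superLocal_spinorFunction (φ : G.SpinorField)
    (x : M) : G.superLocal i (spinorFunction φ).1 x = ExteriorAlgebra.ι 𝕜 (G.spinorLocal i φ.1 x) := by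
  simp [superLocal, spinorLocal, spinorFunction]

/-- The operator keeps degree one, which lets `spinorOp` read its action on spinor fields off the
exterior algebra by `ιInv`. -/
theorem loc_spinorFunction (hc : L.c = 0) (φ : G.SpinorField) {Φ' : S}
    (hΦ : HasWDeriv (s + t) 𝕜 (G.spinorLocal i φ.1) Φ' (X x)) :
    L.loc i (G.superLocal i (spinorFunction φ).1) x
      = ExteriorAlgebra.ι 𝕜 (Φ' + L.spin i x (G.spinorLocal i φ.1 x)) := by
  have h := (hΦ.clm (ExteriorAlgebra.ι 𝕜)).congr
    (.of_forall fun y => superLocal_spinorFunction φ y)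
  rw [L.loc_eq, h.vderiv_eq, superLocal_spinorFunction, derivExt_ι, hc]
  simp

/-- The action on spinor fields. -/
def spinorOp (hc : L.c = 0) (φ : G.SpinorField) : G.SpinorField :=
  ⟨fun x => ExteriorAlgebra.ιInv (L.op (spinorFunction φ).1 x), fun i ℓ => by
    intro x hx
    refine ContMDiffAt.contMDiffWithinAt ?_
    have h := smooth_superLocal ⟨_, L.op_mem (spinorFunction φ)⟩ hx (ℓ ∘ₗ ExteriorAlgebra.ιInv)
    refine h.congr_of_eventuallyEq (.of_forall fun y => ?_)
    obtain ⟨Φ', hΦ⟩ := (smooth_spinorLocal φ (G.mem_idx y)).exists_hasWDeriv (X y)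
    have h1 : L.op (spinorFunction φ).1 y = _ := L.loc_spinorFunction hc φ hΦ
    simp only [superLocal, spinorLocal, h1, LinearMap.comp_apply, ExteriorAlgebra.map_apply_ι,
      ExteriorAlgebra.ι_leftInverse _]⟩

/-- The product rule differentiates `φ`. For the endomorphism part, the dual action of a skew matrix
on `C(φ, ·)` is again pairing with its action on `φ`. A degree term would scale the dual with the
opposite sign, hence `c = 0`. -/
theorem lie_interiorEnd (hc : L.c = 0) (φ : G.SpinorField) :
    ⁅L.toEnd, interiorEnd φ⁆ = interiorEnd (L.spinorOp hc φ) := by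
  apply LinearMap.ext
  intro f
  apply Subtype.ext
  funext x
  set i := G.idx x with hi
  have hx : x ∈ G.spin.U i := G.mem_idx x
  obtain ⟨Φ', hΦ⟩ := (smooth_spinorLocal φ hx).exists_hasWDeriv (X x)
  have hF := (smooth_superLocal f hx).vderiv (X x)
  have h0 : (L.spinorOp hc φ).1 x = Φ' + L.spin i x (φ.1 x) := by
    change ExteriorAlgebra.ιInv (L.loc i (G.superLocal i (spinorFunction φ).1) x) = _
    rw [L.loc_spinorFunction hc φ hΦ, ExteriorAlgebra.ι_leftInverse, hi, G.spinorLocal_idx]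
  have h1 : vderiv (G.superLocal i (interiorEnd φ f).1) x (X x) = _ :=
    ((hasWDeriv_interior hΦ hF).congr
      (.of_forall fun y => G.superLocal_interior φ.1 f.1 y)).vderiv_eq
  change L.loc i (G.superLocal i (interiorEnd φ f).1) x
    - CliffordAlgebra.contractLeft (G.fibre.charge (φ.1 x)) (L.loc i (G.superLocal i f.1) x)
    = CliffordAlgebra.contractLeft (G.fibre.charge ((L.spinorOp hc φ).1 x)) (f.1 x)
  have h2 : G.superLocal i (interiorEnd φ f).1 x
    = CliffordAlgebra.contractLeft (G.fibre.charge (φ.1 x)) (f.1 x) := G.superLocal_idx _ x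
  have h3 : G.fibre.charge (φ.1 x) ∘ₗ L.spin i x = -G.fibre.charge (L.spin i x (φ.1 x)) := by
    ext ψ
    simp only [LinearMap.comp_apply, LinearMap.neg_apply]
    rw [GaugeOperator.spin, G.fibre.charge_spinElt (L.antisymm i x hx), neg_neg]
  rw [L.loc_eq, L.loc_eq, h1, h0, h2, derivExt_contractLeft, hc, h3, hi, G.superLocal_idx,
    G.spinorLocal_idx, ← hi]
  simp only [Pi.zero_apply, zero_smul, add_zero, map_add, map_neg, LinearMap.add_apply,
    LinearMap.neg_apply]
  abel

end GaugeOperator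

end Interior

end Lifts

end SpecialGradedManifold

end SuperKilling

end

noncomputable section

namespace SuperKilling

/-! ### Coordinate functions and coordinate vector fields, extended globally -/

section Coordinates

variable {n : ℕ} {M : Type*} [TopologicalSpace M] [ChartedSpace (EuclideanSpace ℝ (Fin n)) M]
  [IsManifold (𝓡 n) ∞ M] {x₀ x : M}

/-- The coordinate vector fields of the chart at `x₀`. -/
def coordField (n : ℕ) {M : Type*} [TopologicalSpace M] [ChartedSpace (EuclideanSpace ℝ (Fin n)) M]
    [IsManifold (𝓡 n) ∞ M] (x₀ : M) (m : Fin n) (x : M) : TangentSpace (𝓡 n) x :=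
  (trivializationAt (EuclideanSpace ℝ (Fin n)) (TangentSpace (𝓡 n)) x₀).symmL ℝ x
    (EuclideanSpace.single m 1)

theorem smooth_coordField (hx : x ∈ (chartAt (EuclideanSpace ℝ (Fin n)) x₀).source) (m : Fin n) :
    SmoothFieldAt n (coordField n x₀ m) x := by
  set e := trivializationAt (EuclideanSpace ℝ (Fin n)) (TangentSpace (𝓡 n) : M → Type _) x₀ with he
  have hx' : x ∈ e.baseSet := by rwa [he, TangentBundle.trivializationAt_baseSet]
  have h : ContMDiffOn (𝓡 n) (𝓡 n).tangent ∞
      (fun y => (⟨y, coordField n x₀ m y⟩ : TangentBundle (𝓡 n) M)) e.baseSet := by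
    rw [e.contMDiffOn_section_baseSet_iff]
    apply (contMDiffOn_const (c := EuclideanSpace.single m (1 : ℝ))).congr
    intro y hy
    change (e ⟨y, e.symmL ℝ y (EuclideanSpace.single m 1)⟩).2 = _
    rw [e.symmL_apply hy, e.apply_mk_symm hy]
  exact h.contMDiffAt (e.open_baseSet.mem_nhds hx')

theorem dirDeriv_chart (hx : x ∈ (chartAt (EuclideanSpace ℝ (Fin n)) x₀).source) (m : Fin n)
    (v : TangentSpace (𝓡 n) x) : dirDeriv (fun y => extChartAt (𝓡 n) x₀ y m) x v
      = (trivializationAt (EuclideanSpace ℝ (Fin n)) (TangentSpace (𝓡 n)) x₀).continuousLinearMapAt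
        ℝ x v m := by
  rw [TangentBundle.continuousLinearMapAt_trivializationAt hx]
  have h1 : MDifferentiableAt (𝓡 n) 𝓘(ℝ, EuclideanSpace ℝ (Fin n)) (extChartAt (𝓡 n) x₀) x :=
    mdifferentiableAt_extChartAt hx
  have h2 := ((EuclideanSpace.proj m : EuclideanSpace ℝ (Fin n) →L[ℝ] ℝ).hasMFDerivAt
    (x := extChartAt (𝓡 n) x₀ x)).comp x h1.hasMFDerivAt
  exact congrArg (fun A => A v) h2.mfderiv

theorem dirDeriv_coordField (hx : x ∈ (chartAt (EuclideanSpace ℝ (Fin n)) x₀).source)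
    (m l : Fin n) : dirDeriv (fun y => extChartAt (𝓡 n) x₀ y m) x (coordField n x₀ l x)
      = if m = l then 1 else 0 := by
  rw [dirDeriv_chart hx, coordField, Trivialization.continuousLinearMapAt_symmL _
    (by rwa [TangentBundle.trivializationAt_baseSet])]
  simp

theorem eq_sum_coordField (hx : x ∈ (chartAt (EuclideanSpace ℝ (Fin n)) x₀).source)
    (v : TangentSpace (𝓡 n) x) :
    v = ∑ m, dirDeriv (fun y => extChartAt (𝓡 n) x₀ y m) x v • coordField n x₀ m x := by
  simp only [dirDeriv_chart hx, coordField]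
  conv_lhs => rw [← Trivialization.symmL_continuousLinearMapAt (R := ℝ)
    (trivializationAt (EuclideanSpace ℝ (Fin n)) (TangentSpace (𝓡 n) : M → Type _) x₀)
    (by rwa [TangentBundle.trivializationAt_baseSet]) v]
  set w := (trivializationAt (EuclideanSpace ℝ (Fin n)) (TangentSpace (𝓡 n)) x₀).continuousLinearMapAt
        ℝ x v with hw
  have h5 : w = ∑ m, w m • EuclideanSpace.single m (1 : ℝ) := by
    ext k
    simp [Finset.sum_apply, Pi.single_apply]
  conv_lhs => rw [h5]
  rw [map_sum]
  simp only [map_smul]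

/-- Global functions and vector fields that are coordinates and coordinate fields on `O`. -/
structure LocalCoordinates (n : ℕ) (M : Type*) [TopologicalSpace M]
    [ChartedSpace (EuclideanSpace ℝ (Fin n)) M] [IsManifold (𝓡 n) ∞ M] (O : Set M) where
  base : M
  y : Fin n → M → ℝ
  X : Fin n → VF n M
  isOpen : IsOpen O
  subset : O ⊆ (chartAt (EuclideanSpace ℝ (Fin n)) base).source
  smooth_y : ∀ m x, SmoothAt n (y m) x
  y_eq : ∀ x ∈ O, ∀ m, y m x = extChartAt (𝓡 n) base x m
  X_eq : ∀ x ∈ O, ∀ m, X m x = coordField n base m x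

namespace LocalCoordinates

variable {O : Set M} (c : LocalCoordinates n M O)

include c in
theorem eventually_mem (hx : x ∈ O) : ∀ᶠ y in nhds x, y ∈ O := c.isOpen.mem_nhds hx

theorem dirDeriv_y (hx : x ∈ O) (m : Fin n) (v : TangentSpace (𝓡 n) x) :
    dirDeriv (c.y m) x v = dirDeriv (fun y => extChartAt (𝓡 n) c.base y m) x v := by
  refine dirDeriv_congr _ ?_
  filter_upwards [c.eventually_mem hx] with y hy using c.y_eq y hy m

theorem dirDeriv_y_X (hx : x ∈ O) (m l : Fin n) :
    dirDeriv (c.y m) x (c.X l x) = if m = l then 1 else 0 := by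
  rw [c.dirDeriv_y hx, c.X_eq x hx, dirDeriv_coordField (c.subset hx)]

theorem eq_sum (hx : x ∈ O) (v : TangentSpace (𝓡 n) x) :
    v = ∑ m, dirDeriv (c.y m) x v • c.X m x := by
  simp only [c.dirDeriv_y hx, c.X_eq x hx]
  exact eq_sum_coordField (c.subset hx) v

theorem hadamard [T2Space M] {𝕜 : Type*} [RCLike 𝕜] (hx : x ∈ O) {f : M → 𝕜}
    (hf : ∀ x, SmoothAt n f x) : ∃ F : Fin n → M → 𝕜, (∀ m z, SmoothAt n (F m) z) ∧
      ∀ᶠ z in nhds x, f z = f x + ∑ m, ((c.y m z - c.y m x : ℝ) : 𝕜) * F m z := by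
  obtain ⟨F, h1, h2⟩ := exists_smooth_eq_add_sum (by
    rw [extChartAt_source]
    exact c.subset hx) (fun x => hf x : ContMDiff (𝓡 n) 𝓘(ℝ, 𝕜) ∞ f)
  refine ⟨F, h1, ?_⟩
  filter_upwards [h2, c.eventually_mem hx] with z hz hO
  rw [hz]
  simp only [c.y_eq z hO, c.y_eq x hx]

end LocalCoordinates

/-- Local coordinates from a bump function. -/
def LocalCoordinates.ofBump (x₀ : M) {U : Set M} (hU : IsOpen U)
    (hUs : U ⊆ (chartAt (EuclideanSpace ℝ (Fin n)) x₀).source) {χ : M → ℝ}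
    (hχ : ContMDiff (𝓡 n) 𝓘(ℝ, ℝ) ∞ χ) (hs : tsupport χ ⊆ U) {O : Set M} (hO : IsOpen O)
    (hOU : O ⊆ U) (h1 : ∀ x ∈ O, χ x = 1) : LocalCoordinates n M O where
  base := x₀
  y m y := χ y * extChartAt (𝓡 n) x₀ y m
  X m := bumpField hχ hU hs (coordField n x₀ m) fun y hy => smooth_coordField (hUs hy) m
  isOpen := hO
  subset := hOU.trans hUs
  smooth_y m := smoothAt_bump_mul (𝕜 := ℝ) hχ hs fun y hy => by
    have h1 : ContMDiffAt (𝓡 n) 𝓘(ℝ, EuclideanSpace ℝ (Fin n)) ∞ (extChartAt (𝓡 n) x₀) y :=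
      contMDiffAt_extChartAt' (hUs hy)
    exact (EuclideanSpace.proj m : EuclideanSpace ℝ (Fin n) →L[ℝ] ℝ).contDiff.contMDiff.contMDiffAt.comp
      y h1
  y_eq x hx m := by rw [h1 x hx, one_mul]
  X_eq x hx m := by
    change χ x • coordField n x₀ m x = _
    rw [h1 x hx, one_smul]

end Coordinates

namespace SpecialGradedManifold

/-! ### Locally constant spinors and supercoordinates -/

section LocalData

variable {s t : ℕ} {𝕜 S M ι : Type*} [RCLike 𝕜] [AddCommGroup S] [Module 𝕜 S]
  [TopologicalSpace M] [ChartedSpace (EuclideanSpace ℝ (Fin (s + t))) M]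
  [IsManifold (𝓡 (s + t)) ∞ M] (G : SpecialGradedManifold s t 𝕜 S M ι)
  {i j : ι} {x : M} {χ : M → ℝ}

/-- A constant spinor in the frame `i`, cut off. -/
def bumpSpinor (χ : M → ℝ) (i : ι) (v : S) (y : M) : S :=
  (χ y : 𝕜) • G.fibre.act (G.spin.trans (G.idx y) i y) v

/-- A constant element of the exterior algebra in the frame `i`, cut off. -/
def bumpSuper (χ : M → ℝ) (i : ι) (v : ExteriorAlgebra 𝕜 S) (y : M) : ExteriorAlgebra 𝕜 S :=
  (χ y : 𝕜) • ExteriorAlgebra.map (G.fibre.act (G.spin.trans (G.idx y) i y)) v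

theorem act_act (hi : x ∈ G.spin.U i) (hj : x ∈ G.spin.U j) (v : S) :
    G.fibre.act (G.spin.trans i (G.idx x) x) (G.fibre.act (G.spin.trans (G.idx x) j x) v)
      = G.fibre.act (G.spin.trans i j x) v := by
  rw [← G.spin.trans_cocycle i (G.idx x) j x ⟨⟨hi, G.mem_idx x⟩, hj⟩, SpinModule.act_mul]
  rfl

theorem spinorLocal_bumpSpinor (hi : x ∈ G.spin.U i) (hj : x ∈ G.spin.U j) (v : S) :
    G.spinorLocal i (G.bumpSpinor χ j v) x = (χ x : 𝕜) • G.fibre.act (G.spin.trans i j x) v := by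
  rw [spinorLocal, bumpSpinor, map_smul, G.act_act hi hj]

theorem superLocal_bumpSuper (hi : x ∈ G.spin.U i) (hj : x ∈ G.spin.U j)
    (v : ExteriorAlgebra 𝕜 S) : G.superLocal i (G.bumpSuper χ j v) x
      = (χ x : 𝕜) • ExteriorAlgebra.map (G.fibre.act (G.spin.trans i j x)) v := by
  rw [superLocal, bumpSuper, map_smul]
  congr 1
  have h : G.fibre.act (G.spin.trans i j x)
      = G.fibre.act (G.spin.trans i (G.idx x) x) ∘ₗ G.fibre.act (G.spin.trans (G.idx x) j x) :=
    LinearMap.ext fun w => (G.act_act hi hj w).symm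
  rw [h, ← ExteriorAlgebra.map_comp_map]
  rfl

variable (hχ : ContMDiff (𝓡 (s + t)) 𝓘(ℝ, ℝ) ∞ χ) (hs : tsupport χ ⊆ G.spin.U j)
  [FiniteDimensional 𝕜 S]

/-- `bumpSpinor` as a smooth section. -/
def bumpSpinorField (v : S) : G.SpinorField :=
  ⟨G.bumpSpinor χ j v, fun i ℓ x hi => by
    refine ContMDiffAt.contMDiffWithinAt ?_
    by_cases hx : x ∈ tsupport χ
    -- Only smoothness of the transition function on the fibre is wanted; the covariant derivative
    -- along the zero field serves as an arbitrary gauge operator.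
    · obtain ⟨T, A', h1, -, -⟩ := (G.nablaOp 0).spin_trans hi (hs hx)
      have h2 := (h1.clm (LinearMap.applyₗ v)).smul (SmoothAt.ofReal (𝕜 := 𝕜) hχ.contMDiffAt)
      refine (h2 ℓ).1.congr_of_eventuallyEq ?_
      filter_upwards [G.eventually_mem_U hi, G.eventually_mem_U (hs hx)] with y yi yj
      rw [G.spinorLocal_bumpSpinor yi yj]
      rfl
    · refine (contMDiffAt_const (c := (0 : 𝕜))).congr_of_eventuallyEq ?_
      filter_upwards [(isClosed_tsupport χ).isOpen_compl.mem_nhds hx] with y hy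
      rw [spinorLocal, bumpSpinor, image_eq_zero_of_notMem_tsupport hy]
      simp⟩

/-- `bumpSuper` as a smooth section. -/
def bumpSuperFunction (v : ExteriorAlgebra 𝕜 S) : G.superFunctions :=
  ⟨G.bumpSuper χ j v, mem_superFunctions fun i x hi => by
    by_cases hx : x ∈ tsupport χ
    · obtain ⟨T, A', h1, h2, -⟩ := (G.nablaOp 0).spin_trans hi (hs hx)
      have h2 := (h1.map_apply h2 v).smul (SmoothAt.ofReal (𝕜 := 𝕜) hχ.contMDiffAt)
      refine h2.wsmooth.congr ?_
      filter_upwards [G.eventually_mem_U hi, G.eventually_mem_U (hs hx)] with y yi yj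
      exact G.superLocal_bumpSuper yi yj v
    · refine (hasWDeriv_const (v := (0 : TangentSpace (𝓡 (s + t)) x))
        (0 : ExteriorAlgebra 𝕜 S)).wsmooth.congr ?_
      filter_upwards [(isClosed_tsupport χ).isOpen_compl.mem_nhds hx] with y hy
      rw [superLocal, bumpSuper, image_eq_zero_of_notMem_tsupport hy]
      simp⟩

/-- Coordinates, spinor fields and functions on the graded manifold that are constant on `O` in the
frame `i`. -/
structure SuperCoordinates (O : Set M) extends LocalCoordinates (s + t) M O where
  i : ι
  subset_U : O ⊆ G.spin.U i
  spinor : S → G.SpinorField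
  super : ExteriorAlgebra 𝕜 S → G.superFunctions
  spinor_eq : ∀ x ∈ O, ∀ v, G.spinorLocal i (spinor v).1 x = v
  super_eq : ∀ x ∈ O, ∀ v, G.superLocal i (super v).1 x = v
  super_parity : ∀ p, ∀ v ∈ parity 𝕜 S p, ∀ x, (super v).1 x ∈ parity 𝕜 S p

theorem exists_superCoordinates [T2Space M] (x₀ : M) : ∃ O : Set M, x₀ ∈ O ∧
    ∃ c : G.SuperCoordinates O, c.i = G.idx x₀ := by
  have hU : IsOpen (G.spin.U (G.idx x₀) ∩
      (chartAt (EuclideanSpace ℝ (Fin (s + t))) x₀).source) :=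
    (G.spin.isOpen_U _).inter (chartAt (EuclideanSpace ℝ (Fin (s + t))) x₀).open_source
  have hx : x₀ ∈ G.spin.U (G.idx x₀) ∩ (chartAt (EuclideanSpace ℝ (Fin (s + t))) x₀).source :=
    ⟨G.mem_idx x₀, mem_chart_source _ x₀⟩
  obtain ⟨χ, hχ, h1, hs⟩ := exists_bump (n := s + t) hU hx
  obtain ⟨O, hO, hOo, hxO⟩ := eventually_nhds_iff.1 h1
  have hs' : tsupport χ ⊆ G.spin.U (G.idx x₀) := hs.trans Set.inter_subset_left
  have hOU : O ⊆ G.spin.U (G.idx x₀) ∩ (chartAt (EuclideanSpace ℝ (Fin (s + t))) x₀).source := by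
    intro y hy
    refine hs (subset_tsupport χ ?_)
    rw [Function.mem_support, hO y hy]
    exact one_ne_zero
  refine ⟨O, hxO, ⟨LocalCoordinates.ofBump x₀ hU Set.inter_subset_right hχ hs hOo hOU hO,
    G.idx x₀, hOU.trans Set.inter_subset_left, G.bumpSpinorField hχ hs', G.bumpSuperFunction hχ hs',
    fun x hx v => ?_, fun x hx v => ?_, fun p v hv x => ?_⟩, rfl⟩
  · have hxU := (hOU hx).1
    change G.spinorLocal _ (G.bumpSpinor χ _ v) x = v
    rw [G.spinorLocal_bumpSpinor hxU hxU, hO x hx, G.trans_self hxU, SpinModule.act_one]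
    simp
  · have hxU := (hOU hx).1
    change G.superLocal _ (G.bumpSuper χ _ v) x = v
    rw [G.superLocal_bumpSuper hxU hxU, hO x hx, G.trans_self hxU, SpinModule.act_one]
    change ((1 : ℝ) : 𝕜) • ExteriorAlgebra.map LinearMap.id v = v
    rw [ExteriorAlgebra.map_id]
    simp
  · change (χ x : 𝕜) • ExteriorAlgebra.map _ v ∈ parity 𝕜 S p
    refine Submodule.smul_mem _ _ ?_
    rw [mem_parity_iff, involute_map, mem_parity_iff.1 hv, map_zsmul]

end LocalData

/-! ### Superderivations are local and determined by the coordinates -/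

section Locality

variable {s t : ℕ} {𝕜 S M ι : Type*} [RCLike 𝕜] [AddCommGroup S] [Module 𝕜 S]
  [TopologicalSpace M] [ChartedSpace (EuclideanSpace ℝ (Fin (s + t))) M]
  [IsManifold (𝓡 (s + t)) ∞ M] {G : SpecialGradedManifold s t 𝕜 S M ι}
  {i j : ι} {x : M}

theorem algebraMap_mem_parity (a : 𝕜) : algebraMap 𝕜 (ExteriorAlgebra 𝕜 S) a ∈ parity 𝕜 S 0 := by
  rw [mem_parity_iff, AlgHom.commutes]
  simp [superSign]

theorem ι_mem_parity (v : S) : ExteriorAlgebra.ι 𝕜 v ∈ parity 𝕜 S 1 := by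
  rw [mem_parity_iff]
  change CliffordAlgebra.involute (CliffordAlgebra.ι _ v) = _
  rw [CliffordAlgebra.involute_ι]
  simp [superSign, ExteriorAlgebra.ι]

theorem superSign_zero_right (p : ZMod 2) : superSign p 0 = 1 := by simp [superSign]

theorem eq_of_superLocal {f f' : M → ExteriorAlgebra 𝕜 S} (hi : x ∈ G.spin.U i)
    (h : G.superLocal i f x = G.superLocal i f' x) : f x = f' x := by
  rw [← G.superLocal_idx f x, ← G.superLocal_idx f' x, G.superLocal_trans (G.mem_idx x) hi, h,
    ← G.superLocal_trans (G.mem_idx x) hi]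

variable [FiniteDimensional 𝕜 S]

variable (G) in
/-- A scalar function as a function on the graded manifold. -/
def scalar (a : M → 𝕜) (ha : ∀ x, SmoothAt (s + t) a x) : G.superFunctions :=
  ⟨fun x => algebraMap 𝕜 _ (a x), mem_superFunctions fun i x hx ℓ => by
    have h := (HasWDeriv.smul_const (v := (0 : TangentSpace (𝓡 (s + t)) x)) (ha x)
      (1 : ExteriorAlgebra 𝕜 S) ℓ).1
    refine h.congr_of_eventuallyEq (.of_forall fun y => ?_)
    simp [superLocal, Algebra.algebraMap_eq_smul_one]⟩

theorem superLocal_scalar (a : M → 𝕜) (ha : ∀ x, SmoothAt (s + t) a x) (x : M) :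
    G.superLocal i (G.scalar a ha).1 x = algebraMap 𝕜 _ (a x) := by
  simp [superLocal, scalar]

theorem derivation_mul_even {p : ZMod 2} {V : Module.End 𝕜 G.superFunctions}
    (hV : V ∈ G.derivations p) {f : G.superFunctions} (hf : ∀ x, f.1 x ∈ parity 𝕜 S 0)
    (f' : G.superFunctions) : V (f * f') = V f * f' + f * V f' := by
  rw [(hV 0 f hf).2 f', superSign_zero_right, one_smul]

theorem derivation_one {p : ZMod 2} {V : Module.End 𝕜 G.superFunctions}
    (hV : V ∈ G.derivations p) : V 1 = 0 := by
  have h := derivation_mul_even hV (f := 1) (fun x => by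
    simpa using algebraMap_mem_parity (S := S) (1 : 𝕜)) 1
  simpa using h

theorem sum_apply' {J : Type*} (A : Finset J) (F : J → G.superFunctions) (x : M) :
    (∑ k ∈ A, F k : G.superFunctions).1 x = ∑ k ∈ A, (F k).1 x := by
  rw [AddSubmonoidClass.coe_finsetSum, Finset.sum_apply]

theorem superLocal_sum {J : Type*} (A : Finset J) (F : J → G.superFunctions) (x : M) :
    G.superLocal i (∑ k ∈ A, F k : G.superFunctions).1 x = ∑ k ∈ A, G.superLocal i (F k).1 x := by
  rw [superLocal, sum_apply', map_sum]
  rfl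

variable [T2Space M]

/-- Derivations are local. -/
theorem derivation_eq_zero_of_eventually {p : ZMod 2} {V : Module.End 𝕜 G.superFunctions}
    (hV : V ∈ G.derivations p) {f : G.superFunctions} (hf : ∀ᶠ y in nhds x, f.1 y = 0) :
    (V f).1 x = 0 := by
  obtain ⟨U, hU, hUo, hx⟩ := eventually_nhds_iff.1 hf
  obtain ⟨χ, hχ, h1, hs⟩ := exists_bump (n := s + t) hUo hx
  -- A cut-off supported where `f` vanishes and equal to one at `x` annihilates `f`; the Leibniz
  -- rule for this zero product leaves the value of `V f` at `x`.
  have h0 : G.scalar (fun y => (χ y : 𝕜)) (fun x => SmoothAt.ofReal hχ.contMDiffAt) * f = 0 := by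
    apply Subtype.ext
    funext y
    change algebraMap 𝕜 _ (χ y : 𝕜) * f.1 y = 0
    by_cases hy : y ∈ U
    · rw [hU y hy, mul_zero]
    · rw [image_eq_zero_of_notMem_tsupport fun h => hy (hs h)]
      simp
  have h2 := derivation_mul_even hV (f := G.scalar (fun y => (χ y : 𝕜))
    (fun x => SmoothAt.ofReal hχ.contMDiffAt)) (fun x => algebraMap_mem_parity _) f
  rw [h0, map_zero] at h2
  have h3 := congrFun (congrArg Subtype.val h2) x
  change 0 = (V _).1 x * f.1 x + algebraMap 𝕜 _ (χ x : 𝕜) * (V f).1 x at h3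
  rw [hU x hx, h1.self_of_nhds] at h3
  simpa using h3.symm

theorem derivation_congr {p : ZMod 2} {V : Module.End 𝕜 G.superFunctions}
    (hV : V ∈ G.derivations p) {f f' : G.superFunctions} (hf : ∀ᶠ y in nhds x, f.1 y = f'.1 y) :
    (V f).1 x = (V f').1 x := by
  have h := derivation_eq_zero_of_eventually hV (x := x) (f := f - f') (by
    filter_upwards [hf] with y hy
    exact sub_eq_zero.2 hy)
  rw [map_sub] at h
  exact sub_eq_zero.1 h

namespace SuperCoordinates

variable {O : Set M} (c : G.SuperCoordinates O)

/-- The coordinates as functions on the graded manifold. -/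
def coord (m : Fin (s + t)) : G.superFunctions :=
  G.scalar (fun x => (c.y m x : 𝕜)) fun x => (c.smooth_y m x).ofReal

/-- By Hadamard's lemma `a` is a constant plus a combination of functions `y_m - y_m(x)`. At `x`
these vanish and so do their images under `D`, so the Leibniz rule leaves nothing. -/
theorem derivation_scalar_eq_zero {p : ZMod 2} {D : Module.End 𝕜 G.superFunctions}
    (hD : D ∈ G.derivations p) (hx : x ∈ O) (hy : ∀ m, (D (c.coord m)).1 x = 0) (a : M → 𝕜)
    (ha : ∀ x, SmoothAt (s + t) a x) : (D (G.scalar a ha)).1 x = 0 := by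
  obtain ⟨F, hF, h⟩ := c.hadamard hx ha
  have h1 : (D (G.scalar a ha)).1 x = (D (a x • 1 + ∑ m, (c.coord m - (c.y m x : 𝕜) • 1)
      * G.scalar (F m) (hF m))).1 x := by
    refine derivation_congr hD ?_
    filter_upwards [h] with z hz
    change algebraMap 𝕜 _ (a z) = a x • (1 : ExteriorAlgebra 𝕜 S) +
      (∑ m, (c.coord m - (c.y m x : 𝕜) • 1) * G.scalar (F m) (hF m) : G.superFunctions).1 z
    rw [sum_apply', hz, map_add, map_sum,
      Algebra.algebraMap_eq_smul_one (a x)]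
    congr 1
    refine Finset.sum_congr rfl fun m _ => ?_
    change _ = (algebraMap 𝕜 _ (c.y m z : 𝕜) - (c.y m x : 𝕜) • (1 : ExteriorAlgebra 𝕜 S))
      * algebraMap 𝕜 _ (F m z)
    rw [← Algebra.algebraMap_eq_smul_one, ← map_sub, ← map_mul]
    simp
  have hev : ∀ m y, (c.coord m - (c.y m x : 𝕜) • 1 : G.superFunctions).1 y ∈ parity 𝕜 S 0 := by
    intro m y
    refine sub_mem (algebraMap_mem_parity _) (Submodule.smul_mem _ _ ?_)
    simpa using algebraMap_mem_parity (S := S) (1 : 𝕜)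
  rw [h1, map_add, map_smul, derivation_one hD, smul_zero, zero_add, map_sum,
    sum_apply']
  refine Finset.sum_eq_zero fun m _ => ?_
  rw [derivation_mul_even hD (hev m), map_sub, map_smul, derivation_one hD, smul_zero, sub_zero]
  change (D (c.coord m)).1 x * _ + (algebraMap 𝕜 _ (c.y m x : 𝕜)
    - (c.y m x : 𝕜) • (1 : ExteriorAlgebra 𝕜 S)) * _ = 0
  rw [hy, Algebra.algebraMap_eq_smul_one]
  simp

/-- A derivation that kills the coordinates and the constant spinors vanishes. -/
theorem derivation_eq_zero {p : ZMod 2} {D : Module.End 𝕜 G.superFunctions}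
    (hD : D ∈ G.derivations p) (hx : x ∈ O) (hy : ∀ m, (D (c.coord m)).1 x = 0)
    (hψ : ∀ k, (D (c.super (ExteriorAlgebra.ι 𝕜 (Module.finBasis 𝕜 S k)))).1 x = 0)
    (f : G.superFunctions) : (D f).1 x = 0 := by
  have hι : ∀ v, (D (c.super (ExteriorAlgebra.ι 𝕜 v))).1 x = 0 := by
    intro v
    let b := Module.finBasis 𝕜 S
    have h1 : (D (c.super (ExteriorAlgebra.ι 𝕜 v))).1 x
        = (D (∑ k, b.repr v k • c.super (ExteriorAlgebra.ι 𝕜 (b k)))).1 x := by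
      refine derivation_congr hD ?_
      filter_upwards [c.eventually_mem hx] with z hz
      refine eq_of_superLocal (c.subset_U hz) ?_
      rw [c.super_eq z hz, superLocal_sum]
      conv_lhs => rw [← b.sum_repr v, map_sum]
      refine Finset.sum_congr rfl fun k _ => ?_
      refine Eq.trans ?_ (G.superLocal_smul (i := c.i) (b.repr v k) _ z).symm
      rw [c.super_eq z hz, map_smul]
    rw [h1, map_sum, sum_apply']
    refine Finset.sum_eq_zero fun k _ => ?_
    rw [map_smul]
    change b.repr v k • (D _).1 x = 0
    rw [hψ, smul_zero]
  -- Near `x` the assignment `c.super` is an algebra homomorphism, so locality and the Leibniz rule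
  -- extend the vanishing from vectors to the whole exterior algebra.
  have hconst : ∀ v, (D (c.super v)).1 x = 0 := by
    intro v
    induction v using CliffordAlgebra.left_induction with
    | algebraMap r =>
      have h1 : (D (c.super (algebraMap 𝕜 _ r))).1 x = (D (r • 1)).1 x := by
        refine derivation_congr hD ?_
        filter_upwards [c.eventually_mem hx] with z hz
        refine eq_of_superLocal (c.subset_U hz) ?_
        rw [c.super_eq z hz]
        change _ = ExteriorAlgebra.map _ (r • (1 : ExteriorAlgebra 𝕜 S))
        rw [map_smul, map_one, Algebra.algebraMap_eq_smul_one]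
      rw [h1, map_smul, derivation_one hD]
      simp
    | add v w hv hw =>
      have h1 : (D (c.super (v + w))).1 x = (D (c.super v + c.super w)).1 x := by
        refine derivation_congr hD ?_
        filter_upwards [c.eventually_mem hx] with z hz
        refine eq_of_superLocal (c.subset_U hz) ?_
        have e := G.superLocal_add (i := c.i) (c.super v).1 (c.super w).1 z
        rw [c.super_eq z hz]
        refine Eq.trans ?_ e.symm
        rw [c.super_eq z hz, c.super_eq z hz]
      rw [h1, map_add]
      change (D _).1 x + (D _).1 x = 0
      rw [hv, hw, add_zero]
    | ι_mul v w hv =>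
      have h1 : (D (c.super (CliffordAlgebra.ι _ w * v))).1 x
          = (D (c.super (ExteriorAlgebra.ι 𝕜 w) * c.super v)).1 x := by
        refine derivation_congr hD ?_
        filter_upwards [c.eventually_mem hx] with z hz
        refine eq_of_superLocal (c.subset_U hz) ?_
        have e := G.superLocal_mul (i := c.i) (c.super (ExteriorAlgebra.ι 𝕜 w)).1 (c.super v).1 z
        rw [c.super_eq z hz]
        refine Eq.trans ?_ e.symm
        rw [c.super_eq z hz, c.super_eq z hz]
      rw [h1, (hD 1 _ (c.super_parity 1 _ (ι_mem_parity w))).2]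
      change (D _).1 x * _ + superSign p 1 • (_ * (D _).1 x) = 0
      rw [hι, hv]
      simp
  let b := (Module.finBasis 𝕜 S).ExteriorAlgebra
  -- The coefficients of `f` in the constant basis are smooth only on the frame domain; the cut-off
  -- makes them global functions.
  obtain ⟨χ, hχ, h1, hs⟩ := exists_bump (n := s + t) (G.spin.isOpen_U c.i) (c.subset_U hx)
  have ha : ∀ J y, SmoothAt (s + t) (fun y => (χ y : 𝕜) * b.coord J (G.superLocal c.i f.1 y)) y :=
    fun J => smoothAt_bump_mul hχ hs fun y hy => smooth_superLocal f hy (b.coord J)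
  have h2 : (D f).1 x = (D (∑ J, G.scalar _ (ha J) * c.super (b J))).1 x := by
    refine derivation_congr hD ?_
    filter_upwards [c.eventually_mem hx, h1] with z hz hχz
    refine eq_of_superLocal (c.subset_U hz) ?_
    conv_lhs => rw [← b.sum_repr (G.superLocal c.i f.1 z)]
    rw [superLocal_sum]
    refine Finset.sum_congr rfl fun J _ => ?_
    have e := G.superLocal_mul (i := c.i) (G.scalar _ (ha J)).1 (c.super (b J)).1 z
    refine Eq.trans ?_ e.symm
    rw [superLocal_scalar, c.super_eq z hz, hχz]
    simp [Algebra.smul_def]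
  rw [h2, map_sum, sum_apply']
  refine Finset.sum_eq_zero fun J _ => ?_
  rw [derivation_mul_even hD fun y => algebraMap_mem_parity _]
  change (D _).1 x * _ + _ * (D _).1 x = 0
  rw [c.derivation_scalar_eq_zero hD hx hy, hconst]
  simp

end SuperCoordinates

end Locality

end SpecialGradedManifold

end SuperKilling

end

noncomputable section

namespace SuperKilling

/-! ### Supercommutativity of the exterior algebra -/

section SuperCommutative

variable {𝕜 S : Type*} [RCLike 𝕜] [AddCommGroup S] [Module 𝕜 S]

theorem mul_eq_mul_of_involute_eq {b : ExteriorAlgebra 𝕜 S} (hb : CliffordAlgebra.involute b = b)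
    (a : ExteriorAlgebra 𝕜 S) : a * b = b * a := by
  induction a using CliffordAlgebra.left_induction with
  | algebraMap r => exact Algebra.commutes r b
  | add a a' h h' => rw [add_mul, mul_add, h, h']
  | ι_mul a v h =>
    have e := ι_mul_involute v b
    rw [hb] at e
    rw [mul_assoc, h, ← mul_assoc, ← mul_assoc]
    exact congrArg (· * a) e

theorem mul_eq_mul_of_involute_eq_neg {b : ExteriorAlgebra 𝕜 S}
    (hb : CliffordAlgebra.involute b = -b) (a : ExteriorAlgebra 𝕜 S) :
    a * b = b * CliffordAlgebra.involute a := by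
  induction a using CliffordAlgebra.left_induction with
  | algebraMap r => rw [AlgHom.commutes]; exact Algebra.commutes r b
  | add a a' h h' => rw [add_mul, map_add, mul_add, h, h']
  | ι_mul a v h =>
    have e := ι_mul_involute v b
    rw [hb, mul_neg] at e
    rw [mul_assoc, h, map_mul, CliffordAlgebra.involute_ι, ← mul_assoc, ← mul_assoc, mul_neg]
    refine congrArg (· * CliffordAlgebra.involute a) ?_
    rw [neg_eq_iff_eq_neg] at e
    exact e

/-- Supercommutativity of the exterior algebra. -/
theorem mul_comm_parity {p q : ZMod 2} {a b : ExteriorAlgebra 𝕜 S} (ha : a ∈ parity 𝕜 S p)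
    (hb : b ∈ parity 𝕜 S q) : a * b = superSign p q • (b * a) := by
  rw [mem_parity_iff] at ha hb
  have hq : ∀ q : ZMod 2, q = 0 ∨ q = 1 := by decide
  obtain rfl | rfl := hq q
  · rw [mul_eq_mul_of_involute_eq (by simpa [superSign] using hb) a]
    simp [superSign]
  · rw [mul_eq_mul_of_involute_eq_neg (by simpa [superSign] using hb) a, ha, mul_smul_comm]

end SuperCommutative

namespace SpinModule

variable {s t : ℕ} {𝕜 S : Type*} [RCLike 𝕜] [AddCommGroup S] [Module 𝕜 S] [FiniteDimensional 𝕜 S]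
  (σ : SpinModule s t 𝕜 S)

/-- The spinors represent the linear forms. -/
def dualEquiv : S ≃ₗ[𝕜] Module.Dual 𝕜 S :=
  LinearMap.linearEquivOfInjective σ.charge
    (LinearMap.ker_eq_bot.1 (LinearMap.separatingLeft_iff_ker_eq_bot.1 σ.charge_nondegenerate.1))
    (Subspace.dual_finrank_eq (K := 𝕜) (V := S)).symm

theorem charge_dualEquiv_symm (d : Module.Dual 𝕜 S) : σ.charge (σ.dualEquiv.symm d) = d :=
  σ.dualEquiv.apply_symm_apply d

/-- The dual of the chosen basis. -/
def dualBasis (k : Fin (Module.finrank 𝕜 S)) : S :=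
  σ.dualEquiv.symm ((Module.finBasis 𝕜 S).coord k)

theorem eq_sum_dualBasis (φ : S) :
    φ = ∑ k, σ.charge φ (Module.finBasis 𝕜 S k) • σ.dualBasis k := by
  apply σ.dualEquiv.injective
  rw [map_sum]
  refine (Module.finBasis 𝕜 S).ext fun l => ?_
  simp only [map_smul, dualBasis, LinearEquiv.apply_symm_apply, LinearMap.sum_apply,
    LinearMap.smul_apply, Module.Basis.coord_apply, Module.Basis.repr_self, smul_eq_mul,
    Finsupp.single_apply, mul_ite, mul_one, mul_zero, Finset.sum_ite_eq, Finset.mem_univ, if_true]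
  rfl

end SpinModule

namespace SpecialGradedManifold

/-! ### Local expansion of superderivations in lifts -/

section Expansion

variable {s t : ℕ} {𝕜 S M ι : Type*} [RCLike 𝕜] [AddCommGroup S] [Module 𝕜 S]
  [TopologicalSpace M] [ChartedSpace (EuclideanSpace ℝ (Fin (s + t))) M]
  [IsManifold (𝓡 (s + t)) ∞ M] {G : SpecialGradedManifold s t 𝕜 S M ι}
  {i j : ι} {x : M}

theorem charge_spinorLocal (φ ψ : M → S) (x : M) :
    G.fibre.charge (G.spinorLocal i φ x) (G.spinorLocal i ψ x) = G.fibre.charge (φ x) (ψ x) :=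
  G.fibre.charge_act _ _ _

variable [FiniteDimensional 𝕜 S]

theorem derivations_sub_mem {p : ZMod 2} {V W : Module.End 𝕜 G.superFunctions}
    (hV : V ∈ G.derivations p) (hW : W ∈ G.derivations p) : V - W ∈ G.derivations p := by
  have h : V - W = V + (-1 : 𝕜) • W := by
    refine LinearMap.ext fun f => Subtype.ext (funext fun x => ?_)
    change (V f).1 x - (W f).1 x = (V f).1 x + (-1 : 𝕜) • (W f).1 x
    rw [neg_smul, one_smul, sub_eq_add_neg]
  rw [h]
  exact add_mem hV (Submodule.smul_mem _ _ hW)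

/-- Bringing the coefficient `f` to the other side of `g` costs the sign by which the parities `p`
and `q + p` differ in the Leibniz rule. -/
theorem mulLeft_comp_mem {p q : ZMod 2} {f : G.superFunctions} (hf : ∀ x, f.1 x ∈ parity 𝕜 S q)
    {V : Module.End 𝕜 G.superFunctions} (hV : V ∈ G.derivations p) :
    LinearMap.mulLeft 𝕜 f ∘ₗ V ∈ G.derivations (q + p) := by
  intro r g hg
  have hs : ∀ p q r : ZMod 2, superSign (q + p) r = superSign p r * superSign q r := by decide
  refine ⟨fun x => ?_, fun g' => ?_⟩
  · rw [add_assoc]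
    exact SetLike.mul_mem_graded (A := CliffordAlgebra.evenOdd (0 : QuadraticForm 𝕜 S)) (hf x)
      ((hV r g hg).1 x)
  · have hc : f * g = superSign q r • (g * f) := by
      apply Subtype.ext
      funext x
      exact mul_comm_parity (hf x) (hg x)
    simp only [LinearMap.comp_apply, LinearMap.mulLeft_apply]
    rw [(hV r g hg).2 g', mul_add, mul_smul_comm, ← mul_assoc, ← mul_assoc, ← mul_assoc, hc,
      smul_mul_assoc, smul_smul, hs]

theorem nablaOp_apply (X : VF (s + t) M) (f : G.superFunctions) (x : M) :
    ((G.nablaOp X).toEnd f).1 x = G.nabla X f.1 x := by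
  have h : G.spin.trans (G.idx x) (G.idx x) x = 1 := G.trans_self (G.mem_idx x)
  rw [GaugeOperator.toEnd_apply, GaugeOperator.op, GaugeOperator.loc_eq, nabla, superLocal_idx,
    SpinModule.rep_spinImage, connForm_eq]
  change _ + _ + (0 : 𝕜) • _ = _
  rw [zero_smul, add_zero]
  rfl

theorem evenGauge_apply (α : 𝕜) (X : VF (s + t) M) (f : G.superFunctions) (x : M) :
    ((G.evenGauge α X).toEnd f).1 x = G.evenOp α X f.1 x := by
  have hs : spinElt ((G.evenGauge α X).B (G.idx x) x)
      = spinElt (G.conn (G.idx x) X x) - spinElt (G.skewCov (G.idx x) X x) := by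
    change spinElt (fun k l => G.conn (G.idx x) X x k l - G.skewCov (G.idx x) X x k l) = _
    simp only [spinElt_eq, mul_sub, sub_smul, Finset.sum_sub_distrib, smul_sub]
  have hsub : ∀ a b, G.fibre.repCl (a - b) = G.fibre.repCl a - G.fibre.repCl b := by
    intro a b
    rw [eq_sub_iff_add_eq, ← SpinModule.repCl_add, sub_add_cancel]
  rw [GaugeOperator.toEnd_apply, GaugeOperator.op, GaugeOperator.loc_eq, evenOp, nabla,
    superLocal_idx, SpinModule.rep_spinImage, SpinModule.rep_spinImage, connForm_eq, covMatrix_eq,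
    GaugeOperator.spin, hs, hsub, derivExt_sub, derivExt_smul, LinearMap.sub_apply, add_sub_assoc]
  rfl

/-- `∇_X f` is tensorial in `X`. -/
theorem nabla_eq_sum {J : Type*} (A : Finset J) {X : VF (s + t) M} {Y : J → VF (s + t) M}
    {r : J → ℝ} (h : X x = ∑ k ∈ A, r k • Y k x) (f : G.superFunctions) :
    G.nabla X f.1 x = ∑ k ∈ A, (r k : 𝕜) • G.nabla (Y k) f.1 x := by
  have hx := G.mem_idx x
  have hconn : ∀ k l, G.conn (G.idx x) X x k l = ∑ j ∈ A, r j * G.conn (G.idx x) (Y j) x k l := by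
    intro k l
    have e : ∀ Z : VF (s + t) M, G.conn (G.idx x) Z x k l = ∑ m, G.metric.val x (Z x)
        (G.frameField (G.idx x) m x) * (1 / 2 * eta m *
          koszul G.metric (G.frameField (G.idx x) m) (G.frameField (G.idx x) k)
            (G.frameField (G.idx x) l) x) := by
      intro Z
      rw [conn, G.koszul_expand_left hx (Z.contMDiff x) (G.smooth_frameField hx k)
        (G.smooth_frameField hx l), Finset.mul_sum]
      refine Finset.sum_congr rfl fun m _ => ?_
      rw [PseudoMetric.pair]
      ring
    simp only [e, h, map_sum, map_smul, sum_apply, smul_apply, smul_eq_mul, Finset.sum_mul,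
      Finset.mul_sum]
    rw [Finset.sum_comm]
    exact Finset.sum_congr rfl fun j _ => Finset.sum_congr rfl fun m _ => by ring
  have hspin : G.fibre.repCl (spinElt (G.conn (G.idx x) X x))
      = ∑ j ∈ A, (r j : 𝕜) • G.fibre.repCl (spinElt (G.conn (G.idx x) (Y j) x)) := by
    have e1 : spinElt (G.conn (G.idx x) X x)
        = ∑ j ∈ A, r j • spinElt (G.conn (G.idx x) (Y j) x) := by
      simp only [spinElt_eq, hconn, Finset.mul_sum, Finset.sum_smul, Finset.smul_sum]
      conv_rhs => rw [Finset.sum_comm]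
      refine Finset.sum_congr rfl fun k _ => ?_
      conv_rhs => rw [Finset.sum_comm]
      refine Finset.sum_congr rfl fun l _ => Finset.sum_congr rfl fun j _ => ?_
      rw [smul_smul, smul_smul, smul_smul]
      congr 1
      ring
    let L : Cl s t →+ Module.End 𝕜 S := ⟨⟨G.fibre.repCl, by
      simpa using G.fibre.repCl_smul 0 0⟩, G.fibre.repCl_add⟩
    rw [e1]
    refine (map_sum L _ _).trans ?_
    exact Finset.sum_congr rfl fun j _ => G.fibre.repCl_smul _ _
  have hd : G.superDeriv f.1 x (X x) = ∑ j ∈ A, (r j : 𝕜) • G.superDeriv f.1 x (Y j x) := by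
    simp only [superDeriv, h, dirDeriv_sum_vec, dirDeriv_smul_vec, Finset.sum_smul, Finset.smul_sum,
      smul_smul]
    exact Finset.sum_comm
  simp only [nabla, SpinModule.rep_spinImage, connForm_eq, hd, hspin, smul_add,
    Finset.sum_add_distrib]
  congr 1
  change derivExtHom 𝕜 S _ _ = ∑ k ∈ A, _ • derivExtHom 𝕜 S _ _
  simp only [map_sum, map_smul, LinearMap.sum_apply, LinearMap.smul_apply]

/-- Derivations extending endomorphisms kill degree zero, so neither `B` nor `c` is visible on
scalars. -/
theorem toEnd_scalar {X : VF (s + t) M} (L : G.GaugeOperator X) (a : M → 𝕜)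
    (ha : ∀ x, SmoothAt (s + t) a x) (x : M) :
    (L.toEnd (G.scalar a ha)).1 x = algebraMap 𝕜 _ (dirDeriv a x (X x)) := by
  have h1 : HasWDeriv (s + t) 𝕜 (G.superLocal (G.idx x) (G.scalar a ha).1)
      (dirDeriv a x (X x) • (1 : ExteriorAlgebra 𝕜 S)) (X x) := by
    refine (HasWDeriv.smul_const (ha x) _).congr (.of_forall fun y => ?_)
    rw [superLocal_scalar, Algebra.algebraMap_eq_smul_one]
  rw [L.toEnd_apply, GaugeOperator.op, L.loc_eq, h1.vderiv_eq, superLocal_scalar,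
    derivExt_algebraMap, derivExt_algebraMap, Algebra.algebraMap_eq_smul_one]
  simp

theorem nabla_scalar (X : VF (s + t) M) (a : M → 𝕜) (ha : ∀ x, SmoothAt (s + t) a x) (x : M) :
    G.nabla X (G.scalar a ha).1 x = algebraMap 𝕜 _ (dirDeriv a x (X x)) := by
  rw [← nablaOp_apply, toEnd_scalar]

theorem interior_scalar (φ : M → S) (a : M → 𝕜) (ha : ∀ x, SmoothAt (s + t) a x) (x : M) :
    G.interior φ (G.scalar a ha).1 x = 0 :=
  CliffordAlgebra.contractLeft_algebraMap _ _ _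

namespace SuperCoordinates

variable {O : Set M} (c : G.SuperCoordinates O)

/-- The coordinate spinors as functions on the graded manifold. -/
def even (k : Fin (Module.finrank 𝕜 S)) : G.superFunctions :=
  c.super (ExteriorAlgebra.ι 𝕜 (Module.finBasis 𝕜 S k))

/-- The spinor fields dual to the coordinate spinors. -/
def odd (k : Fin (Module.finrank 𝕜 S)) : G.SpinorField := c.spinor (G.fibre.dualBasis k)

theorem interior_odd_even (hx : x ∈ O) (k l : Fin (Module.finrank 𝕜 S)) :
    G.interior (c.odd k).1 (c.even l).1 x
      = algebraMap 𝕜 _ (if k = l then (1 : 𝕜) else 0) := by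
  have h : G.superLocal c.i (G.interior (c.odd k).1 (c.even l).1) x
      = G.superLocal c.i (fun _ => algebraMap 𝕜 _ (if k = l then (1 : 𝕜) else 0)) x := by
    rw [superLocal_interior, odd, even, c.spinor_eq x hx, c.super_eq x hx, SpinModule.dualBasis,
      SpinModule.charge_dualEquiv_symm]
    refine (CliffordAlgebra.contractLeft_ι _ _ _).trans ?_
    rw [superLocal, AlgHom.commutes, Module.Basis.coord_apply, Module.Basis.repr_self,
      Finsupp.single_apply]
    simp only [eq_comm]
  exact eq_of_superLocal (c.subset_U hx) h

/-- The even components of an operator. -/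
def coeffEven (V : Module.End 𝕜 G.superFunctions) (m : Fin (s + t)) : G.superFunctions :=
  V (c.coord m)

/-- The odd components of an operator. -/
def coeffOdd (V : Module.End 𝕜 G.superFunctions) (k : Fin (Module.finrank 𝕜 S)) :
    G.superFunctions :=
  V (c.even k) - ∑ m, c.coeffEven V m * (G.nablaOp (c.X m)).toEnd (c.even k)

theorem coeffEven_mem {p : ZMod 2} {V : Module.End 𝕜 G.superFunctions} (hV : V ∈ G.derivations p)
    (m : Fin (s + t)) (x : M) : (c.coeffEven V m).1 x ∈ parity 𝕜 S p := by
  have := (hV 0 (c.coord m) fun y => algebraMap_mem_parity _).1 x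
  rwa [add_zero] at this

theorem coeffOdd_mem {p : ZMod 2} {V : Module.End 𝕜 G.superFunctions} (hV : V ∈ G.derivations p)
    (k : Fin (Module.finrank 𝕜 S)) (x : M) : (c.coeffOdd V k).1 x ∈ parity 𝕜 S (p + 1) := by
  have hk := c.super_parity 1 _ (ι_mem_parity (Module.finBasis 𝕜 S k))
  refine sub_mem ((hV 1 _ hk).1 x) ?_
  rw [sum_apply']
  refine sum_mem fun m _ => ?_
  have h2 := ((G.nablaOp (c.X m)).toEnd_mem 1 _ hk).1 x
  rw [zero_add] at h2
  exact SetLike.mul_mem_graded (A := CliffordAlgebra.evenOdd (0 : QuadraticForm 𝕜 S))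
    (c.coeffEven_mem hV m x) h2

/-- The remainder in the expansion of a derivation. -/
def remainder (V : Module.End 𝕜 G.superFunctions) : Module.End 𝕜 G.superFunctions :=
  V - ∑ m, LinearMap.mulLeft 𝕜 (c.coeffEven V m) ∘ₗ (G.nablaOp (c.X m)).toEnd
    - ∑ k, LinearMap.mulLeft 𝕜 (c.coeffOdd V k) ∘ₗ interiorEnd (c.odd k)

theorem remainder_mem {p : ZMod 2} {V : Module.End 𝕜 G.superFunctions} (hV : V ∈ G.derivations p) :
    c.remainder V ∈ G.derivations p := by
  refine derivations_sub_mem (derivations_sub_mem hV (sum_mem fun m _ => ?_)) (sum_mem fun k _ => ?_)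
  · have := mulLeft_comp_mem (c.coeffEven_mem hV m) (G.nablaOp (c.X m)).toEnd_mem
    rwa [add_zero] at this
  · have := mulLeft_comp_mem (c.coeffOdd_mem hV k) (interiorEnd_mem (c.odd k))
    rwa [add_assoc, show (1 : ZMod 2) + 1 = 0 from rfl, add_zero] at this

theorem remainder_apply (V : Module.End 𝕜 G.superFunctions) (f : G.superFunctions) (x : M) :
    (c.remainder V f).1 x = (V f).1 x - ∑ m, (c.coeffEven V m).1 x * G.nabla (c.X m) f.1 x
      - ∑ k, (c.coeffOdd V k).1 x * G.interior (c.odd k).1 f.1 x := by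
  have h : c.remainder V f = V f - ∑ m, c.coeffEven V m * (G.nablaOp (c.X m)).toEnd f
      - ∑ k, c.coeffOdd V k * interiorEnd (c.odd k) f := by
    simp [remainder, LinearMap.sum_apply]
  rw [h]
  change (V f).1 x - (∑ m, _ : G.superFunctions).1 x - (∑ k, _ : G.superFunctions).1 x = _
  rw [sum_apply', sum_apply']
  simp only [← nablaOp_apply]
  rfl

variable [T2Space M]

/-- The even coefficients are fitted on coordinates, which contractions do not see. The odd ones are
fitted on coordinate spinors after subtracting the covariant part, using the dual spinors. The
remainder therefore kills both kinds of generators. -/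
theorem remainder_eq_zero {p : ZMod 2} {V : Module.End 𝕜 G.superFunctions}
    (hV : V ∈ G.derivations p) (hx : x ∈ O) (f : G.superFunctions) : (c.remainder V f).1 x = 0 := by
  refine c.derivation_eq_zero (c.remainder_mem hV) hx (fun m => ?_) (fun k => ?_) f
  · rw [remainder_apply, Finset.sum_eq_single m]
    · rw [coord, nabla_scalar]
      simp only [interior_scalar, mul_zero, Finset.sum_const_zero]
      have h := dirDeriv_clm (c.X m x) (RCLike.ofRealCLM (K := 𝕜)) (c.smooth_y m x)
      have h2 : dirDeriv (fun y => (c.y m y : 𝕜)) x (c.X m x) = 1 := by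
        refine h.trans ?_
        rw [c.dirDeriv_y_X hx, if_pos rfl]
        simp
      rw [h2, map_one, mul_one]
      simp [coeffEven, coord]
    · intro l _ hl
      have h := dirDeriv_clm (c.X l x) (RCLike.ofRealCLM (K := 𝕜)) (c.smooth_y m x)
      have h2 : dirDeriv (fun y => (c.y m y : 𝕜)) x (c.X l x) = 0 := by
        refine h.trans ?_
        rw [c.dirDeriv_y_X hx, if_neg (Ne.symm hl)]
        simp
      rw [coord, nabla_scalar, h2, map_zero, mul_zero]
    · simp
  · change (c.remainder V (c.even k)).1 x = 0
    rw [remainder_apply, Finset.sum_eq_single (a := k) (f := fun l => (c.coeffOdd V l).1 x *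
      G.interior (c.odd l).1 (c.even k).1 x)]
    · rw [c.interior_odd_even hx, if_pos rfl, map_one, mul_one, coeffOdd]
      change _ - _ - ((V (c.even k)).1 x - (∑ m, _ : G.superFunctions).1 x) = 0
      rw [sum_apply']
      simp only [← nablaOp_apply]
      exact sub_self _
    · intro l _ hl
      rw [c.interior_odd_even hx, if_neg hl, map_zero, mul_zero]
    · simp

end SuperCoordinates

/-- An expression of an operator at `x` by covariant derivatives and interior products. -/
def Expands {I J : Type*} [Fintype I] [Fintype J] (V : Module.End 𝕜 G.superFunctions) (x : M)
    (a : I → ExteriorAlgebra 𝕜 S) (X : I → VF (s + t) M) (b : J → ExteriorAlgebra 𝕜 S)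
    (φ : J → G.SpinorField) : Prop :=
  ∀ f : G.superFunctions, (V f).1 x
    = ∑ k, a k * G.nabla (X k) f.1 x + ∑ k, b k * G.interior (φ k).1 f.1 x

theorem SuperCoordinates.expands [T2Space M] {O : Set M} (c : G.SuperCoordinates O) (V : G.Field)
    (hx : x ∈ O) : Expands V.1 x (fun m => (c.coeffEven V.1 m).1 x) c.X
      (fun k => (c.coeffOdd V.1 k).1 x) c.odd := by
  intro f
  obtain ⟨V, hV⟩ := V
  obtain ⟨V₀, h₀, V₁, h₁, rfl⟩ := Submodule.mem_sup.1 hV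
  have hadd : c.remainder (V₀ + V₁) = c.remainder V₀ + c.remainder V₁ := by
    apply LinearMap.ext
    intro f
    simp only [remainder, coeffOdd, coeffEven, LinearMap.sub_apply, LinearMap.add_apply,
      LinearMap.sum_apply, LinearMap.comp_apply, LinearMap.mulLeft_apply, add_mul, sub_mul,
      Finset.sum_add_distrib, Finset.sum_sub_distrib]
    abel
  have h2 : (c.remainder (V₀ + V₁) f).1 x = 0 := by
    rw [hadd]
    change (c.remainder V₀ f).1 x + (c.remainder V₁ f).1 x = 0
    rw [c.remainder_eq_zero h₀ hx, c.remainder_eq_zero h₁ hx, add_zero]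
  rw [c.remainder_apply] at h2
  rw [sub_sub, sub_eq_zero] at h2
  exact h2

end Expansion

end SpecialGradedManifold

end SuperKilling

end

/-! ### Existence of the metric -/

noncomputable section

namespace SuperKilling

theorem sum_smul_mul_sum {𝕜 A I I' K L : Type*} [CommRing 𝕜] [Ring A] [Algebra 𝕜 A] [Fintype I]
    [Fintype I'] [Fintype K] [Fintype L] (β : K → L → 𝕜) (u : I → K → 𝕜) (u' : I' → L → 𝕜)
    (a : I → A) (a' : I' → A) :
    ∑ k, ∑ l, β k l • ((∑ i, u i k • a i) * ∑ i, u' i l • a' i)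
      = ∑ i, ∑ i', (∑ k, ∑ l, u i k * u' i' l * β k l) • (a i * a' i') := by
  have e : ∀ k l, β k l • ((∑ i, u i k • a i) * ∑ i, u' i l • a' i)
      = ∑ i, ∑ i', (u i k * u' i' l * β k l) • (a i * a' i') := by
    intro k l
    rw [Finset.sum_mul_sum, Finset.smul_sum]
    refine Finset.sum_congr rfl fun i _ => ?_
    rw [Finset.smul_sum]
    refine Finset.sum_congr rfl fun i' _ => ?_
    rw [smul_mul_smul_comm, smul_smul]
    congr 1
    ring
  simp only [e, Finset.sum_smul]
  calc _ = ∑ k, ∑ i, ∑ i', ∑ l, (u i k * u' i' l * β k l) • (a i * a' i') := by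
        refine Finset.sum_congr rfl fun k _ => ?_
        rw [Finset.sum_comm]
        refine Finset.sum_congr rfl fun i _ => ?_
        rw [Finset.sum_comm]
    _ = _ := by
        rw [Finset.sum_comm]
        refine Finset.sum_congr rfl fun i _ => ?_
        rw [Finset.sum_comm]

namespace SpecialGradedManifold

section Metric

variable {s t : ℕ} {𝕜 S M ι : Type*} [RCLike 𝕜] [AddCommGroup S] [Module 𝕜 S]
  [TopologicalSpace M] [ChartedSpace (EuclideanSpace ℝ (Fin (s + t))) M]
  [IsManifold (𝓡 (s + t)) ∞ M] {G : SpecialGradedManifold s t 𝕜 S M ι}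
  {x : M} [FiniteDimensional 𝕜 S]

namespace SuperCoordinates

variable {O : Set M} (c : G.SuperCoordinates O) {I J : Type*} [Fintype I] [Fintype J]
  {V : Module.End 𝕜 G.superFunctions} {a : I → ExteriorAlgebra 𝕜 S} {X : I → VF (s + t) M}
  {b : J → ExteriorAlgebra 𝕜 S} {φ : J → G.SpinorField}

theorem coeffEven_eq (h : Expands V x a X b φ) (m : Fin (s + t)) :
    (c.coeffEven V m).1 x = ∑ i, ((dirDeriv (c.y m) x (X i x) : ℝ) : 𝕜) • a i := by
  rw [coeffEven, h, coord]
  simp only [nabla_scalar, interior_scalar, mul_zero, Finset.sum_const_zero, add_zero]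
  refine Finset.sum_congr rfl fun i _ => ?_
  have h := dirDeriv_clm (X i x) (RCLike.ofRealCLM (K := 𝕜)) (c.smooth_y m x)
  rw [← Algebra.commutes, ← Algebra.smul_def]
  exact congrArg (· • a i) h

/-- Since `∇` is tensorial in its direction, the covariant parts of the given and the coordinate
expansion agree and drop out; contractions are what remains. -/
theorem coeffOdd_eq (hx : x ∈ O) (h : Expands V x a X b φ) (k : Fin (Module.finrank 𝕜 S)) :
    (c.coeffOdd V k).1 x = ∑ j, G.fibre.charge (G.spinorLocal c.i (φ j).1 x)
      (Module.finBasis 𝕜 S k) • b j := by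
  have h1 : ∀ j, G.interior (φ j).1 (c.even k).1 x = algebraMap 𝕜 _
      (G.fibre.charge (G.spinorLocal c.i (φ j).1 x) (Module.finBasis 𝕜 S k)) := by
    intro j
    refine eq_of_superLocal (f' := fun _ => algebraMap 𝕜 _ (G.fibre.charge
      (G.spinorLocal c.i (φ j).1 x) (Module.finBasis 𝕜 S k))) (c.subset_U hx) ?_
    rw [superLocal_interior, even, c.super_eq x hx]
    refine (CliffordAlgebra.contractLeft_ι _ _ _).trans ?_
    rw [superLocal, AlgHom.commutes]
  have h2 : (c.coeffOdd V k).1 x = (V (c.even k)).1 x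
      - ∑ m, (c.coeffEven V m).1 x * G.nabla (c.X m) (c.even k).1 x := by
    rw [coeffOdd]
    change _ - (∑ m, _ : G.superFunctions).1 x = _
    rw [sum_apply']
    simp only [← nablaOp_apply]
    rfl
  have h3 : ∑ m, (c.coeffEven V m).1 x * G.nabla (c.X m) (c.even k).1 x
      = ∑ i, a i * G.nabla (X i) (c.even k).1 x := by
    simp only [c.coeffEven_eq h, nabla_eq_sum Finset.univ (c.eq_sum hx (X _ x)), Finset.sum_mul,
      Finset.mul_sum, smul_mul_assoc, mul_smul_comm]
    exact Finset.sum_comm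
  rw [h2, h3, h, add_sub_cancel_left]
  refine Finset.sum_congr rfl fun j _ => ?_
  rw [h1, ← Algebra.commutes, ← Algebra.smul_def]

/-- The metric in coordinates. -/
def metricLocal (V W : Module.End 𝕜 G.superFunctions) (x : M) : ExteriorAlgebra 𝕜 S :=
  ∑ m, ∑ l, (G.metric.val x (c.X m x) (c.X l x) : 𝕜)
      • ((c.coeffEven V m).1 x * (c.coeffEven W l).1 x)
    + ∑ k, ∑ l, G.fibre.charge (G.fibre.dualBasis k) (G.fibre.dualBasis l)
      • ((c.coeffOdd V k).1 x * CliffordAlgebra.involute ((c.coeffOdd W l).1 x))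

/-- The right-hand side does not mention the coordinates, and the left-hand side does not mention
the expansion. Hence all coordinate systems give the same value and any expansion computes it. The
involution on the second odd coefficient is the sign for moving it past the first odd field. -/
theorem metricLocal_eq (hx : x ∈ O) (h : Expands V x a X b φ) {I' J' : Type*} [Fintype I']
    [Fintype J'] {W : Module.End 𝕜 G.superFunctions} {a' : I' → ExteriorAlgebra 𝕜 S}
    {X' : I' → VF (s + t) M} {b' : J' → ExteriorAlgebra 𝕜 S} {φ' : J' → G.SpinorField}
    (h' : Expands W x a' X' b' φ') : c.metricLocal V W x
      = ∑ i, ∑ i', (G.metric.val x (X i x) (X' i' x) : 𝕜) • (a i * a' i')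
        + ∑ j, ∑ j', G.fibre.charge ((φ j).1 x) ((φ' j').1 x)
          • (b j * CliffordAlgebra.involute (b' j')) := by
  rw [metricLocal]
  congr 1
  · simp only [c.coeffEven_eq h, c.coeffEven_eq h']
    rw [sum_smul_mul_sum]
    refine Finset.sum_congr rfl fun i _ => Finset.sum_congr rfl fun i' _ => ?_
    congr 1
    conv_rhs => rw [c.eq_sum hx (X i x), c.eq_sum hx (X' i' x)]
    simp only [map_sum, map_smul, sum_apply, smul_apply, smul_eq_mul, RCLike.ofReal_mul,
      Finset.mul_sum]
    rw [Finset.sum_comm]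
    exact Finset.sum_congr rfl fun m _ => Finset.sum_congr rfl fun l _ => by ring
  · simp only [c.coeffOdd_eq hx h, c.coeffOdd_eq hx h', map_sum, map_smul]
    rw [sum_smul_mul_sum]
    refine Finset.sum_congr rfl fun j _ => Finset.sum_congr rfl fun j' _ => ?_
    congr 1
    rw [← charge_spinorLocal (i := c.i) (φ j).1 (φ' j').1]
    conv_rhs => rw [G.fibre.eq_sum_dualBasis (G.spinorLocal c.i (φ j).1 x),
      G.fibre.eq_sum_dualBasis (G.spinorLocal c.i (φ' j').1 x)]
    simp only [map_sum, map_smul, LinearMap.sum_apply, LinearMap.smul_apply, smul_eq_mul,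
      Finset.mul_sum]
    rw [Finset.sum_comm]
    exact Finset.sum_congr rfl fun m _ => Finset.sum_congr rfl fun l _ => by ring

/-- The metric in coordinates is smooth. -/
theorem exists_metricLocal (V W : Module.End 𝕜 G.superFunctions) :
    ∃ H : G.superFunctions, ∀ x, H.1 x = c.metricLocal V W x := by
  let inv : G.superFunctions → G.superFunctions := fun f =>
    ⟨fun x => CliffordAlgebra.involute (f.1 x), mem_superFunctions fun i x hx ℓ => by
      refine (smooth_superLocal f hx
        (ℓ ∘ₗ CliffordAlgebra.involute.toLinearMap)).congr_of_eventuallyEq (.of_forall fun y => ?_)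
      simp only [superLocal, LinearMap.comp_apply, AlgHom.toLinearMap_apply, involute_map]⟩
  refine ⟨∑ m, ∑ l, G.scalar (fun x => (G.metric.val x (c.X m x) (c.X l x) : 𝕜))
      (fun x => (SmoothFieldAt.pair G.metric ((c.X m).contMDiff x) ((c.X l).contMDiff x)).ofReal)
      * (c.coeffEven V m * c.coeffEven W l)
    + ∑ k, ∑ l, G.fibre.charge (G.fibre.dualBasis k) (G.fibre.dualBasis l)
      • (c.coeffOdd V k * inv (c.coeffOdd W l)), fun x => ?_⟩
  change (∑ m, _ : G.superFunctions).1 x + (∑ m, _ : G.superFunctions).1 x = _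
  rw [sum_apply', sum_apply', metricLocal]
  simp only [sum_apply', Algebra.smul_def (A := ExteriorAlgebra 𝕜 S)]
  congr 1

end SuperCoordinates

theorem Expands.mul {I J : Type*} [Fintype I] [Fintype J] {V V' : Module.End 𝕜 G.superFunctions}
    {a : I → ExteriorAlgebra 𝕜 S} {X : I → VF (s + t) M} {b : J → ExteriorAlgebra 𝕜 S}
    {φ : J → G.SpinorField} (h : Expands V x a X b φ) {f : G.superFunctions}
    (hf : ∀ a, V' a = f * V a) :
    Expands V' x (fun i => f.1 x * a i) X (fun j => f.1 x * b j) φ := by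
  intro f'
  rw [hf]
  change f.1 x * (V f').1 x = _
  rw [h]
  simp only [mul_add, Finset.mul_sum, mul_assoc]

variable (G) [T2Space M]

/-- A coordinate neighbourhood of `x`. -/
def coordSet (x : M) : Set M := (G.exists_superCoordinates x).choose

theorem mem_coordSet (x : M) : x ∈ G.coordSet x := (G.exists_superCoordinates x).choose_spec.1

/-- Coordinates near `x`. -/
def coords (x : M) : G.SuperCoordinates (G.coordSet x) :=
  (G.exists_superCoordinates x).choose_spec.2.choose

variable {G}

theorem metricLocal_coords {O : Set M} (c : G.SuperCoordinates O) (V W : G.Field) (hx : x ∈ O) :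
    (G.coords x).metricLocal V.1 W.1 x = c.metricLocal V.1 W.1 x :=
  ((G.coords x).metricLocal_eq (G.mem_coordSet x) (c.expands V hx) (c.expands W hx)).trans
    (c.metricLocal_eq hx (c.expands V hx) (c.expands W hx)).symm

/-- The coordinates vary with the point, but near `x` their values agree with those of one fixed
system, which is smooth. -/
theorem metricLocal_mem (V W : G.Field) :
    (fun x => (G.coords x).metricLocal V.1 W.1 x) ∈ G.superFunctions := by
  refine mem_superFunctions fun i x hx => ?_
  obtain ⟨H, hH⟩ := (G.coords x).exists_metricLocal V.1 W.1
  refine (smooth_superLocal H hx).congr ?_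
  filter_upwards [(G.coords x).eventually_mem (G.mem_coordSet x)] with y hy
  exact congrArg (ExteriorAlgebra.map (G.fibre.act (G.spin.trans i (G.idx y) y)))
    ((metricLocal_coords (G.coords x) V W hy).trans (hH y).symm)

/-- The metric of the graded manifold. -/
def superMetric (V W : G.Field) : G.superFunctions :=
  ⟨fun x => (G.coords x).metricLocal V.1 W.1 x, metricLocal_mem V W⟩

theorem superMetric_eq {V W : G.Field} {I J I' J' : Type*} [Fintype I] [Fintype J] [Fintype I']
    [Fintype J'] {a : I → ExteriorAlgebra 𝕜 S} {X : I → VF (s + t) M}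
    {b : J → ExteriorAlgebra 𝕜 S} {φ : J → G.SpinorField} {a' : I' → ExteriorAlgebra 𝕜 S}
    {X' : I' → VF (s + t) M} {b' : J' → ExteriorAlgebra 𝕜 S} {φ' : J' → G.SpinorField}
    (h : Expands V.1 x a X b φ) (h' : Expands W.1 x a' X' b' φ') : (superMetric V W).1 x
      = ∑ i, ∑ i', (G.metric.val x (X i x) (X' i' x) : 𝕜) • (a i * a' i')
        + ∑ j, ∑ j', G.fibre.charge ((φ j).1 x) ((φ' j').1 x)
          • (b j * CliffordAlgebra.involute (b' j')) :=
  (G.coords x).metricLocal_eq (G.mem_coordSet x) h h'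

/-- `X ↦ ∇_X`. -/
def liftVector (X : VF (s + t) M) : G.Field :=
  ⟨(G.nablaOp X).toEnd, Submodule.mem_sup_left (G.nablaOp X).toEnd_mem⟩

/-- `φ ↦ φ⌋`. -/
def liftSpinor (φ : G.SpinorField) : G.Field :=
  ⟨interiorEnd φ, Submodule.mem_sup_right (interiorEnd_mem φ)⟩

/-- The even field `∇_X - (∇X)_𝔞 + α tr(∇X)`. -/
def evenLift (α : 𝕜) (X : VF (s + t) M) : G.EvenField :=
  ⟨(G.evenGauge α X).toEnd, (G.evenGauge α X).toEnd_mem⟩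

omit [T2Space M] in
theorem expands_liftVector (X : VF (s + t) M) (x : M) :
    Expands (G := G) (liftVector X).1 x (fun _ : Unit => 1) (fun _ => X) Empty.elim Empty.elim := by
  intro f
  simp only [Finset.univ_unique, Finset.sum_singleton, one_mul, Finset.univ_eq_empty,
    Finset.sum_empty, add_zero]
  exact nablaOp_apply X f x

omit [T2Space M] in
theorem expands_liftSpinor (φ : G.SpinorField) (x : M) :
    Expands (liftSpinor φ).1 x Empty.elim Empty.elim (fun _ : Unit => 1) (fun _ => φ) := by
  intro f
  simp only [Finset.univ_unique, Finset.sum_singleton, one_mul, Finset.univ_eq_empty,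
    Finset.sum_empty, zero_add]
  rfl

theorem superMetric_add_left (V V' W : G.Field) :
    superMetric (V + V') W = superMetric V W + superMetric V' W := by
  apply Subtype.ext
  funext x
  set c := G.coords x with hc
  have hx := G.mem_coordSet x
  have h : Expands (V + V').1 x (fun m => (c.coeffEven V.1 m).1 x + (c.coeffEven V'.1 m).1 x) c.X
      (fun k => (c.coeffOdd V.1 k).1 x + (c.coeffOdd V'.1 k).1 x) c.odd := by
    intro f
    change (V.1 f).1 x + (V'.1 f).1 x = _
    rw [c.expands V hx, c.expands V' hx]
    simp only [add_mul, Finset.sum_add_distrib]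
    abel
  have hW := c.expands W hx
  change _ = (superMetric V W).1 x + (superMetric V' W).1 x
  rw [superMetric_eq h hW, superMetric_eq (c.expands V hx) hW, superMetric_eq (c.expands V' hx) hW]
  simp only [add_mul, smul_add, Finset.sum_add_distrib]
  abel

theorem superMetric_add_right (V W W' : G.Field) :
    superMetric V (W + W') = superMetric V W + superMetric V W' := by
  apply Subtype.ext
  funext x
  set c := G.coords x with hc
  have hx := G.mem_coordSet x
  have h : Expands (W + W').1 x (fun m => (c.coeffEven W.1 m).1 x + (c.coeffEven W'.1 m).1 x) c.X
      (fun k => (c.coeffOdd W.1 k).1 x + (c.coeffOdd W'.1 k).1 x) c.odd := by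
    intro f
    change (W.1 f).1 x + (W'.1 f).1 x = _
    rw [c.expands W hx, c.expands W' hx]
    simp only [add_mul, Finset.sum_add_distrib]
    abel
  have hV := c.expands V hx
  change _ = (superMetric V W).1 x + (superMetric V W').1 x
  rw [superMetric_eq hV h, superMetric_eq hV (c.expands W hx), superMetric_eq hV (c.expands W' hx)]
  simp only [map_add, mul_add, smul_add, Finset.sum_add_distrib]
  abel

theorem isEvenBilinearForm_superMetric : G.IsEvenBilinearForm superMetric where
  add_left := superMetric_add_left
  add_right := superMetric_add_right
  mul_left f V V' W hf := by
    apply Subtype.ext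
    funext x
    have hV := (G.coords x).expands V (G.mem_coordSet x)
    have hW := (G.coords x).expands W (G.mem_coordSet x)
    change _ = f.1 x * (superMetric V W).1 x
    rw [superMetric_eq (hV.mul hf) hW, superMetric_eq hV hW]
    simp only [mul_add, Finset.mul_sum, mul_smul_comm, mul_assoc]
  mul_right p q f V W W' hVp hf hW' := by
    apply Subtype.ext
    funext x
    -- In the odd part `f` meets the involution and then passes an odd coefficient of parity `p +
    -- 1`; the two signs combine to that of passing a field of parity `p`.
    have hs : ∀ p q : ZMod 2, superSign q 1 * superSign (p + 1) q = superSign p q := by decide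
    have hV := (G.coords x).expands V (G.mem_coordSet x)
    have hW := (G.coords x).expands W (G.mem_coordSet x)
    change _ = superSign p q • (f.1 x * (superMetric V W).1 x)
    rw [superMetric_eq hV (hW.mul hW'), superMetric_eq hV hW]
    simp only [mul_add, Finset.mul_sum, mul_smul_comm, smul_add, Finset.smul_sum]
    congr 1
    · refine Finset.sum_congr rfl fun k _ => Finset.sum_congr rfl fun l _ => ?_
      rw [← mul_assoc, mul_comm_parity ((G.coords x).coeffEven_mem hVp k x) (hf x), smul_mul_assoc,
        mul_assoc, smul_comm]
    · refine Finset.sum_congr rfl fun k _ => Finset.sum_congr rfl fun l _ => ?_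
      rw [map_mul, mem_parity_iff.1 (hf x), smul_mul_assoc, mul_smul_comm, ← mul_assoc,
        mul_comm_parity ((G.coords x).coeffOdd_mem hVp k x) (hf x), smul_mul_assoc, smul_smul, hs,
        mul_assoc, smul_comm]

theorem isMetric_superMetric : G.IsMetric liftVector liftSpinor superMetric where
  bilinear := isEvenBilinearForm_superMetric
  vec_vec X Y x := by
    rw [superMetric_eq (expands_liftVector X x) (expands_liftVector Y x)]
    simp [Algebra.algebraMap_eq_smul_one]
  spin_spin φ ψ x := by
    rw [superMetric_eq (expands_liftSpinor φ x) (expands_liftSpinor ψ x)]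
    simp [Algebra.algebraMap_eq_smul_one]
  vec_spin X φ := by
    apply Subtype.ext
    funext x
    rw [superMetric_eq (expands_liftVector X x) (expands_liftSpinor φ x)]
    simp
  spin_vec φ X := by
    apply Subtype.ext
    funext x
    rw [superMetric_eq (expands_liftSpinor φ x) (expands_liftVector X x)]
    simp

end Metric

end SpecialGradedManifold

end SuperKilling

end

noncomputable section

namespace SuperKilling

namespace SpecialGradedManifold

/-! ### Graded forms are determined by the lifts -/

section Uniqueness

variable {s t : ℕ} {𝕜 S M ι : Type*} [RCLike 𝕜] [AddCommGroup S] [Module 𝕜 S]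
  [TopologicalSpace M] [ChartedSpace (EuclideanSpace ℝ (Fin (s + t))) M]
  [IsManifold (𝓡 (s + t)) ∞ M] {G : SpecialGradedManifold s t 𝕜 S M ι}
  {x : M} [FiniteDimensional 𝕜 S]

theorem derivations_le (p : ZMod 2) : G.derivations p ≤ G.derivations 0 ⊔ G.derivations 1 := by
  have hp : ∀ p : ZMod 2, p = 0 ∨ p = 1 := by decide
  obtain rfl | rfl := hp p
  · exact le_sup_left
  · exact le_sup_right

/-- The product of a homogeneous function and a homogeneous field. -/
def fieldMul {p q : ZMod 2} {f : G.superFunctions} (hf : ∀ x, f.1 x ∈ parity 𝕜 S q) {V : G.Field}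
    (hV : V.1 ∈ G.derivations p) : G.Field :=
  ⟨LinearMap.mulLeft 𝕜 f ∘ₗ V.1, derivations_le _ (mulLeft_comp_mem hf hV)⟩

theorem field_ext {V W : G.Field} (h : ∀ f x, (V.1 f).1 x = (W.1 f).1 x) : V = W :=
  Subtype.ext (LinearMap.ext fun f => Subtype.ext (funext fun x => h f x))

/-- Biadditive forms with the sign rules of an even form on homogeneous arguments. -/
structure IsGradedForm (b : G.Field → G.Field → G.superFunctions) : Prop where
  add_left : ∀ V V' W, b (V + V') W = b V W + b V' W
  add_right : ∀ V W W', b V (W + W') = b V W + b V W'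
  mul_left : ∀ (p q : ZMod 2) (f : G.superFunctions) (V V' W : G.Field),
    V.1 ∈ G.derivations p → (∀ x, f.1 x ∈ parity 𝕜 S q) →
    (∀ a, V'.1 a = f * V.1 a) → b V' W = f * b V W
  mul_right : ∀ (p p' q : ZMod 2) (f : G.superFunctions) (V W W' : G.Field),
    V.1 ∈ G.derivations p → W.1 ∈ G.derivations p' → (∀ x, f.1 x ∈ parity 𝕜 S q) →
    (∀ a, W'.1 a = f * W.1 a) → b V W' = superSign p q • (f * b V W)

/-- The weaker notion suffices for uniqueness, and it is what the Leibniz rule on homogeneous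
functions gives directly for Lie derivatives. -/
theorem IsEvenBilinearForm.isGradedForm {b : G.Field → G.Field → G.superFunctions}
    (h : G.IsEvenBilinearForm b) : IsGradedForm b :=
  ⟨h.add_left, h.add_right, fun _ _ f V V' W _ _ => h.mul_left f V V' W,
    fun p _ q f V W W' hV _ => h.mul_right p q f V W W' hV⟩

theorem IsGradedForm.sub {b b' : G.Field → G.Field → G.superFunctions} (h : IsGradedForm b)
    (h' : IsGradedForm b') : IsGradedForm fun V W => b V W - b' V W where
  add_left V V' W := by
    rw [h.add_left, h'.add_left]
    abel
  add_right V V' W := by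
    rw [h.add_right, h'.add_right]
    abel
  mul_left p q f V V' W hV hf hV' := by
    rw [h.mul_left p q f V V' W hV hf hV', h'.mul_left p q f V V' W hV hf hV', mul_sub]
  mul_right p p' q f V W W' hV hW hf hW' := by
    rw [h.mul_right p p' q f V W W' hV hW hf hW', h'.mul_right p p' q f V W W' hV hW hf hW',
      mul_sub, smul_sub]

theorem bracket_add (W : G.EvenField) (V V' : G.Field) :
    G.bracket W (V + V') = G.bracket W V + G.bracket W V' := by
  refine field_ext fun f x => ?_
  change (W.1 (V.1 f + V'.1 f)).1 x - ((V.1 (W.1 f)).1 x + (V'.1 (W.1 f)).1 x) =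
    ((W.1 (V.1 f)).1 x - (V.1 (W.1 f)).1 x) + ((W.1 (V'.1 f)).1 x - (V'.1 (W.1 f)).1 x)
  rw [map_add]
  change (W.1 (V.1 f)).1 x + (W.1 (V'.1 f)).1 x - _ = _
  abel

theorem evenField_mul (W : G.EvenField) {q : ZMod 2} {f : G.superFunctions}
    (hf : ∀ x, f.1 x ∈ parity 𝕜 S q) (f' : G.superFunctions) :
    W.1 (f * f') = W.1 f * f' + f * W.1 f' := by
  rw [(W.2 q f hf).2 f']
  simp [superSign]

theorem evenField_parity (W : G.EvenField) {q : ZMod 2} {f : G.superFunctions}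
    (hf : ∀ x, f.1 x ∈ parity 𝕜 S q) (x : M) : (W.1 f).1 x ∈ parity 𝕜 S q := by
  have := (W.2 q f hf).1 x
  rwa [zero_add] at this

theorem bracket_fieldMul (W : G.EvenField) {p q : ZMod 2} {f : G.superFunctions}
    (hf : ∀ x, f.1 x ∈ parity 𝕜 S q) {V V' : G.Field} (hV : V.1 ∈ G.derivations p)
    (hV' : ∀ a, V'.1 a = f * V.1 a) :
    G.bracket W V' = fieldMul (evenField_parity W hf) hV
      + fieldMul hf (V := G.bracket W V) (G.lie_mem_derivations W.2 hV) := by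
  refine field_ext fun a x => ?_
  change (W.1 (V'.1 a) - V'.1 (W.1 a)).1 x
    = (W.1 f * V.1 a + f * (W.1 (V.1 a) - V.1 (W.1 a))).1 x
  rw [hV', hV', evenField_mul W hf, mul_sub, add_sub_assoc]

/-- The Lie derivative of an even bilinear form is an even bilinear form. -/
theorem isGradedForm_lieDeriv {b : G.Field → G.Field → G.superFunctions}
    (h : G.IsEvenBilinearForm b) (W : G.EvenField) : IsGradedForm (G.lieDeriv W b) where
  add_left V V' Z := by
    simp only [lieDeriv, bracket_add, h.add_left, map_add]
    abel
  add_right V Z Z' := by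
    simp only [lieDeriv, bracket_add, h.add_right, map_add]
    abel
  mul_left p q f V V' Z hV hf hV' := by
    simp only [lieDeriv]
    -- The derivative of `f` occurs once from `W` applied to the product and once from the bracket,
    -- and cancels. In the second slot the same holds, since bracketing with an even field changes
    -- no parity.
    rw [bracket_fieldMul W hf hV hV', h.add_left, h.mul_left f V V' _ hV', h.mul_left f V V' _ hV',
      h.mul_left (W.1 f) V (fieldMul (evenField_parity W hf) hV) _ fun a => rfl,
      h.mul_left f (G.bracket W V)
        (fieldMul hf (V := G.bracket W V) (G.lie_mem_derivations W.2 hV)) _ fun a => rfl,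
      evenField_mul W hf]
    simp only [mul_sub]
    abel
  mul_right p p' q f V Z Z' hV hZ hf hZ' := by
    simp only [lieDeriv]
    rw [bracket_fieldMul W hf hZ hZ', h.add_right, h.mul_right p q f V Z Z' hV hf hZ',
      h.mul_right p q f (G.bracket W V) Z Z' (G.lie_mem_derivations W.2 hV) hf hZ',
      h.mul_right p q (W.1 f) V Z (fieldMul (evenField_parity W hf) hZ) hV (evenField_parity W hf)
        fun a => rfl,
      h.mul_right p q f V (G.bracket W Z)
        (fieldMul hf (V := G.bracket W Z) (G.lie_mem_derivations W.2 hZ)) hV hf fun a => rfl,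
      map_zsmul, evenField_mul W hf]
    simp only [mul_sub, smul_sub, smul_add]
    abel

variable [T2Space M]

/-- Near each point a homogeneous field is a combination of the lifts. -/
theorem exists_expansion {p : ZMod 2} {V : G.Field} (hV : V.1 ∈ G.derivations p) (x : M) :
    ∃ (χ : G.superFunctions) (a : Fin (s + t) → G.superFunctions) (X : Fin (s + t) → VF (s + t) M)
      (b : Fin (Module.finrank 𝕜 S) → G.superFunctions)
      (φ : Fin (Module.finrank 𝕜 S) → G.SpinorField), χ.1 x = 1 ∧
      (∀ y, χ.1 y ∈ parity 𝕜 S 0) ∧ (∀ k y, (a k).1 y ∈ parity 𝕜 S p) ∧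
      (∀ k y, (b k).1 y ∈ parity 𝕜 S (p + 1)) ∧
      ∀ f y, (χ * V.1 f).1 y = ∑ k, (a k * (liftVector (X k)).1 f).1 y
        + ∑ k, (b k * (liftSpinor (φ k)).1 f).1 y := by
  have hx := G.mem_coordSet x
  -- Multiplication by a cut-off turns the local expansion into an identity of global fields, to
  -- which linearity of a form can be applied.
  obtain ⟨χ, hχ, h1, hs⟩ := exists_bump (n := s + t) (G.coords x).isOpen hx
  set c := G.coords x with hc
  let ρ : G.superFunctions := G.scalar (fun y => (χ y : 𝕜)) fun x => SmoothAt.ofReal hχ.contMDiffAt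
  have hρ : ∀ y, ρ.1 y ∈ parity 𝕜 S 0 := fun y => algebraMap_mem_parity _
  have hm : ∀ {q : ZMod 2} {f : G.superFunctions}, (∀ y, f.1 y ∈ parity 𝕜 S q) →
      ∀ y, (ρ * f).1 y ∈ parity 𝕜 S q := by
    intro q f hf y
    have := SetLike.mul_mem_graded (A := CliffordAlgebra.evenOdd (0 : QuadraticForm 𝕜 S))
      (hρ y) (hf y)
    rwa [zero_add] at this
  refine ⟨ρ, fun k => ρ * c.coeffEven V.1 k, c.X, fun k => ρ * c.coeffOdd V.1 k, c.odd, ?_, hρ,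
    fun k => hm (c.coeffEven_mem hV k), fun k => hm (c.coeffOdd_mem hV k), fun f y => ?_⟩
  · change algebraMap 𝕜 _ (χ x : 𝕜) = 1
    rw [h1.self_of_nhds]
    simp
  · by_cases hy : y ∈ G.coordSet x
    · change ρ.1 y * (V.1 f).1 y = ∑ k, ρ.1 y * (c.coeffEven V.1 k).1 y * _
        + ∑ k, ρ.1 y * (c.coeffOdd V.1 k).1 y * _
      rw [c.expands V hy f, mul_add, Finset.mul_sum, Finset.mul_sum]
      simp only [mul_assoc, ← nablaOp_apply]
      rfl
    · have h0 : ρ.1 y = 0 := by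
        change algebraMap 𝕜 _ (χ y : 𝕜) = 0
        rw [image_eq_zero_of_notMem_tsupport fun h => hy (hs h)]
        simp
      change ρ.1 y * _ = ∑ k, ρ.1 y * (c.coeffEven V.1 k).1 y * _
        + ∑ k, ρ.1 y * (c.coeffOdd V.1 k).1 y * _
      simp [h0]

namespace IsGradedForm

variable {b : G.Field → G.Field → G.superFunctions} (h : IsGradedForm b)

include h

omit [T2Space M] in
theorem sum_left {J : Type*} (A : Finset J) (V : J → G.Field) (W : G.Field) :
    b (∑ k ∈ A, V k) W = ∑ k ∈ A, b (V k) W := by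
  classical
  induction A using Finset.induction_on with
  | empty => simpa using h.add_left 0 0 W
  | insert k A hk ih => rw [Finset.sum_insert hk, Finset.sum_insert hk, h.add_left, ih]

omit [T2Space M] in
theorem sum_right {J : Type*} (A : Finset J) (V : G.Field) (W : J → G.Field) :
    b V (∑ k ∈ A, W k) = ∑ k ∈ A, b V (W k) := by
  classical
  induction A using Finset.induction_on with
  | empty => simpa using h.add_right V 0 0
  | insert k A hk ih => rw [Finset.sum_insert hk, Finset.sum_insert hk, h.add_right, ih]

/-- Multiplying `V` by a function equal to one at the given point makes it a combination of lifts
without changing the value of the form there. -/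
theorem eq_zero_left {W : G.Field} (h1 : ∀ X, b (liftVector X) W = 0)
    (h2 : ∀ φ, b (liftSpinor φ) W = 0) (V : G.Field) : b V W = 0 := by
  have key : ∀ {p : ZMod 2} (V : G.Field), V.1 ∈ G.derivations p → b V W = 0 := by
    intro p V hV
    apply Subtype.ext
    funext x
    obtain ⟨χ, a, X, c, φ, hχ, hχ0, ha, hc, hf⟩ := exists_expansion hV x
    have e : fieldMul hχ0 hV
        = ∑ k, fieldMul (ha k) (V := liftVector (X k)) (G.nablaOp (X k)).toEnd_mem
        + ∑ k, fieldMul (hc k) (V := liftSpinor (φ k)) (interiorEnd_mem (φ k)) := by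
      refine field_ext fun f y => (hf f y).trans ?_
      simp only [Submodule.coe_add, AddSubmonoidClass.coe_finsetSum, LinearMap.add_apply,
        LinearMap.sum_apply]
      change _ = (∑ k, _ : G.superFunctions).1 y + (∑ k, _ : G.superFunctions).1 y
      rw [sum_apply', sum_apply']
      rfl
    have h3 := h.mul_left p 0 χ V (fieldMul hχ0 hV) W hV hχ0 fun a => rfl
    rw [e, h.add_left, h.sum_left, h.sum_left] at h3
    have e1 : ∀ k,
        b (fieldMul (ha k) (V := liftVector (X k)) (G.nablaOp (X k)).toEnd_mem) W = 0 := by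
      intro k
      rw [h.mul_left 0 p (a k) (liftVector (X k)) _ W (G.nablaOp (X k)).toEnd_mem (ha k)
        fun a => rfl, h1, mul_zero]
    have e2 : ∀ k, b (fieldMul (hc k) (V := liftSpinor (φ k)) (interiorEnd_mem (φ k))) W = 0 := by
      intro k
      rw [h.mul_left 1 _ (c k) (liftSpinor (φ k)) _ W (interiorEnd_mem (φ k)) (hc k) fun a => rfl,
        h2, mul_zero]
    simp only [e1, e2, Finset.sum_const_zero, add_zero] at h3
    have h4 := congrFun (congrArg Subtype.val h3) x
    change 0 = χ.1 x * (b V W).1 x at h4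
    rw [hχ, one_mul] at h4
    exact h4.symm
  obtain ⟨V, hV⟩ := V
  obtain ⟨V₀, h₀, V₁, h₁, rfl⟩ := Submodule.mem_sup.1 hV
  have e : (⟨V₀ + V₁, hV⟩ : G.Field) = ⟨V₀, derivations_le 0 h₀⟩ + ⟨V₁, derivations_le 1 h₁⟩ := rfl
  rw [e, h.add_left, key _ h₀, key _ h₁, add_zero]

/-- The same argument in the second slot, where `V` must be homogeneous for the sign to be defined;
lifts are. -/
theorem eq_zero_right {p : ZMod 2} {V : G.Field} (hV : V.1 ∈ G.derivations p)
    (h1 : ∀ X, b V (liftVector X) = 0) (h2 : ∀ φ, b V (liftSpinor φ) = 0) (W : G.Field) :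
    b V W = 0 := by
  have key : ∀ {p : ZMod 2} (W : G.Field), W.1 ∈ G.derivations p → b V W = 0 := by
    intro r W hW
    apply Subtype.ext
    funext x
    obtain ⟨χ, a, X, c, φ, hχ, hχ0, ha, hc, hf⟩ := exists_expansion hW x
    have e : fieldMul hχ0 hW
        = ∑ k, fieldMul (ha k) (V := liftVector (X k)) (G.nablaOp (X k)).toEnd_mem
        + ∑ k, fieldMul (hc k) (V := liftSpinor (φ k)) (interiorEnd_mem (φ k)) := by
      refine field_ext fun f y => (hf f y).trans ?_
      simp only [Submodule.coe_add, AddSubmonoidClass.coe_finsetSum, LinearMap.add_apply,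
        LinearMap.sum_apply]
      change _ = (∑ k, _ : G.superFunctions).1 y + (∑ k, _ : G.superFunctions).1 y
      rw [sum_apply', sum_apply']
      rfl
    have h3 := h.mul_right p r 0 χ V W (fieldMul hχ0 hW) hV hW hχ0 fun a => rfl
    rw [e, h.add_right, h.sum_right, h.sum_right, superSign_zero_right, one_smul] at h3
    have e1 : ∀ k,
        b V (fieldMul (ha k) (V := liftVector (X k)) (G.nablaOp (X k)).toEnd_mem) = 0 := by
      intro k
      rw [h.mul_right p 0 _ (a k) V (liftVector (X k)) _ hV (G.nablaOp (X k)).toEnd_mem (ha k)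
        fun a => rfl, h1, mul_zero, smul_zero]
    have e2 : ∀ k, b V (fieldMul (hc k) (V := liftSpinor (φ k)) (interiorEnd_mem (φ k))) = 0 := by
      intro k
      rw [h.mul_right p 1 _ (c k) V (liftSpinor (φ k)) _ hV (interiorEnd_mem (φ k)) (hc k)
        fun a => rfl, h2, mul_zero, smul_zero]
    simp only [e1, e2, Finset.sum_const_zero, add_zero] at h3
    have h4 := congrFun (congrArg Subtype.val h3) x
    change 0 = χ.1 x * (b V W).1 x at h4
    rw [hχ, one_mul] at h4
    exact h4.symm
  obtain ⟨W, hW⟩ := W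
  obtain ⟨W₀, h₀, W₁, h₁, rfl⟩ := Submodule.mem_sup.1 hW
  have e : (⟨W₀ + W₁, hW⟩ : G.Field) = ⟨W₀, derivations_le 0 h₀⟩ + ⟨W₁, derivations_le 1 h₁⟩ := rfl
  rw [e, h.add_right, key _ h₀, key _ h₁, add_zero]

/-- A graded form is determined by its values on the lifts. -/
theorem eq_zero (h1 : ∀ X Y, b (liftVector X) (liftVector Y) = 0)
    (h2 : ∀ X φ, b (liftVector X) (liftSpinor φ) = 0)
    (h3 : ∀ φ X, b (liftSpinor φ) (liftVector X) = 0)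
    (h4 : ∀ φ ψ, b (liftSpinor φ) (liftSpinor ψ) = 0) (V W : G.Field) : b V W = 0 :=
  h.eq_zero_left (fun X => h.eq_zero_right (G.nablaOp X).toEnd_mem (h1 X) (h2 X) W)
    (fun φ => h.eq_zero_right (interiorEnd_mem φ) (h3 φ) (h4 φ) W) V

end IsGradedForm

theorem IsMetric.eq_superMetric {h : G.Field → G.Field → G.superFunctions}
    (hh : G.IsMetric liftVector liftSpinor h) : h = superMetric := by
  have hm := isMetric_superMetric (G := G)
  have key := (hh.bilinear.isGradedForm.sub hm.bilinear.isGradedForm).eq_zero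
    (fun X Y => sub_eq_zero.2 (Subtype.ext (funext fun x => by rw [hh.vec_vec, hm.vec_vec])))
    (fun X φ => by rw [hh.vec_spin, hm.vec_spin, sub_self])
    (fun φ X => by rw [hh.spin_vec, hm.spin_vec, sub_self])
    (fun φ ψ => sub_eq_zero.2 (Subtype.ext (funext fun x => by rw [hh.spin_spin, hm.spin_spin])))
  funext V W
  exact sub_eq_zero.1 (key V W)

end Uniqueness

end SpecialGradedManifold

end SuperKilling

end

noncomputable section

namespace SuperKilling

namespace SpecialGradedManifold

/-! ### Even Killing fields and Killing fields -/

section Killing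

variable {s t : ℕ} {𝕜 S M ι : Type*} [RCLike 𝕜] [AddCommGroup S] [Module 𝕜 S]
  [TopologicalSpace M] [ChartedSpace (EuclideanSpace ℝ (Fin (s + t))) M]
  [IsManifold (𝓡 (s + t)) ∞ M] {G : SpecialGradedManifold s t 𝕜 S M ι}
  {x : M} [FiniteDimensional 𝕜 S] [T2Space M]

omit [IsManifold (𝓡 (s + t)) ∞ M] [T2Space M] in
theorem dirDeriv_ofReal {a : M → ℝ} (ha : SmoothAt (s + t) a x) (v : TangentSpace (𝓡 (s + t)) x) :
    dirDeriv (fun y => (a y : 𝕜)) x v = ((dirDeriv a x v : ℝ) : 𝕜) :=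
  dirDeriv_clm v (RCLike.ofRealCLM (K := 𝕜)) ha

theorem evenLift_superMetric_vec_vec (α : 𝕜) (X Y Z : VF (s + t) M) :
    ((evenLift (G := G) α X).1 (superMetric (liftVector Y) (liftVector Z))).1 x = algebraMap 𝕜 _
      ((dirDeriv (fun y => G.metric.val y (Y y) (Z y)) x (X x) : ℝ) : 𝕜) := by
  have hs : ∀ x, SmoothAt (s + t) (fun y => G.metric.val y (Y y) (Z y)) x := fun x =>
    SmoothFieldAt.pair G.metric (Y.contMDiff x) (Z.contMDiff x)
  have e : superMetric (G := G) (liftVector Y) (liftVector Z)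
      = G.scalar (fun y => (G.metric.val y (Y y) (Z y) : 𝕜)) fun x => (hs x).ofReal :=
    Subtype.ext (funext fun x => isMetric_superMetric.vec_vec Y Z x)
  rw [e]
  exact (toEnd_scalar (G.evenGauge α X) _ _ x).trans (congrArg _ (dirDeriv_ofReal (hs x) _))

omit [T2Space M] in
theorem coeffEven_of_scalar {O : Set M} (c : G.SuperCoordinates O)
    {V : Module.End 𝕜 G.superFunctions}
    {v : TangentSpace (𝓡 (s + t)) x}
    (hV : ∀ a ha, (V (G.scalar a ha)).1 x = algebraMap 𝕜 _ (dirDeriv a x v)) (m : Fin (s + t)) :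
    (c.coeffEven V m).1 x = algebraMap 𝕜 _ ((dirDeriv (c.y m) x v : ℝ) : 𝕜) :=
  (hV _ _).trans (congrArg _ (dirDeriv_ofReal (c.smooth_y m x) v))

/-- Products of lifts with a field that acts on scalars as a tangent vector. -/
theorem superMetric_liftVector_right {V : G.Field} {v : TangentSpace (𝓡 (s + t)) x}
    (hV : ∀ a ha, (V.1 (G.scalar a ha)).1 x = algebraMap 𝕜 _ (dirDeriv a x v))
    (Z : VF (s + t) M) :
    (superMetric V (liftVector Z)).1 x = algebraMap 𝕜 _ ((G.metric.val x v (Z x) : ℝ) : 𝕜) := by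
  have hx := G.mem_coordSet x
  rw [superMetric_eq ((G.coords x).expands V hx) (expands_liftVector Z x)]
  simp only [coeffEven_of_scalar _ hV, Finset.univ_unique, Finset.sum_singleton, mul_one,
    Finset.univ_eq_empty, Finset.sum_empty, Finset.sum_const_zero, add_zero]
  conv_rhs => rw [(G.coords x).eq_sum hx v]
  simp only [map_sum, map_smul, sum_apply, smul_apply, smul_eq_mul, Algebra.smul_def,
    map_mul]
  exact Finset.sum_congr rfl fun m _ => (Algebra.commutes _ _)

theorem superMetric_liftVector_left {V : G.Field} {v : TangentSpace (𝓡 (s + t)) x}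
    (hV : ∀ a ha, (V.1 (G.scalar a ha)).1 x = algebraMap 𝕜 _ (dirDeriv a x v))
    (Z : VF (s + t) M) :
    (superMetric (liftVector Z) V).1 x = algebraMap 𝕜 _ ((G.metric.val x (Z x) v : ℝ) : 𝕜) := by
  have hx := G.mem_coordSet x
  rw [superMetric_eq (expands_liftVector Z x) ((G.coords x).expands V hx)]
  simp only [coeffEven_of_scalar _ hV, Finset.univ_unique, Finset.sum_singleton, one_mul,
    Finset.univ_eq_empty, Finset.sum_empty, add_zero]
  conv_rhs => rw [(G.coords x).eq_sum hx v]
  simp only [map_sum, map_smul, smul_eq_mul, map_mul, Algebra.smul_def]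
  exact Finset.sum_congr rfl fun m _ => (Algebra.commutes _ _)

omit [T2Space M] in
theorem bracket_scalar {X Y : VF (s + t) M} (L : G.GaugeOperator X) (L' : G.GaugeOperator Y)
    (a : M → 𝕜) (ha : ∀ x, SmoothAt (s + t) a x) :
    (⁅L.toEnd, L'.toEnd⁆ (G.scalar a ha)).1 x
      = algebraMap 𝕜 _ (dirDeriv a x (lieBracket X Y x)) := by
  have key : ∀ {X : VF (s + t) M} (L : G.GaugeOperator X), L.toEnd (G.scalar a ha)
      = G.scalar (fun y => dirDeriv a y (X y)) fun x => (ha x).dirDeriv (X.contMDiff x) :=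
    fun L => Subtype.ext (funext fun x => toEnd_scalar L a ha x)
  change (L.toEnd (L'.toEnd (G.scalar a ha)) - L'.toEnd (L.toEnd (G.scalar a ha))).1 x = _
  rw [key L', key L]
  change (L.toEnd _).1 x - (L'.toEnd _).1 x = _
  rw [toEnd_scalar, toEnd_scalar, ← map_sub]
  exact congrArg _ (dirDeriv_bracket (ha x) (X.contMDiff x) (Y.contMDiff x)).symm

/-- No Killing condition is needed. The brackets with `∇_Y` and `∇_Z` need not be lifts, but they
act on scalars as Lie brackets, and products with a vector lift see nothing else. -/
theorem lieDeriv_evenLift_vec_vec (α : 𝕜) (X Y Z : VF (s + t) M) :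
    (G.lieDeriv (evenLift α X) superMetric (liftVector Y) (liftVector Z)).1 x
      = algebraMap 𝕜 _ ((dirDeriv (fun y => G.metric.val y (Y y) (Z y)) x (X x)
        - G.metric.val x (lieBracket X Y x) (Z x) - G.metric.val x (Y x) (lieBracket X Z x) : ℝ)
          : 𝕜) := by
  change ((evenLift α X).1 _).1 x - (superMetric _ _).1 x - (superMetric _ _).1 x = _
  rw [evenLift_superMetric_vec_vec,
    superMetric_liftVector_right (v := lieBracket X Y x)
      fun a ha => bracket_scalar (G.evenGauge α X) (G.nablaOp Y) a ha,
    superMetric_liftVector_left (v := lieBracket X Z x)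
      fun a ha => bracket_scalar (G.evenGauge α X) (G.nablaOp Z) a ha]
  simp only [map_sub]

theorem isKilling_of_isEvenKilling {α : 𝕜} {X : VF (s + t) M}
    (h : G.IsEvenKilling superMetric (evenLift α X)) : IsKilling G.metric X := by
  intro Y Z x
  have h1 := congrFun (congrArg Subtype.val (h (liftVector Y) (liftVector Z))) x
  rw [lieDeriv_evenLift_vec_vec] at h1
  change _ = 0 at h1
  rw [ExteriorAlgebra.algebraMap_eq_zero_iff] at h1
  exact RCLike.ofReal_eq_zero.1 h1

theorem bracket_liftVector {X : VF (s + t) M} (hX : IsKilling G.metric X) (α : 𝕜)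
    (Y : VF (s + t) M) :
    G.bracket (evenLift α X) (liftVector Y) = liftVector (lieBracket X Y) :=
  Subtype.ext (lie_evenGauge_nablaOp hX α Y)

omit [T2Space M] in
theorem bracket_liftSpinor {X : VF (s + t) M} {α : 𝕜} (hc : (G.evenGauge α X).c = 0)
    (φ : G.SpinorField) : G.bracket (evenLift α X) (liftSpinor φ)
      = liftSpinor ((G.evenGauge α X).spinorOp hc φ) :=
  Subtype.ext ((G.evenGauge α X).lie_interiorEnd hc φ)

omit [T2Space M] in
theorem GaugeOperator.toEnd_spinorFunction {X : VF (s + t) M} (L : G.GaugeOperator X)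
    (hc : L.c = 0) (φ : G.SpinorField) :
    L.toEnd (spinorFunction φ) = spinorFunction (L.spinorOp hc φ) := by
  apply Subtype.ext
  funext x
  obtain ⟨Φ', hΦ⟩ := (smooth_spinorLocal φ (G.mem_idx x)).exists_hasWDeriv (X x)
  have h1 : L.op (spinorFunction φ).1 x = _ := L.loc_spinorFunction hc φ hΦ
  change L.op (spinorFunction φ).1 x = ExteriorAlgebra.ι 𝕜
    (ExteriorAlgebra.ιInv (L.op (spinorFunction φ).1 x))
  rw [h1, ExteriorAlgebra.ι_leftInverse]

/-- Writing `C(φ, ψ)` as a contraction makes its invariance an instance of the commutator formula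
for contractions. -/
theorem superMetric_spin_spin (φ ψ : G.SpinorField) :
    superMetric (liftSpinor φ) (liftSpinor ψ) = interiorEnd φ (spinorFunction ψ) := by
  apply Subtype.ext
  funext x
  rw [isMetric_superMetric.spin_spin]
  exact (CliffordAlgebra.contractLeft_ι _ _ _).symm

theorem isEvenKilling_evenLift {X : VF (s + t) M} (hX : IsKilling G.metric X) (α : 𝕜) :
    G.IsEvenKilling superMetric (evenLift α X) := by
  have hc := G.evenGauge_c_eq_zero α hX
  have hm := isMetric_superMetric (G := G)
  refine (isGradedForm_lieDeriv isEvenBilinearForm_superMetric (evenLift α X)).eq_zero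
    (fun Y Z => ?_) (fun Y φ => ?_) (fun φ Y => ?_) (fun φ ψ => ?_)
  · apply Subtype.ext
    funext x
    rw [lieDeriv_evenLift_vec_vec, hX Y Z x]
    simp
  · rw [lieDeriv, bracket_liftVector hX, bracket_liftSpinor hc]
    simp only [hm.vec_spin, map_zero, sub_zero]
  · rw [lieDeriv, bracket_liftVector hX, bracket_liftSpinor hc]
    simp only [hm.spin_vec, map_zero, sub_zero]
  · rw [lieDeriv, bracket_liftSpinor hc, bracket_liftSpinor hc]
    simp only [superMetric_spin_spin]
    -- What remains is `W(φ⌋ψ) - [W, φ⌋]ψ - φ⌋(Wψ)`, which is zero by definition of the commutator.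
    rw [← (G.evenGauge α X).lie_interiorEnd hc, ← GaugeOperator.toEnd_spinorFunction _ hc]
    exact sub_eq_zero.2 (sub_sub_cancel _ _)

end Killing

end SpecialGradedManifold

end SuperKilling

end

theorem mainTheorem3 {s t : ℕ} {𝕜 S M ι : Type*} [RCLike 𝕜] [AddCommGroup S] [Module 𝕜 S]
    [FiniteDimensional 𝕜 S] [TopologicalSpace M] [T2Space M]
    [ChartedSpace (EuclideanSpace ℝ (Fin (s + t))) M] [IsManifold (𝓡 (s + t)) ∞ M]
    (G : SuperKilling.SpecialGradedManifold s t 𝕜 S M ι) (α : 𝕜) :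
    ∃ (jv : SuperKilling.VF (s + t) M → G.Field) (js : G.SpinorField → G.Field)
      (e : SuperKilling.VF (s + t) M → G.EvenField)
      (h : G.Field → G.Field → G.superFunctions),
      -- the inclusions `X ↦ ∇_X` and `φ ↦ φ⌋`, and the fields `e_α(X)`
      (∀ X f x, ((jv X).1 f).1 x = G.nabla X f.1 x) ∧
      (∀ φ f x, ((js φ).1 f).1 x = G.interior φ.1 f.1 x) ∧
      (∀ X f x, ((e X).1 f).1 x = G.evenOp α X f.1 x) ∧
      -- `h` is the metric
      G.IsMetric jv js h ∧ (∀ h', G.IsMetric jv js h' → h' = h) ∧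
      (∀ X, G.IsEvenKilling h (e X) ↔ SuperKilling.IsKilling G.metric X) ∧
      (∀ X Y, SuperKilling.IsKilling G.metric X → SuperKilling.IsKilling G.metric Y →
        ⁅(e X).1, (e Y).1⁆ = (e (SuperKilling.lieBracket X Y)).1) := by
  open SuperKilling SpecialGradedManifold in
  exact ⟨liftVector, liftSpinor, evenLift α, superMetric, nablaOp_apply, fun _ _ _ => rfl,
    evenGauge_apply α, isMetric_superMetric, fun _ hh => hh.eq_superMetric,
    fun _ => ⟨isKilling_of_isEvenKilling, fun hX => isEvenKilling_evenLift hX α⟩,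
    fun _ _ hX hY => lie_evenGauge hX α hY⟩
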